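/- **Setting.** Let $\mathbb{V}$ be one of the real vector spaces $\mathbb{R}^{n_1\times n_2}$, $\mathbb{C}^{n_1\times n_2}$, $\mathcal{S}^n$ (real symmetric) or $\mathcal{H}^n$ (Hermitian), with $n_1=n_2=n$ in the last two cases, with inner product $\langle X,Y\rangle=\mathrm{Re}\,\mathrm{Tr}(X^{\mathbb T}Y)$ (${}^{\mathbb T}$ being the conjugate transpose in the complex case) and Frobenius norm $\|\cdot\|_F$; the sizes are fixed. Let $\Theta_1,\dots,\Theta_d$ be an orthonormal basis of $\mathbb{V}$, $\alpha\subseteq\{1,\dots,d\}$, $\beta$ its complement, $\mathcal{R}_\alpha(X)=(\langle\Theta_k,X\rangle)_{k\in\alpha}$. Let $\overline X\in\mathbb{V}$ with $r=\mathrm{rank}(\overline X)\ge 1$. For $i\ge1$ let $y_i=\langle\Theta_{\omega_i},\overline X\rangle+\nu\xi_i$ with $\nu>0$, where the indices $\omega_i$ are i.i.d. with $\Pr(\omega_i=k)=0$ for $k\in\alpha$ and $\Pr(\omega_i=k)=p_k>0$ for $k\in\beta$, the real noises $\xi_i$ are i.i.d. with $\mathbb{E}\xi_i=0$, $\mathbb{E}\xi_i^2=1$,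 and $(\xi_i)_i$ is independent of $(\omega_i)_i$. Let $\widetilde X_m$ be random matrices in $\mathbb V$ with $\widetilde X_m\to\overline X$ in probability, $\rho_m>0$ deterministic, and $\gamma_m\ge0$ (possibly random). For $\tau,\varepsilon>0$ let $\phi(t)=\mathrm{sgn}(t)(1+\varepsilon^\tau)\frac{|t|^\tau}{|t|^\tau+\varepsilon^\tau}$, $f(0)=0$, $f_i(x)=\phi(x_i/\|x\|_\infty)$ for $x\ne0$, and $F(X)=U\,\mathrm{Diag}(f(\sigma(X)))V^{\mathbb T}$, where $X=U\,\mathrm{Diag}(\sigma(X))V^{\mathbb T}$ is a singular value decomposition with nonincreasing singular values $\sigma(X)$. *Rectangular case* (any of the four spaces $\mathbb V$). $\widehat X_m$ is an optimal solution of $$\min_{X\in\mathbb V}\ \frac1{2m}\sum_{i=1}^m\big(y_i-\langle\Theta_{\omega_i},X\rangle\big)^2+\rho_m\Big(\|X\|_*-\langle F(\widetilde X_m),X\rangle+\frac{\gamma_m}2\|X-\widetilde X_m\|_F^2\Big)\quad\text{s.t. }\mathcal R_\alpha(X)=\mathcal R_\alpha(\overline X),$$ where $\|\cdot\|_*$ is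 the nuclear norm. Constraint nondegeneracy at $\overline X$ means $\mathcal R_\alpha(\{H\in\mathbb V: U_2^{\mathbb T}HV_2=0\})=\mathbb R^{\alpha}$, where $U_2,V_2$ consist of the last $n_1-r$ and $n_2-r$ columns of $U,V$ in a singular value decomposition of $\overline X$. *Positive semidefinite case* ($\mathbb V=\mathcal S^n$ or $\mathcal H^n$, $\overline X$ and all $\widetilde X_m$ positive semidefinite). $\widehat X_m$ is an optimal solution of $$\min_{X\in\mathbb V}\ \frac1{2m}\sum_{i=1}^m\big(y_i-\langle\Theta_{\omega_i},X\rangle\big)^2+\rho_m\Big(\langle I-F(\widetilde X_m),X\rangle+\frac{\gamma_m}2\|X-\widetilde X_m\|_F^2\Big)\quad\text{s.t. }\mathcal R_\alpha(X)=\mathcal R_\alpha(\overline X),\ X\succeq0.$$ Constraint nondegeneracy at $\overline X$ means $\mathcal R_\alpha(\mathcal T\cap(-\mathcal T))=\mathbb R^\alpha$, where $\mathcal T$ is the tangent cone at $\overline X$ of the cone of positive semidefinite matrices in $\mathbb V$. In both cases $\widehat X_m$ is a random matrix that is, almost surely, an optimal solution whenever one exists (and is arbitrary otherwise). **Statement.**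 In either case, suppose that constraint nondegeneracy holds at $\overline X$ and that $\rho_m\to0$, $\sqrt m\,\rho_m\to\infty$ and $\gamma_m=O_p(1)$ (bounded in probability). Then for every $\tau>0$ there is $\overline\varepsilon>0$ such that, for every $0<\varepsilon\le\overline\varepsilon$, the estimator $\widehat X_m$ built with the above $F$ is rank consistent: $$\lim_{m\to\infty}\Pr\big(\mathrm{rank}(\widehat X_m)=\mathrm{rank}(\overline X)\big)=1.$$ -/

import Mathlib

open MeasureTheory ProbabilityTheory Filter Topology Matrix
open scoped ComplexOrder Matrix.Norms.Frobenius

namespace RankCorrection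

noncomputable section

/-! ### Singular values and spectral operators -/

/-- The vector `σ(X)` of the `min n₁ n₂` singular values of `X`, in nonincreasing order. -/
def singVals {𝕜 : Type*} [RCLike 𝕜] {n₁ n₂ : ℕ} (X : Matrix (Fin n₁) (Fin n₂) 𝕜) :
    Fin (min n₁ n₂) → ℝ :=
  fun i => (Matrix.toEuclideanLin X).singularValues i

/-- The rectangular `n₁ × n₂` diagonal matrix with diagonal entries `x`. -/
def rectDiag (𝕜 : Type*) [RCLike 𝕜] {n₁ n₂ : ℕ} (x : Fin (min n₁ n₂) → ℝ) :
    Matrix (Fin n₁) (Fin n₂) 𝕜 :=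
  Matrix.of fun i j =>
    if h : i.val = j.val then ((x ⟨i.val, lt_min i.isLt (h ▸ j.isLt)⟩ : ℝ) : 𝕜) else 0

/-- `(U, W)` is a pair of orthogonal (unitary) matrices with `X = U Diag(σ(X)) Wᴴ`. -/
def IsSVD {𝕜 : Type*} [RCLike 𝕜] {n₁ n₂ : ℕ} (X : Matrix (Fin n₁) (Fin n₂) 𝕜)
    (U : Matrix (Fin n₁) (Fin n₁) 𝕜) (W : Matrix (Fin n₂) (Fin n₂) 𝕜) : Prop :=
  U ∈ Matrix.unitaryGroup (Fin n₁) 𝕜 ∧ W ∈ Matrix.unitaryGroup (Fin n₂) 𝕜 ∧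
    X = U * rectDiag 𝕜 (singVals X) * Wᴴ

/-- Every matrix has a singular value decomposition. -/
theorem exists_isSVD {𝕜 : Type*} [RCLike 𝕜] {n₁ n₂ : ℕ} (X : Matrix (Fin n₁) (Fin n₂) 𝕜) :
    ∃ P : Matrix (Fin n₁) (Fin n₁) 𝕜 × Matrix (Fin n₂) (Fin n₂) 𝕜, IsSVD X P.1 P.2 := by
  classical
  set T := Matrix.toEuclideanLin X with hT
  have hn : Module.finrank 𝕜 (EuclideanSpace 𝕜 (Fin n₂)) = n₂ := by simp
  set b := T.isSymmetric_adjoint_comp_self.eigenvectorBasis hn with hb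
  have hinner : ∀ i j, inner 𝕜 (T (b i)) (T (b j)) =
      if i = j then ((T.singularValues j ^ 2 : ℝ) : 𝕜) else 0 := by
    intro i j
    have h1 : inner 𝕜 (T (b i)) (T (b j)) = inner 𝕜 (b i) ((LinearMap.adjoint T ∘ₗ T) (b j)) := by
      rw [LinearMap.comp_apply, LinearMap.adjoint_inner_right]
    rw [h1, hb, LinearMap.IsSymmetric.apply_eigenvectorBasis, inner_smul_right,
      orthonormal_iff_ite.mp (T.isSymmetric_adjoint_comp_self.eigenvectorBasis hn).orthonormal,
      LinearMap.sq_singularValues_fin T hn j]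
    split_ifs <;> simp
  set v : Fin n₁ → EuclideanSpace 𝕜 (Fin n₁) := fun i =>
    if h : i.val < n₂ then (((T.singularValues i)⁻¹ : ℝ) : 𝕜) • T (b ⟨i.val, h⟩) else 0 with hv
  set s : Set (Fin n₁) := {i | 0 < T.singularValues i} with hs
  have hlt : ∀ i : ℕ, 0 < T.singularValues i → i < n₂ := by
    intro i hi
    by_contra hcon
    rw [T.singularValues_of_finrank_le (by rw [hn]; omega)] at hi
    exact lt_irrefl _ hi
  have hlt1 : ∀ i : ℕ, 0 < T.singularValues i → i < n₁ := by
    intro i hi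
    rw [LinearMap.singularValues_pos_iff_lt_finrank_range] at hi
    have h2 := Submodule.finrank_le (LinearMap.range T)
    rw [finrank_euclideanSpace_fin] at h2
    omega
  have hon : Orthonormal 𝕜 (fun i : s => v i) := by
    rw [orthonormal_iff_ite]
    rintro ⟨i, hi⟩ ⟨j, hj⟩
    have hi' : 0 < T.singularValues i := hi
    have hj' : 0 < T.singularValues j := hj
    simp only [hv, dif_pos (hlt _ hi'), dif_pos (hlt _ hj'),
      inner_smul_left, inner_smul_right, hinner, Subtype.mk.injEq, Fin.ext_iff]
    by_cases hij : i.val = j.val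
    · simp only [hij, if_true, RCLike.conj_ofReal]
      have : (T.singularValues j : ℝ) ≠ 0 := hj'.ne'
      norm_cast
      field_simp
    · simp [hij]
  obtain ⟨c, hc⟩ := Orthonormal.exists_orthonormalBasis_extension_of_card_eq (by simp)
    (v := v) (s := s) hon
  refine ⟨((EuclideanSpace.basisFun (Fin n₁) 𝕜).toBasis.toMatrix c,
    (EuclideanSpace.basisFun (Fin n₂) 𝕜).toBasis.toMatrix b),
    OrthonormalBasis.toMatrix_orthonormalBasis_mem_unitary _ _,
    OrthonormalBasis.toMatrix_orthonormalBasis_mem_unitary _ _, ?_⟩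
  have hW := OrthonormalBasis.toMatrix_orthonormalBasis_mem_unitary
    (EuclideanSpace.basisFun (Fin n₂) 𝕜) b
  set U := (EuclideanSpace.basisFun (Fin n₁) 𝕜).toBasis.toMatrix c with hU
  set W := (EuclideanSpace.basisFun (Fin n₂) 𝕜).toBasis.toMatrix b with hWd
  have key : X * W = U * rectDiag 𝕜 (singVals X) := by
    ext i j
    have hl : (X * W) i j = T (b j) i := by
      simp [hT, hWd, Matrix.mul_apply, Module.Basis.toMatrix_apply, Matrix.mulVec, dotProduct]
    rw [hl, Matrix.mul_apply]
    by_cases hj : 0 < T.singularValues j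
    · have hj1 := hlt1 _ hj
      rw [Finset.sum_eq_single ⟨j.val, hj1⟩]
      · have h3 := hc ⟨j.val, hj1⟩ hj
        have h4 : U i ⟨j.val, hj1⟩ = c ⟨j.val, hj1⟩ i := by
          simp [hU, Module.Basis.toMatrix_apply]
        rw [h4, h3]
        have : ((T.singularValues j : ℝ) : 𝕜) ≠ 0 := by exact_mod_cast hj.ne'
        simp [hv, rectDiag, singVals, ← hT]
        field_simp
      · intro k _ hk
        have : ¬ k.val = j.val := fun h => hk (Fin.ext h)
        simp [rectDiag, this]
      · simp
    · have h0 : T.singularValues j = 0 := le_antisymm (not_lt.mp hj) (T.singularValues_nonneg _)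
      have h5 : T (b j) = 0 := by
        rw [← inner_self_eq_zero (𝕜 := 𝕜), hinner]
        simp [h0]
      rw [h5, Finset.sum_eq_zero]
      · simp
      · intro k _
        by_cases hk : k.val = j.val
        · simp [rectDiag, hk, singVals, ← hT, h0]
        · simp [rectDiag, hk]
  calc X = X * (W * Wᴴ) := by
        rw [← Matrix.star_eq_conjTranspose, (Matrix.mem_unitaryGroup_iff).mp hW, Matrix.mul_one]
    _ = _ := by rw [← Matrix.mul_assoc, key]

/-- The spectral operator `F(X) = U Diag(f(σ(X))) Wᴴ`, `(U, W)` a singular value decomposition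
of `X`, associated with `f`. (For symmetric `f` the value does not depend on the choice of
`(U, W)`.) -/
def spectralOp {𝕜 : Type*} [RCLike 𝕜] {n₁ n₂ : ℕ}
    (f : (Fin (min n₁ n₂) → ℝ) → (Fin (min n₁ n₂) → ℝ))
    (X : Matrix (Fin n₁) (Fin n₂) 𝕜) : Matrix (Fin n₁) (Fin n₂) 𝕜 :=
  (exists_isSVD X).choose.1 * rectDiag 𝕜 (f (singVals X)) * (exists_isSVD X).choose.2ᴴ

/-- `φ(t) = sgn(t) (1 + ε ^ τ) |t| ^ τ / (|t| ^ τ + ε ^ τ)`. -/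
def phi (τ ε t : ℝ) : ℝ :=
  Real.sign t * (1 + ε ^ τ) * (|t| ^ τ / (|t| ^ τ + ε ^ τ))

/-- `f_i(x) = φ(x_i / ‖x‖_∞)` for `x ≠ 0`, and `f(0) = 0`; the norm on `Fin n → ℝ` is the
maximum norm. -/
def rankCorrVec (τ ε : ℝ) {n : ℕ} (x : Fin n → ℝ) : Fin n → ℝ :=
  open Classical in fun i => if x = 0 then 0 else phi τ ε (x i / ‖x‖)

/-- The rank-correction function: the spectral operator associated with `rankCorrVec τ ε`. -/
def rankCorr {𝕜 : Type*} [RCLike 𝕜] (τ ε : ℝ) {n₁ n₂ : ℕ}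
    (X : Matrix (Fin n₁) (Fin n₂) 𝕜) : Matrix (Fin n₁) (Fin n₂) 𝕜 :=
  spectralOp (rankCorrVec τ ε) X

/-- The nuclear norm. -/
def nuclearNorm {𝕜 : Type*} [RCLike 𝕜] {n₁ n₂ : ℕ} (X : Matrix (Fin n₁) (Fin n₂) 𝕜) : ℝ :=
  ∑ i, singVals X i

/-! ### The matrix space and its basis -/

/-- The real trace inner product `Re Tr(Xᴴ Y)`. -/
def trInner {𝕜 : Type*} [RCLike 𝕜] {n₁ n₂ : ℕ} (X Y : Matrix (Fin n₁) (Fin n₂) 𝕜) : ℝ :=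
  RCLike.re (Matrix.trace (Xᴴ * Y))

/-- The real vector space of symmetric (`𝕜 = ℝ`) or Hermitian (`𝕜 = ℂ`) matrices. -/
def hermitianSpace (𝕜 : Type*) [RCLike 𝕜] (n : ℕ) : Submodule ℝ (Matrix (Fin n) (Fin n) 𝕜) where
  carrier := {X | X.IsHermitian}
  add_mem' := fun hX hY => hX.add hY
  zero_mem' := Matrix.isHermitian_zero
  smul_mem' := fun c X hX => by
    have hX' : Xᴴ = X := hX
    change (c • X)ᴴ = c • X
    rw [Matrix.conjTranspose_smul, hX', star_trivial]

/-- The ambient real inner product spaces: all `n₁ × n₂` matrices over `𝕜`, or the symmetric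
(Hermitian) `n × n` matrices. -/
inductive IsMatrixSpace (𝕜 : Type*) [RCLike 𝕜] :
    {n₁ n₂ : ℕ} → Submodule ℝ (Matrix (Fin n₁) (Fin n₂) 𝕜) → Prop
  | full (n₁ n₂ : ℕ) :
      IsMatrixSpace 𝕜 (⊤ : Submodule ℝ (Matrix (Fin n₁) (Fin n₂) 𝕜))
  | hermitian (n : ℕ) : IsMatrixSpace 𝕜 (hermitianSpace 𝕜 n)

/-- `Θ₁, …, Θ_d` is an orthonormal basis of `V` for the trace inner product. -/
structure IsONBasis {𝕜 : Type*} [RCLike 𝕜] {n₁ n₂ d : ℕ}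
    (V : Submodule ℝ (Matrix (Fin n₁) (Fin n₂) 𝕜))
    (Θ : Fin d → Matrix (Fin n₁) (Fin n₂) 𝕜) : Prop where
  inner_eq : ∀ j k, trInner (Θ j) (Θ k) = if j = k then 1 else 0
  span_eq : Submodule.span ℝ (Set.range Θ) = V

/-- The coefficient operator `R_α`, `X ↦ (⟨Θ_k, X⟩)_{k ∈ α}`. -/
def coeffs {𝕜 : Type*} [RCLike 𝕜] {n₁ n₂ d : ℕ} (Θ : Fin d → Matrix (Fin n₁) (Fin n₂) 𝕜)
    (α : Finset (Fin d)) (X : Matrix (Fin n₁) (Fin n₂) 𝕜) : α → ℝ :=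
  fun k => trInner (Θ k) X

/-! ### Constraint nondegeneracy -/

/-- The last `n - r` columns of a square matrix. -/
def lastCols {𝕜 : Type*} {n : ℕ} (r : ℕ) (U : Matrix (Fin n) (Fin n) 𝕜) :
    Matrix (Fin n) {j : Fin n // r ≤ j.val} 𝕜 :=
  U.submatrix id Subtype.val

/-- `T(X) = {H ∈ V | U₂ᴴ H W₂ = 0}`, where `U₂`, `W₂` are the last `n₁ - rank X` and
`n₂ - rank X` columns of `U`, `W` for singular value decompositions `(U, W)` of `X`. -/
def tangentSpace {𝕜 : Type*} [RCLike 𝕜] {n₁ n₂ : ℕ}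
    (V : Submodule ℝ (Matrix (Fin n₁) (Fin n₂) 𝕜)) (X : Matrix (Fin n₁) (Fin n₂) 𝕜) :
    Set (Matrix (Fin n₁) (Fin n₂) 𝕜) :=
  {H | H ∈ V ∧ ∀ U W, IsSVD X U W → (lastCols X.rank U)ᴴ * H * lastCols X.rank W = 0}

/-- Constraint nondegeneracy for the problem without the semidefinite constraint:
`R_α(T(X)) = ℝ^α`. -/
def ConstraintNondeg {𝕜 : Type*} [RCLike 𝕜] {n₁ n₂ d : ℕ}
    (V : Submodule ℝ (Matrix (Fin n₁) (Fin n₂) 𝕜)) (Θ : Fin d → Matrix (Fin n₁) (Fin n₂) 𝕜)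
    (α : Finset (Fin d)) (X : Matrix (Fin n₁) (Fin n₂) 𝕜) : Prop :=
  coeffs Θ α '' tangentSpace V X = Set.univ

/-- The lineality space `T ∩ (-T)` of the tangent cone `T` of the cone of positive semidefinite
matrices at `X`. -/
def psdLineality {𝕜 : Type*} [RCLike 𝕜] {n : ℕ} (X : Matrix (Fin n) (Fin n) 𝕜) :
    Set (Matrix (Fin n) (Fin n) 𝕜) :=
  {H | H ∈ posTangentConeAt {Y : Matrix (Fin n) (Fin n) 𝕜 | Y.PosSemidef} X ∧
    -H ∈ posTangentConeAt {Y : Matrix (Fin n) (Fin n) 𝕜 | Y.PosSemidef} X}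

/-- Constraint nondegeneracy for the problem with the semidefinite constraint. -/
def ConstraintNondegPSD {𝕜 : Type*} [RCLike 𝕜] {n d : ℕ}
    (Θ : Fin d → Matrix (Fin n) (Fin n) 𝕜)
    (α : Finset (Fin d)) (X : Matrix (Fin n) (Fin n) 𝕜) : Prop :=
  coeffs Θ α '' psdLineality X = Set.univ

/-! ### The observations and the rank-correction step -/

/-- The sampling scheme: i.i.d. indices `ω_i` with law `p` supported exactly on the complement of
`α`, and i.i.d. noises `ξ_i` with mean zero and second moment one, independent of the indices. -/
structure IsSampling {Ω : Type*} [MeasurableSpace Ω] (μ : Measure Ω) {d : ℕ}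
    (α : Finset (Fin d)) (p : Fin d → ℝ) (ω : ℕ → Ω → Fin d) (ξ : ℕ → Ω → ℝ) : Prop where
  prob_fixed : ∀ k ∈ α, p k = 0
  prob_pos : ∀ k ∉ α, 0 < p k
  measurable_index : ∀ i, Measurable (ω i)
  law_index : ∀ i k, μ {x | ω i x = k} = ENNReal.ofReal (p k)
  indep_index : iIndepFun ω μ
  measurable_noise : ∀ i, Measurable (ξ i)
  identDistrib_noise : ∀ i, IdentDistrib (ξ i) (ξ 0) μ μ
  indep_noise : iIndepFun ξ μ
  memLp_noise : MemLp (ξ 0) 2 μ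
  mean_noise : ∫ x, ξ 0 x ∂μ = 0
  variance_noise : ∫ x, ξ 0 x ^ 2 ∂μ = 1
  indep_index_noise : IndepFun (fun x i => ω i x) (fun x i => ξ i x) μ

/-- `x_m = O_p(1)`: the sequence is bounded in probability. -/
def BoundedInProb {Ω : Type*} [MeasurableSpace Ω] (μ : Measure Ω) (x : ℕ → Ω → ℝ) : Prop :=
  ∀ δ : ℝ, 0 < δ → ∃ M : ℝ, ∀ᶠ m in atTop, μ {a | M < |x m a|} ≤ ENNReal.ofReal δ

/-- Entrywise measurability of a random matrix. -/
def MeasurableMatrix {𝕜 : Type*} [RCLike 𝕜] {Ω : Type*} [MeasurableSpace Ω] {n₁ n₂ : ℕ}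
    (X : Ω → Matrix (Fin n₁) (Fin n₂) 𝕜) : Prop :=
  ∀ i j, Measurable fun a => X a i j

/-- The least squares loss `(1 / 2m) ‖y - R_Ω(X)‖²`, with the observations
`y_i = ⟨Θ_{ω_i}, Xbar⟩ + ν ξ_i`, `i < m`. -/
def loss {𝕜 : Type*} [RCLike 𝕜] {n₁ n₂ d : ℕ} (Θ : Fin d → Matrix (Fin n₁) (Fin n₂) 𝕜)
    (Xbar : Matrix (Fin n₁) (Fin n₂) 𝕜) (ν : ℝ) (m : ℕ) (ω : ℕ → Fin d) (ξ : ℕ → ℝ)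
    (X : Matrix (Fin n₁) (Fin n₂) 𝕜) : ℝ :=
  1 / (2 * (m : ℝ)) *
    ∑ i ∈ Finset.range m, ((trInner (Θ (ω i)) Xbar + ν * ξ i) - trInner (Θ (ω i)) X) ^ 2

/-- The objective of the rank-correction step, with correction matrix `G = F(X̃_m)`. -/
def objective {𝕜 : Type*} [RCLike 𝕜] {n₁ n₂ d : ℕ} (Θ : Fin d → Matrix (Fin n₁) (Fin n₂) 𝕜)
    (Xbar : Matrix (Fin n₁) (Fin n₂) 𝕜) (ν : ℝ) (m : ℕ) (ω : ℕ → Fin d) (ξ : ℕ → ℝ) (ρ γ : ℝ)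
    (G Xtilde X : Matrix (Fin n₁) (Fin n₂) 𝕜) : ℝ :=
  loss Θ Xbar ν m ω ξ X +
    ρ * (nuclearNorm X - trInner G X + γ / 2 * ‖X - Xtilde‖ ^ 2)

/-- The objective of the rank-correction step in the positive semidefinite case. -/
def objectivePSD {𝕜 : Type*} [RCLike 𝕜] {n d : ℕ} (Θ : Fin d → Matrix (Fin n) (Fin n) 𝕜)
    (Xbar : Matrix (Fin n) (Fin n) 𝕜) (ν : ℝ) (m : ℕ) (ω : ℕ → Fin d) (ξ : ℕ → ℝ) (ρ γ : ℝ)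
    (G Xtilde X : Matrix (Fin n) (Fin n) 𝕜) : ℝ :=
  loss Θ Xbar ν m ω ξ X + ρ * (trInner (1 - G) X + γ / 2 * ‖X - Xtilde‖ ^ 2)

/-- The matrices in `V` with the same fixed coefficients as `Xbar`. -/
def feasible {𝕜 : Type*} [RCLike 𝕜] {n₁ n₂ d : ℕ}
    (V : Submodule ℝ (Matrix (Fin n₁) (Fin n₂) 𝕜)) (Θ : Fin d → Matrix (Fin n₁) (Fin n₂) 𝕜)
    (α : Finset (Fin d)) (Xbar : Matrix (Fin n₁) (Fin n₂) 𝕜) :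
    Set (Matrix (Fin n₁) (Fin n₂) 𝕜) :=
  {X | X ∈ V ∧ coeffs Θ α X = coeffs Θ α Xbar}

/-- The positive semidefinite matrices with the same fixed coefficients as `Xbar`. -/
def feasiblePSD {𝕜 : Type*} [RCLike 𝕜] {n d : ℕ} (Θ : Fin d → Matrix (Fin n) (Fin n) 𝕜)
    (α : Finset (Fin d)) (Xbar : Matrix (Fin n) (Fin n) 𝕜) : Set (Matrix (Fin n) (Fin n) 𝕜) :=
  {X | X ∈ feasible (hermitianSpace 𝕜 n) Θ α Xbar ∧ X.PosSemidef}

/-- `X` minimizes `Φ` over `S`. -/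
def IsMinimizer {E : Type*} (Φ : E → ℝ) (S : Set E) (X : E) : Prop :=
  X ∈ S ∧ ∀ Y ∈ S, Φ X ≤ Φ Y

/-- `X` is an optimal solution of the problem of minimizing `Φ` over `S`; if the problem has no
optimal solution, `X` is arbitrary. -/
def Solves {E : Type*} (Φ : E → ℝ) (S : Set E) (X : E) : Prop :=
  (∃ Y, IsMinimizer Φ S Y) → IsMinimizer Φ S X

/-- Rank consistency: `Pr(rank X_m = rank Xbar) → 1`. -/
def RankConsistent {𝕜 : Type*} [RCLike 𝕜] {Ω : Type*} [MeasurableSpace Ω] (μ : Measure Ω)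
    {n₁ n₂ : ℕ} (X : ℕ → Ω → Matrix (Fin n₁) (Fin n₂) 𝕜)
    (Xbar : Matrix (Fin n₁) (Fin n₂) 𝕜) : Prop :=
  Tendsto (fun m => μ {a | (X m a).rank = Xbar.rank}) atTop (𝓝 1)

end

end RankCorrection

namespace RankCorrection

/-! ### The trace inner product -/

section TraceInner

variable {𝕜 : Type*} [RCLike 𝕜] {n₁ n₂ : ℕ}

/-! The argument compares values of the objective; no multipliers or limit problems enter. Write `Π`
for `polarFactor Xbar`, a subgradient of the nuclear norm at `Xbar`, and `r` for the rank of `Xbar`.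

Correction. For small `ε`, `F` maps a neighbourhood of `Xbar` close to `Π`
(`exists_eventually_norm_rankCorr_sub_lt`). The norm of `F` is at most about `√r` because the
trailing singular values of a nearby matrix are small, and `F` is well aligned with `Π` because it
almost norms the matrix. No perturbation theory of singular vectors is needed.

Location. On the feasible set the loss grows quadratically around `Xbar`, up to a linear noise term.
Since `Π` is a subgradient and `F(X̃)` is within `δ` of it, the penalty can fall by at most `O(ρ δ
‖X - Xbar‖)`. Hence minimizers exist and lie within `O(δ ρ)` of `Xbar`
(`norm_sub_le_of_objective_le`); in particular their rank is at least `r`.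

Excess rank is impossible. If `X` is near `Xbar` and has rank above `r`, its singular dyads `u_k
v_kᴴ` with positive singular value sum to a contraction, whose pairing with `Π` is at most `r`; so
one dyad `E` pairs with `Π` to at most `r / (r + 1)`. Constraint nondegeneracy gives a bounded `K`,
tangent at `Xbar`, with the same fixed coefficients as `E`. Along `H = K - E` the fixed coefficients
do not change. A contraction norming `X + t H` almost norms both `X` and `Xbar`, so it is nearly `1`
on `E` and nearly `Π` on `K`: the nuclear norm falls faster than `t ⟨Π, H⟩` by a fixed rate
(`HasRankDescent`). The loss and the remaining penalty terms change by only `O(δ ρ)` per unit of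
`t`, so for small `δ` the objective decreases, contradicting optimality
(`exists_rank_eq_of_solves`). In the Hermitian space `E` is first projected. In the semidefinite
problem the nuclear norm is the trace, and a small multiple of the identity is added to `H` to stay
in the cone.

Probability. Chebyshev's inequality makes the sampling frequencies bounded below and the averaged
noise at most `δ ρ_m`, the latter because `√m ρ_m → ∞`. All required events have probability tending
to one. -/

theorem trInner_eq_sum (X Y : Matrix (Fin n₁) (Fin n₂) 𝕜) :
    trInner X Y = ∑ i, ∑ j, RCLike.re (star (X i j) * Y i j) := by
  simp only [trInner, Matrix.trace, Matrix.diag_apply, Matrix.mul_apply, conjTranspose_apply,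
    map_sum]
  exact Finset.sum_comm

theorem trInner_add_right (X Y Z : Matrix (Fin n₁) (Fin n₂) 𝕜) :
    trInner X (Y + Z) = trInner X Y + trInner X Z := by
  simp [trInner, Matrix.mul_add]

theorem trInner_sub_right (X Y Z : Matrix (Fin n₁) (Fin n₂) 𝕜) :
    trInner X (Y - Z) = trInner X Y - trInner X Z := by
  simp [trInner, Matrix.mul_sub]

theorem trInner_neg_right (X Y : Matrix (Fin n₁) (Fin n₂) 𝕜) :
    trInner X (-Y) = -trInner X Y := by
  simp [trInner]

theorem trInner_smul_right (c : ℝ) (X Y : Matrix (Fin n₁) (Fin n₂) 𝕜) :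
    trInner X (c • Y) = c * trInner X Y := by
  simp [trInner, Matrix.trace_smul, RCLike.smul_re]

theorem trInner_comm (X Y : Matrix (Fin n₁) (Fin n₂) 𝕜) : trInner X Y = trInner Y X := by
  have h : (Yᴴ * X).trace = star (Xᴴ * Y).trace := by
    rw [← trace_conjTranspose, conjTranspose_mul, conjTranspose_conjTranspose]
  rw [trInner, trInner, h, RCLike.star_def, RCLike.conj_re]

theorem trInner_add_left (X Y Z : Matrix (Fin n₁) (Fin n₂) 𝕜) :
    trInner (X + Y) Z = trInner X Z + trInner Y Z := by
  rw [trInner_comm, trInner_add_right, trInner_comm Z, trInner_comm Z]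

theorem trInner_sub_left (X Y Z : Matrix (Fin n₁) (Fin n₂) 𝕜) :
    trInner (X - Y) Z = trInner X Z - trInner Y Z := by
  rw [trInner_comm, trInner_sub_right, trInner_comm Z, trInner_comm Z]

theorem trInner_smul_left (c : ℝ) (X Y : Matrix (Fin n₁) (Fin n₂) 𝕜) :
    trInner (c • X) Y = c * trInner X Y := by
  rw [trInner_comm, trInner_smul_right, trInner_comm]

theorem trInner_sum_right {ι : Type*} (s : Finset ι) (X : Matrix (Fin n₁) (Fin n₂) 𝕜)
    (Y : ι → Matrix (Fin n₁) (Fin n₂) 𝕜) :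
    trInner X (∑ i ∈ s, Y i) = ∑ i ∈ s, trInner X (Y i) := by
  simp [trInner, Matrix.mul_sum, Matrix.trace_sum]

theorem frobenius_norm_sq (X : Matrix (Fin n₁) (Fin n₂) 𝕜) :
    ‖X‖ ^ 2 = ∑ i, ∑ j, ‖X i j‖ ^ 2 := by
  have h : (0 : ℝ) ≤ ∑ i, ∑ j, ‖X i j‖ ^ 2 := by positivity
  rw [frobenius_norm_def, ← Real.sqrt_eq_rpow]
  simp only [Real.rpow_two]
  exact Real.sq_sqrt h

theorem trInner_self (X : Matrix (Fin n₁) (Fin n₂) 𝕜) : trInner X X = ‖X‖ ^ 2 := by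
  rw [trInner_eq_sum, frobenius_norm_sq]
  refine Finset.sum_congr rfl fun i _ => Finset.sum_congr rfl fun j _ => ?_
  rw [RCLike.star_def, RCLike.conj_mul, ← RCLike.ofReal_pow, RCLike.ofReal_re]

/-- Cauchy–Schwarz: `‖t • X - Y‖ ^ 2` is a nonnegative quadratic polynomial in `t`, so its
discriminant is nonpositive. -/
theorem trInner_le (X Y : Matrix (Fin n₁) (Fin n₂) 𝕜) : trInner X Y ≤ ‖X‖ * ‖Y‖ := by
  have h (t : ℝ) : 0 ≤ ‖X‖ ^ 2 * (t * t) + (-2 * trInner X Y) * t + ‖Y‖ ^ 2 := by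
    have := sq_nonneg ‖t • X - Y‖
    rw [← trInner_self, trInner_sub_left, trInner_sub_right, trInner_sub_right,
      trInner_smul_left, trInner_smul_left, trInner_smul_right, trInner_smul_right,
      trInner_self, trInner_self, trInner_comm Y X] at this
    linarith
  have := discrim_le_zero h
  rw [discrim] at this
  exact (abs_le_of_sq_le_sq' (by nlinarith) (by positivity)).2

theorem abs_trInner_le (X Y : Matrix (Fin n₁) (Fin n₂) 𝕜) : |trInner X Y| ≤ ‖X‖ * ‖Y‖ := by
  rw [abs_le]
  have h := trInner_le X (-Y)
  rw [trInner_neg_right, norm_neg] at h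
  exact ⟨by linarith, trInner_le X Y⟩

theorem trInner_mul_left {k : ℕ} (A : Matrix (Fin n₁) (Fin k) 𝕜) (X : Matrix (Fin k) (Fin n₂) 𝕜)
    (Y : Matrix (Fin n₁) (Fin n₂) 𝕜) : trInner (A * X) Y = trInner X (Aᴴ * Y) := by
  rw [trInner, trInner, conjTranspose_mul, Matrix.mul_assoc]

theorem trInner_mul_right {k : ℕ} (X : Matrix (Fin n₁) (Fin k) 𝕜) (A : Matrix (Fin k) (Fin n₂) 𝕜)
    (Y : Matrix (Fin n₁) (Fin n₂) 𝕜) : trInner (X * A) Y = trInner X (Y * Aᴴ) := by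
  rw [trInner, trInner, conjTranspose_mul, Matrix.mul_assoc, Matrix.trace_mul_comm,
    Matrix.mul_assoc]

theorem trInner_conjTranspose (X Y : Matrix (Fin n₁) (Fin n₂) 𝕜) :
    trInner Xᴴ Yᴴ = trInner X Y := by
  rw [trInner_comm X, trInner, trInner, conjTranspose_conjTranspose, Matrix.trace_mul_comm]

variable {U : Matrix (Fin n₁) (Fin n₁) 𝕜} {W : Matrix (Fin n₂) (Fin n₂) 𝕜}

theorem conjTranspose_mul_self_of_mem (hU : U ∈ unitaryGroup (Fin n₁) 𝕜) : Uᴴ * U = 1 :=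
  mem_unitaryGroup_iff'.mp hU

theorem mul_conjTranspose_self_of_mem (hU : U ∈ unitaryGroup (Fin n₁) 𝕜) : U * Uᴴ = 1 :=
  mem_unitaryGroup_iff.mp hU

theorem conjTranspose_mem (hU : U ∈ unitaryGroup (Fin n₁) 𝕜) : Uᴴ ∈ unitaryGroup (Fin n₁) 𝕜 :=
  Unitary.star_mem hU

theorem norm_unitary_mul (hU : U ∈ unitaryGroup (Fin n₁) 𝕜) (X : Matrix (Fin n₁) (Fin n₂) 𝕜) :
    ‖U * X‖ = ‖X‖ := by
  have : ‖U * X‖ ^ 2 = ‖X‖ ^ 2 := by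
    rw [← trInner_self, ← trInner_self, trInner_mul_left, ← Matrix.mul_assoc,
      conjTranspose_mul_self_of_mem hU, Matrix.one_mul]
  exact (pow_left_inj₀ (norm_nonneg _) (norm_nonneg _) two_ne_zero).mp this

theorem norm_mul_unitary (hW : W ∈ unitaryGroup (Fin n₂) 𝕜) (X : Matrix (Fin n₁) (Fin n₂) 𝕜) :
    ‖X * W‖ = ‖X‖ := by
  have : ‖X * W‖ ^ 2 = ‖X‖ ^ 2 := by
    rw [← trInner_self, ← trInner_self, trInner_mul_right, Matrix.mul_assoc,
      mul_conjTranspose_self_of_mem hW, Matrix.mul_one]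
  exact (pow_left_inj₀ (norm_nonneg _) (norm_nonneg _) two_ne_zero).mp this

theorem trInner_unitary_conj (A X : Matrix (Fin n₁) (Fin n₂) 𝕜) :
    trInner A (U * X * Wᴴ) = trInner (Uᴴ * A * W) X := by
  rw [trInner_mul_right, trInner_mul_left, conjTranspose_conjTranspose, ← Matrix.mul_assoc]

/-- Conjugation by unitary matrices is undone by the adjoint conjugation. -/
theorem unitary_conj_conj (hU : U ∈ unitaryGroup (Fin n₁) 𝕜) (hW : W ∈ unitaryGroup (Fin n₂) 𝕜)
    (X : Matrix (Fin n₁) (Fin n₂) 𝕜) : U * (Uᴴ * X * W) * Wᴴ = X := by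
  simp only [Matrix.mul_assoc]
  rw [mul_conjTranspose_self_of_mem hW, Matrix.mul_one, ← Matrix.mul_assoc,
    mul_conjTranspose_self_of_mem hU, Matrix.one_mul]

theorem unitary_conj_conj' (hU : U ∈ unitaryGroup (Fin n₁) 𝕜) (hW : W ∈ unitaryGroup (Fin n₂) 𝕜)
    (X : Matrix (Fin n₁) (Fin n₂) 𝕜) : Uᴴ * (U * X * Wᴴ) * W = X := by
  simp only [Matrix.mul_assoc]
  rw [conjTranspose_mul_self_of_mem hW, Matrix.mul_one, ← Matrix.mul_assoc,
    conjTranspose_mul_self_of_mem hU, Matrix.one_mul]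

theorem norm_entry_le (X : Matrix (Fin n₁) (Fin n₂) 𝕜) (i : Fin n₁) (j : Fin n₂) :
    ‖X i j‖ ≤ ‖X‖ := by
  refine abs_le_of_sq_le_sq' ?_ (norm_nonneg _) |>.2
  rw [frobenius_norm_sq]
  exact (Finset.single_le_sum (f := fun j => ‖X i j‖ ^ 2) (fun _ _ => by positivity)
    (Finset.mem_univ j)).trans (Finset.single_le_sum (f := fun i => ∑ j, ‖X i j‖ ^ 2)
      (fun _ _ => by positivity) (Finset.mem_univ i))

end TraceInner

/-! ### Rectangular diagonal matrices -/

section RectDiag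

variable {𝕜 : Type*} [RCLike 𝕜] {n₁ n₂ : ℕ}

/-- The row index of the `k`-th diagonal position. -/
def rowIdx (k : Fin (min n₁ n₂)) : Fin n₁ := Fin.castLE (min_le_left _ _) k

/-- The column index of the `k`-th diagonal position. -/
def colIdx (k : Fin (min n₁ n₂)) : Fin n₂ := Fin.castLE (min_le_right _ _) k

theorem rectDiag_eq_sum (x : Fin (min n₁ n₂) → ℝ) :
    rectDiag 𝕜 x = ∑ k, Matrix.single (rowIdx k) (colIdx k) ((x k : ℝ) : 𝕜) := by
  ext i j
  rw [Matrix.sum_apply]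
  by_cases h : i.val = j.val
  · have hi : i.val < min n₁ n₂ := lt_min i.isLt (h ▸ j.isLt)
    rw [Finset.sum_eq_single ⟨i.val, hi⟩]
    · have h1 : rowIdx (n₂ := n₂) ⟨i.val, hi⟩ = i := Fin.ext rfl
      have h2 : colIdx (n₁ := n₁) ⟨i.val, hi⟩ = j := Fin.ext h
      rw [h1, h2]
      simp [rectDiag, h]
    · intro k _ hk
      rw [Matrix.single_apply_of_ne]
      rintro ⟨h1, -⟩
      exact hk (Fin.ext (by simpa [rowIdx] using congrArg Fin.val h1))
    · simp
  · rw [Finset.sum_eq_zero]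
    · simp [rectDiag, h]
    · intro k _
      rw [Matrix.single_apply_of_ne]
      rintro ⟨h1, h2⟩
      exact h (by rw [← h1, ← h2]; rfl)

theorem trInner_rectDiag (A : Matrix (Fin n₁) (Fin n₂) 𝕜) (x : Fin (min n₁ n₂) → ℝ) :
    trInner A (rectDiag 𝕜 x) = ∑ k, x k * RCLike.re (A (rowIdx k) (colIdx k)) := by
  rw [rectDiag_eq_sum, trInner_sum_right]
  refine Finset.sum_congr rfl fun k _ => ?_
  rw [trInner, trace_mul_single]
  simp [mul_comm]

theorem rectDiag_apply_diag (x : Fin (min n₁ n₂) → ℝ) (k : Fin (min n₁ n₂)) :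
    rectDiag 𝕜 x (rowIdx k) (colIdx k) = ((x k : ℝ) : 𝕜) := by
  simp [rectDiag, rowIdx, colIdx]

theorem norm_rectDiag_sq (x : Fin (min n₁ n₂) → ℝ) :
    ‖(rectDiag 𝕜 x : Matrix (Fin n₁) (Fin n₂) 𝕜)‖ ^ 2 = ∑ k, x k ^ 2 := by
  rw [← trInner_self, trInner_rectDiag]
  simp [rectDiag_apply_diag, sq]

theorem rectDiag_sum {ι : Type*} (s : Finset ι) (x : ι → Fin (min n₁ n₂) → ℝ) :
    (rectDiag 𝕜 (∑ i ∈ s, x i) : Matrix (Fin n₁) (Fin n₂) 𝕜) = ∑ i ∈ s, rectDiag 𝕜 (x i) := by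
  ext i j
  rw [Matrix.sum_apply]
  by_cases h : i.val = j.val <;> simp [rectDiag, h]

end RectDiag

/-! ### Contractions -/

section Contraction

variable {𝕜 : Type*} [RCLike 𝕜] {n₁ n₂ : ℕ}

/-- Matrices of spectral norm at most one. -/
def IsContraction (A : Matrix (Fin n₁) (Fin n₂) 𝕜) : Prop :=
  ∀ B : Matrix (Fin n₂) (Fin 1) 𝕜, ‖A * B‖ ≤ ‖B‖

theorem IsContraction.mul {k : ℕ} {A : Matrix (Fin n₁) (Fin k) 𝕜} {B : Matrix (Fin k) (Fin n₂) 𝕜}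
    (hA : IsContraction A) (hB : IsContraction B) : IsContraction (A * B) := fun C => by
  rw [Matrix.mul_assoc]
  exact (hA _).trans (hB C)

theorem isContraction_of_unitary {U : Matrix (Fin n₁) (Fin n₁) 𝕜}
    (hU : U ∈ unitaryGroup (Fin n₁) 𝕜) : IsContraction U :=
  fun B => (norm_unitary_mul hU B).le

theorem IsContraction.conjTranspose {A : Matrix (Fin n₁) (Fin n₂) 𝕜} (hA : IsContraction A) :
    IsContraction Aᴴ := fun B => by
  -- `‖Aᴴ B‖² = ⟨B, A Aᴴ B⟩`, and `A` does not increase the norm of `Aᴴ B`.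
  have h : ‖Aᴴ * B‖ ^ 2 ≤ ‖B‖ * ‖Aᴴ * B‖ := by
    rw [← trInner_self]
    nth_rewrite 1 [trInner_mul_left]
    rw [conjTranspose_conjTranspose]
    exact (trInner_le _ _).trans (mul_le_mul_of_nonneg_left (hA _) (norm_nonneg _))
  rcases (norm_nonneg (Aᴴ * B)).eq_or_lt with h0 | h0
  · rw [← h0]; exact norm_nonneg _
  · nlinarith

theorem IsContraction.convex {A B : Matrix (Fin n₁) (Fin n₂) 𝕜} (hA : IsContraction A)
    (hB : IsContraction B) : IsContraction ((1 / 2 : ℝ) • (A + B)) := fun C => by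
  rw [Matrix.smul_mul, Matrix.add_mul, norm_smul]
  have := norm_add_le (A * C) (B * C)
  have := hA C
  have := hB C
  norm_num
  linarith

theorem IsContraction.sum_col_le {A : Matrix (Fin n₁) (Fin n₂) 𝕜} (hA : IsContraction A)
    (j : Fin n₂) : ∑ i, ‖A i j‖ ^ 2 ≤ 1 := by
  have h := hA (Matrix.of fun k _ => if k = j then 1 else 0)
  have h1 : ‖A * (Matrix.of fun k _ => if k = j then 1 else 0 : Matrix (Fin n₂) (Fin 1) 𝕜)‖ ^ 2
      = ∑ i, ‖A i j‖ ^ 2 := by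
    rw [frobenius_norm_sq]
    simp [Matrix.mul_apply]
  have h2 : ‖(Matrix.of fun k _ => if k = j then 1 else 0 : Matrix (Fin n₂) (Fin 1) 𝕜)‖ ^ 2
      = 1 := by
    rw [frobenius_norm_sq]
    simp [apply_ite norm, ite_pow]
  rw [← h1, ← h2]
  gcongr

theorem IsContraction.sum_row_le {A : Matrix (Fin n₁) (Fin n₂) 𝕜} (hA : IsContraction A)
    (i : Fin n₁) : ∑ j, ‖A i j‖ ^ 2 ≤ 1 := by
  simpa using hA.conjTranspose.sum_col_le i

theorem IsContraction.re_le {A : Matrix (Fin n₁) (Fin n₂) 𝕜} (hA : IsContraction A)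
    (i : Fin n₁) (j : Fin n₂) : RCLike.re (A i j) ≤ 1 := by
  refine (RCLike.re_le_norm _).trans ((sq_le_one_iff₀ (norm_nonneg _)).mp ?_)
  exact (Finset.single_le_sum (f := fun j => ‖A i j‖ ^ 2) (fun _ _ => by positivity)
    (Finset.mem_univ j)).trans (hA.sum_row_le i)

theorem IsContraction.abs_re_le {A : Matrix (Fin n₁) (Fin n₂) 𝕜} (hA : IsContraction A)
    (i : Fin n₁) (j : Fin n₂) : |RCLike.re (A i j)| ≤ 1 := by
  refine (RCLike.abs_re_le_norm _).trans ((sq_le_one_iff₀ (norm_nonneg _)).mp ?_)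
  exact (Finset.single_le_sum (f := fun j => ‖A i j‖ ^ 2) (fun _ _ => by positivity)
    (Finset.mem_univ j)).trans (hA.sum_row_le i)

theorem isContraction_rectDiag {x : Fin (min n₁ n₂) → ℝ} (hx : ∀ k, |x k| ≤ 1) :
    IsContraction (rectDiag 𝕜 x : Matrix (Fin n₁) (Fin n₂) 𝕜) := fun B => by
  refine abs_le_of_sq_le_sq' ?_ (norm_nonneg _) |>.2
  rw [frobenius_norm_sq, frobenius_norm_sq]
  simp only [Finset.univ_unique, Finset.sum_singleton]
  have h1 : ∀ i : Fin n₁, ‖((rectDiag 𝕜 x : Matrix (Fin n₁) (Fin n₂) 𝕜) * B) i default‖ ^ 2 ≤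
      ∑ j : Fin n₂, if i.val = j.val then ‖B j default‖ ^ 2 else 0 := by
    intro i
    rw [Matrix.mul_apply]
    by_cases hi : i.val < n₂
    · rw [Finset.sum_eq_single ⟨i.val, hi⟩, Finset.sum_eq_single ⟨i.val, hi⟩]
      · simp only [rectDiag, of_apply, dif_pos, if_true, norm_mul, RCLike.norm_ofReal, mul_pow]
        have := hx ⟨i.val, lt_min i.isLt hi⟩
        have : |x ⟨i.val, lt_min i.isLt hi⟩| ^ 2 ≤ 1 := pow_le_one₀ (abs_nonneg _) this
        exact mul_le_of_le_one_left (by positivity) this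
      · intro j _ hj
        rw [if_neg fun h => hj (Fin.ext h.symm)]
      · simp
      · intro j _ hj
        have : ¬ i.val = j.val := fun h => hj (Fin.ext h.symm)
        simp [rectDiag, this]
      · simp
    · rw [Finset.sum_eq_zero]
      · simp only [norm_zero, ne_eq, OfNat.ofNat_ne_zero, not_false_eq_true, zero_pow]
        positivity
      · intro j _
        have : ¬ i.val = j.val := by have := j.isLt; omega
        simp [rectDiag, this]
  refine (Finset.sum_le_sum fun i _ => h1 i).trans ?_
  rw [Finset.sum_comm]
  refine Finset.sum_le_sum fun j _ => ?_
  by_cases hj : j.val < n₁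
  · rw [Finset.sum_eq_single ⟨j.val, hj⟩]
    · simp
    · intro i _ hi
      rw [if_neg fun h => hi (Fin.ext h)]
    · simp
  · rw [Finset.sum_eq_zero]
    · positivity
    · intro i _
      rw [if_neg]
      have := i.isLt
      omega

theorem isContraction_unitary_rectDiag {U : Matrix (Fin n₁) (Fin n₁) 𝕜}
    {W : Matrix (Fin n₂) (Fin n₂) 𝕜} (hU : U ∈ unitaryGroup (Fin n₁) 𝕜)
    (hW : W ∈ unitaryGroup (Fin n₂) 𝕜) {x : Fin (min n₁ n₂) → ℝ} (hx : ∀ k, |x k| ≤ 1) :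
    IsContraction (U * rectDiag 𝕜 x * Wᴴ) :=
  ((isContraction_of_unitary hU).mul (isContraction_rectDiag hx)).mul
    (isContraction_of_unitary (conjTranspose_mem hW))

theorem IsContraction.unitary_conj {A : Matrix (Fin n₁) (Fin n₂) 𝕜} (hA : IsContraction A)
    {U : Matrix (Fin n₁) (Fin n₁) 𝕜} {W : Matrix (Fin n₂) (Fin n₂) 𝕜}
    (hU : U ∈ unitaryGroup (Fin n₁) 𝕜) (hW : W ∈ unitaryGroup (Fin n₂) 𝕜) :
    IsContraction (Uᴴ * A * W) :=
  ((isContraction_of_unitary (conjTranspose_mem hU)).mul hA).mul (isContraction_of_unitary hW)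

/-- A contraction pairs with a matrix to at most the sum of the moduli of the diagonal
coefficients of the matrix. -/
theorem IsContraction.trInner_le_sum {A : Matrix (Fin n₁) (Fin n₂) 𝕜} (hA : IsContraction A)
    {U : Matrix (Fin n₁) (Fin n₁) 𝕜} {W : Matrix (Fin n₂) (Fin n₂) 𝕜}
    (hU : U ∈ unitaryGroup (Fin n₁) 𝕜) (hW : W ∈ unitaryGroup (Fin n₂) 𝕜)
    (x : Fin (min n₁ n₂) → ℝ) : trInner A (U * rectDiag 𝕜 x * Wᴴ) ≤ ∑ k, |x k| := by
  rw [trInner_unitary_conj, trInner_rectDiag]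
  refine Finset.sum_le_sum fun k _ => ?_
  refine (le_abs_self _).trans ?_
  rw [abs_mul]
  exact mul_le_of_le_one_right (abs_nonneg _) ((hA.unitary_conj hU hW).abs_re_le _ _)

end Contraction

/-! ### Singular values and the nuclear norm -/

section Nuclear

variable {𝕜 : Type*} [RCLike 𝕜] {n₁ n₂ : ℕ}

theorem singVals_nonneg (X : Matrix (Fin n₁) (Fin n₂) 𝕜) (k : Fin (min n₁ n₂)) :
    0 ≤ singVals X k := LinearMap.singularValues_nonneg _ _

theorem rank_eq_finrank_range_toEuclideanLin (X : Matrix (Fin n₁) (Fin n₂) 𝕜) :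
    X.rank = Module.finrank 𝕜 (Matrix.toEuclideanLin X).range := by
  rw [Matrix.toEuclideanLin, Matrix.toLpLin_eq_toLin]
  exact rank_eq_finrank_range_toLin X _ _

theorem singVals_pos_iff (X : Matrix (Fin n₁) (Fin n₂) 𝕜) (k : Fin (min n₁ n₂)) :
    0 < singVals X k ↔ k.val < X.rank := by
  rw [rank_eq_finrank_range_toEuclideanLin]
  exact LinearMap.singularValues_pos_iff_lt_finrank_range _

theorem singVals_antitone (X : Matrix (Fin n₁) (Fin n₂) 𝕜) : Antitone (singVals X) :=
  fun _ _ h => LinearMap.singularValues_antitone _ h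

theorem rank_le_min (X : Matrix (Fin n₁) (Fin n₂) 𝕜) : X.rank ≤ min n₁ n₂ :=
  le_min (by simpa using X.rank_le_card_height) (by simpa using X.rank_le_card_width)

theorem card_singVals_pos (X : Matrix (Fin n₁) (Fin n₂) 𝕜) :
    (Finset.univ.filter fun k => 0 < singVals X k).card = X.rank := by
  simp only [singVals_pos_iff]
  rw [Fin.card_filter_val_lt, min_eq_right (rank_le_min X)]

/-- With `exists_isContraction_trInner_eq`, this says that the nuclear norm is dual to the spectral
norm. All later facts about the nuclear norm, its continuity and its subgradients included, come
from this duality. -/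
theorem IsContraction.trInner_le_nuclearNorm {A : Matrix (Fin n₁) (Fin n₂) 𝕜}
    (hA : IsContraction A) (X : Matrix (Fin n₁) (Fin n₂) 𝕜) : trInner A X ≤ nuclearNorm X := by
  obtain ⟨⟨U, W⟩, hU, hW, hX⟩ := exists_isSVD X
  have h := hA.trInner_le_sum hU hW (singVals X)
  simp only at hX
  rw [← hX] at h
  simpa [nuclearNorm, abs_of_nonneg (singVals_nonneg X _)] using h

theorem exists_isContraction_trInner_eq (X : Matrix (Fin n₁) (Fin n₂) 𝕜) :
    ∃ A : Matrix (Fin n₁) (Fin n₂) 𝕜, IsContraction A ∧ trInner A X = nuclearNorm X := by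
  obtain ⟨⟨U, W⟩, hU, hW, hX⟩ := exists_isSVD X
  refine ⟨U * rectDiag 𝕜 (fun _ => 1) * Wᴴ,
    isContraction_unitary_rectDiag hU hW (by simp), ?_⟩
  nth_rewrite 1 [hX]
  rw [trInner_unitary_conj, unitary_conj_conj' hU hW, trInner_rectDiag]
  simp [rectDiag_apply_diag, nuclearNorm]

/-- The entries of `x` may be negative or unordered, so the bound applies to eigenvalue
decompositions, which need not be singular value decompositions. -/
theorem nuclearNorm_le_sum {U : Matrix (Fin n₁) (Fin n₁) 𝕜} {W : Matrix (Fin n₂) (Fin n₂) 𝕜}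
    (hU : U ∈ unitaryGroup (Fin n₁) 𝕜) (hW : W ∈ unitaryGroup (Fin n₂) 𝕜)
    (x : Fin (min n₁ n₂) → ℝ) : nuclearNorm (U * rectDiag 𝕜 x * Wᴴ) ≤ ∑ k, |x k| := by
  obtain ⟨A, hA, h⟩ := exists_isContraction_trInner_eq (U * rectDiag 𝕜 x * Wᴴ)
  rw [← h]
  exact hA.trInner_le_sum hU hW x

theorem IsContraction.norm_sq_le {A : Matrix (Fin n₁) (Fin n₂) 𝕜} (hA : IsContraction A) :
    ‖A‖ ^ 2 ≤ n₁ := by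
  rw [frobenius_norm_sq]
  exact (Finset.sum_le_sum fun i _ => hA.sum_row_le i).trans (by simp)

theorem IsContraction.norm_le {A : Matrix (Fin n₁) (Fin n₂) 𝕜} (hA : IsContraction A) :
    ‖A‖ ≤ √(n₁ : ℝ) := Real.le_sqrt_of_sq_le hA.norm_sq_le

theorem IsContraction.abs_trInner_le {A : Matrix (Fin n₁) (Fin n₂) 𝕜} (hA : IsContraction A)
    (X : Matrix (Fin n₁) (Fin n₂) 𝕜) : |trInner A X| ≤ √(n₁ : ℝ) * ‖X‖ :=
  (RankCorrection.abs_trInner_le A X).trans (by gcongr; exact hA.norm_le)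

theorem nuclearNorm_le_add (X Y : Matrix (Fin n₁) (Fin n₂) 𝕜) :
    nuclearNorm X ≤ nuclearNorm Y + √(n₁ : ℝ) * ‖X - Y‖ := by
  obtain ⟨A, hA, h⟩ := exists_isContraction_trInner_eq X
  have h1 := hA.trInner_le_nuclearNorm Y
  have h2 := (le_abs_self _).trans (hA.abs_trInner_le (X - Y))
  rw [trInner_sub_right] at h2
  linarith

theorem continuous_nuclearNorm :
    Continuous (nuclearNorm : Matrix (Fin n₁) (Fin n₂) 𝕜 → ℝ) := by
  refine LipschitzWith.continuous (K := ⟨√(n₁ : ℝ), Real.sqrt_nonneg _⟩)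
    (LipschitzWith.of_le_add_mul _ fun X Y => ?_)
  rw [dist_eq_norm]
  exact nuclearNorm_le_add X Y

end Nuclear

/-! ### The polar factor and almost norming contractions -/

section Polar

variable {𝕜 : Type*} [RCLike 𝕜] {n₁ n₂ : ℕ}

/-- The partial isometry `U₁ W₁ᴴ` of a singular value decomposition. -/
noncomputable def polarFactor (X : Matrix (Fin n₁) (Fin n₂) 𝕜) : Matrix (Fin n₁) (Fin n₂) 𝕜 :=
  (exists_isSVD X).choose.1 * rectDiag 𝕜 (fun k => if 0 < singVals X k then 1 else 0) *
    (exists_isSVD X).choose.2ᴴ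

theorem isContraction_polarFactor (X : Matrix (Fin n₁) (Fin n₂) 𝕜) :
    IsContraction (polarFactor X) := by
  obtain ⟨hU, hW, -⟩ := (exists_isSVD X).choose_spec
  refine isContraction_unitary_rectDiag hU hW fun k => ?_
  split_ifs <;> simp

theorem trInner_polarFactor_self (X : Matrix (Fin n₁) (Fin n₂) 𝕜) :
    trInner (polarFactor X) X = nuclearNorm X := by
  obtain ⟨hU, hW, hX⟩ := (exists_isSVD X).choose_spec
  nth_rewrite 2 [hX]
  rw [trInner_unitary_conj, polarFactor, unitary_conj_conj' hU hW, trInner_rectDiag, nuclearNorm]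
  refine Finset.sum_congr rfl fun k _ => ?_
  rw [rectDiag_apply_diag, RCLike.ofReal_re]
  split_ifs with h
  · simp
  · rw [le_antisymm (not_lt.mp h) (singVals_nonneg X k), zero_mul]

theorem norm_polarFactor_sq (X : Matrix (Fin n₁) (Fin n₂) 𝕜) :
    ‖polarFactor X‖ ^ 2 = X.rank := by
  obtain ⟨hU, hW, -⟩ := (exists_isSVD X).choose_spec
  rw [polarFactor, norm_mul_unitary (conjTranspose_mem hW), norm_unitary_mul hU,
    norm_rectDiag_sq, ← card_singVals_pos]
  simp

/-- The polar factor has singular values `1`, repeated `X.rank` times, and `0`. This bound drives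
the averaging argument of `exists_trInner_polarFactor_le`. -/
theorem IsContraction.trInner_polarFactor_le {A : Matrix (Fin n₁) (Fin n₂) 𝕜}
    (hA : IsContraction A) (X : Matrix (Fin n₁) (Fin n₂) 𝕜) :
    trInner A (polarFactor X) ≤ X.rank := by
  obtain ⟨hU, hW, -⟩ := (exists_isSVD X).choose_spec
  refine (hA.trInner_le_sum hU hW _).trans (le_of_eq ?_)
  rw [← card_singVals_pos]
  simp [apply_ite abs]

/-- The nuclear norm is bounded below by its linearization at `X` along the polar factor. -/
theorem nuclearNorm_add_trInner_polarFactor_le (X Y : Matrix (Fin n₁) (Fin n₂) 𝕜) :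
    nuclearNorm X + trInner (polarFactor X) (Y - X) ≤ nuclearNorm Y := by
  have := (isContraction_polarFactor X).trInner_le_nuclearNorm Y
  rw [trInner_sub_right, trInner_polarFactor_self]
  linarith

theorem exists_pos_le_singVals (X : Matrix (Fin n₁) (Fin n₂) 𝕜) :
    ∃ s : ℝ, 0 < s ∧ ∀ k, 0 < singVals X k → s ≤ singVals X k := by
  classical
  by_cases hne : (Finset.univ.filter fun k => 0 < singVals X k).Nonempty
  · obtain ⟨k, hk, hmin⟩ := Finset.exists_min_image _ (singVals X) hne
    exact ⟨singVals X k, (Finset.mem_filter.mp hk).2,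
      fun j hj => hmin j (Finset.mem_filter.mpr ⟨Finset.mem_univ _, hj⟩)⟩
  · refine ⟨1, one_pos, fun k hk => (hne ⟨k, ?_⟩).elim⟩
    exact Finset.mem_filter.mpr ⟨Finset.mem_univ _, hk⟩

/-- In singular bases of `X` the duality gap of a contraction `A` is a sum of nonnegative terms. A
small gap therefore forces the diagonal entries of `Uᴴ * A * W` to be near `1` wherever the singular
value is positive. -/
theorem nuclearNorm_sub_trInner {X : Matrix (Fin n₁) (Fin n₂) 𝕜}
    {U : Matrix (Fin n₁) (Fin n₁) 𝕜} {W : Matrix (Fin n₂) (Fin n₂) 𝕜} (h : IsSVD X U W)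
    (A : Matrix (Fin n₁) (Fin n₂) 𝕜) :
    nuclearNorm X - trInner A X =
      ∑ k, singVals X k * (1 - RCLike.re ((Uᴴ * A * W) (rowIdx k) (colIdx k))) := by
  obtain ⟨hU, hW, hX⟩ := h
  have : trInner A X = trInner A (U * rectDiag 𝕜 (singVals X) * Wᴴ) := by rw [← hX]
  rw [this, trInner_unitary_conj, trInner_rectDiag, nuclearNorm, ← Finset.sum_sub_distrib]
  refine Finset.sum_congr rfl fun k _ => by ring

theorem IsContraction.singVals_mul_le {A X : Matrix (Fin n₁) (Fin n₂) 𝕜} (hA : IsContraction A)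
    {U : Matrix (Fin n₁) (Fin n₁) 𝕜} {W : Matrix (Fin n₂) (Fin n₂) 𝕜} (h : IsSVD X U W)
    (k : Fin (min n₁ n₂)) :
    singVals X k * (1 - RCLike.re ((Uᴴ * A * W) (rowIdx k) (colIdx k))) ≤
      nuclearNorm X - trInner A X := by
  rw [nuclearNorm_sub_trInner h]
  refine Finset.single_le_sum (f := fun k => singVals X k *
    (1 - RCLike.re ((Uᴴ * A * W) (rowIdx k) (colIdx k)))) (fun k _ => ?_) (Finset.mem_univ k)
  exact mul_nonneg (singVals_nonneg _ _)
    (sub_nonneg.mpr ((hA.unitary_conj h.1 h.2.1).re_le _ _))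

/-- In a contraction, a row with an entry of real part close to one is close to a unit vector. -/
theorem IsContraction.sum_row_sub_le {A : Matrix (Fin n₁) (Fin n₂) 𝕜} (hA : IsContraction A)
    (i : Fin n₁) (j : Fin n₂) :
    ∑ l, ‖A i l - if l = j then 1 else 0‖ ^ 2 ≤ 2 * (1 - RCLike.re (A i j)) := by
  -- `|a - 1|² = |a|² + 1 - 2 Re a` at the distinguished entry; the squared moduli of the row sum to
  -- at most `1`.
  have h : ∀ l, ‖A i l - if l = j then 1 else 0‖ ^ 2 =
      ‖A i l‖ ^ 2 + if l = j then 1 - 2 * RCLike.re (A i l) else 0 := by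
    intro l
    split_ifs
    · rw [← RCLike.normSq_eq_def', ← RCLike.normSq_eq_def', RCLike.normSq_apply,
        RCLike.normSq_apply]
      simp
      ring
    · simp
  simp only [h, Finset.sum_add_distrib, Finset.sum_ite_eq', Finset.mem_univ, if_true]
  linarith [hA.sum_row_le i]

theorem IsContraction.norm_sub_le_of_row {A : Matrix (Fin n₁) (Fin n₂) 𝕜} (hA : IsContraction A)
    (i : Fin n₁) (j l : Fin n₂) :
    ‖A i l - if l = j then 1 else 0‖ ≤ √(2 * (1 - RCLike.re (A i j))) :=
  Real.le_sqrt_of_sq_le ((Finset.single_le_sum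
    (f := fun l => ‖A i l - if l = j then 1 else 0‖ ^ 2) (fun _ _ => by positivity)
    (Finset.mem_univ l)).trans (hA.sum_row_sub_le i j))

theorem IsContraction.norm_sub_le_of_col {A : Matrix (Fin n₁) (Fin n₂) 𝕜} (hA : IsContraction A)
    (i l : Fin n₁) (j : Fin n₂) :
    ‖A l j - if l = i then 1 else 0‖ ≤ √(2 * (1 - RCLike.re (A i j))) := by
  have h := hA.conjTranspose.norm_sub_le_of_row j i l
  have e : Aᴴ j l - (if l = i then 1 else 0) = star (A l j - if l = i then 1 else 0) := by
    rw [conjTranspose_apply, star_sub]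
    split_ifs <;> simp
  rw [e, norm_star, conjTranspose_apply, RCLike.star_def, RCLike.conj_re] at h
  exact h

/-- A contraction that almost norms `X` almost agrees with the polar factor on the tangent
space of the manifold of matrices of fixed rank at `X`. -/
theorem exists_abs_trInner_sub_polarFactor_le (X : Matrix (Fin n₁) (Fin n₂) 𝕜) :
    ∃ c : ℝ, 0 ≤ c ∧ ∀ A : Matrix (Fin n₁) (Fin n₂) 𝕜, IsContraction A →
      ∀ (V : Submodule ℝ (Matrix (Fin n₁) (Fin n₂) 𝕜)), ∀ K ∈ tangentSpace V X,
        |trInner A K - trInner (polarFactor X) K| ≤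
          c * √(nuclearNorm X - trInner A X) * ‖K‖ := by
  obtain ⟨s, hs, hmin⟩ := exists_pos_le_singVals X
  set U := (exists_isSVD X).choose.1 with hUdef
  set W := (exists_isSVD X).choose.2 with hWdef
  have hSVD : IsSVD X U W := (exists_isSVD X).choose_spec
  have ⟨hU, hW, _⟩ := hSVD
  refine ⟨n₁ * n₂ * √(2 / s), by positivity, fun A hA V K hK => ?_⟩
  set q := √(nuclearNorm X - trInner A X) with hq
  set D : Matrix (Fin n₁) (Fin n₂) 𝕜 :=
    rectDiag 𝕜 (fun k => if 0 < singVals X k then 1 else 0) with hD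
  set A' := Uᴴ * A * W with hA'
  set K' := Uᴴ * K * W with hK'
  have hcA' : IsContraction A' := hA.unitary_conj hU hW
  have h1 : trInner A K - trInner (polarFactor X) K = trInner (A' - D) K' := by
    rw [← trInner_sub_left]
    nth_rewrite 1 [← unitary_conj_conj hU hW K]
    rw [trInner_unitary_conj, Matrix.mul_sub, Matrix.sub_mul, polarFactor,
      unitary_conj_conj' hU hW]
  have hnK : ‖K'‖ = ‖K‖ := by
    rw [hK', norm_mul_unitary hW, norm_unitary_mul (conjTranspose_mem hU)]
  -- Tangency kills the block in which nothing is known about `A'`; all other entries lie in a row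
  -- or a column through a positive singular value.
  have hzero : ∀ i j, X.rank ≤ i.val → X.rank ≤ j.val → K' i j = 0 := by
    intro i j hi hj
    have h := congrFun (congrFun (hK.2 U W hSVD) ⟨i, hi⟩) ⟨j, hj⟩
    simpa [lastCols, hK', Matrix.mul_apply] using h
  have hrank := rank_le_min X
  -- The gap dominates `s * (1 - Re A'_kk)`, since the positive singular values are at least `s`.
  have hbound : ∀ k : Fin (min n₁ n₂), k.val < X.rank →
      √(2 * (1 - RCLike.re (A' (rowIdx k) (colIdx k)))) ≤ √(2 / s) * q := by
    intro k hk
    have hpos := (singVals_pos_iff X k).mpr hk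
    have h2 := hA.singVals_mul_le hSVD k
    have h3 : 0 ≤ 1 - RCLike.re (A' (rowIdx k) (colIdx k)) := sub_nonneg.mpr (hcA'.re_le _ _)
    have h4 : s * (1 - RCLike.re (A' (rowIdx k) (colIdx k))) ≤ nuclearNorm X - trInner A X :=
      (mul_le_mul_of_nonneg_right (hmin k hpos) h3).trans h2
    rw [hq, ← Real.sqrt_mul (by positivity)]
    refine Real.sqrt_le_sqrt ?_
    rw [div_mul_eq_mul_div, le_div_iff₀ hs]
    linarith
  -- A row or column of a contraction whose diagonal entry is nearly `1` is nearly a coordinate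
  -- vector, as is the corresponding row or column of `D`.
  have hent : ∀ i j, (i.val < X.rank ∨ j.val < X.rank) → ‖(A' - D) i j‖ ≤ √(2 / s) * q := by
    rintro i j (hi | hj)
    · set k : Fin (min n₁ n₂) := ⟨i.val, lt_of_lt_of_le hi hrank⟩ with hk
      refine le_trans (le_of_eq ?_)
        ((hcA'.norm_sub_le_of_row (rowIdx k) (colIdx k) j).trans (hbound k hi))
      have e1 : rowIdx k = i := Fin.ext rfl
      rw [e1, Matrix.sub_apply]
      congr 2
      have hpos := (singVals_pos_iff X k).mpr hi
      by_cases hij : i.val = j.val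
      · have : j = colIdx k := Fin.ext hij.symm
        rw [if_pos this]
        simp only [hD, rectDiag, of_apply, dif_pos hij]
        rw [if_pos hpos, RCLike.ofReal_one]
      · have : j ≠ colIdx k := fun h => hij (by rw [h]; rfl)
        rw [if_neg this]
        simp only [hD, rectDiag, of_apply, dif_neg hij]
    · set k : Fin (min n₁ n₂) := ⟨j.val, lt_of_lt_of_le hj hrank⟩ with hk
      refine le_trans (le_of_eq ?_)
        ((hcA'.norm_sub_le_of_col (rowIdx k) i (colIdx k)).trans (hbound k hj))
      have e1 : colIdx k = j := Fin.ext rfl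
      rw [e1, Matrix.sub_apply]
      congr 2
      have hpos := (singVals_pos_iff X k).mpr hj
      by_cases hij : i.val = j.val
      · have h5 : i = rowIdx k := Fin.ext hij
        have h6 : 0 < singVals X ⟨i.val, lt_min i.isLt (hij ▸ j.isLt)⟩ := by
          rw [singVals_pos_iff]; simpa [hij] using hj
        rw [if_pos h5]
        simp only [hD, rectDiag, of_apply, dif_pos hij]
        rw [if_pos h6, RCLike.ofReal_one]
      · have : i ≠ rowIdx k := fun h => hij (by rw [h]; rfl)
        rw [if_neg this]
        simp only [hD, rectDiag, of_apply, dif_neg hij]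
  rw [h1, trInner_eq_sum]
  have hterm : ∀ i j, |RCLike.re (star ((A' - D) i j) * K' i j)| ≤ √(2 / s) * q * ‖K‖ := by
    intro i j
    by_cases hij : i.val < X.rank ∨ j.val < X.rank
    · refine (RCLike.abs_re_le_norm _).trans ?_
      rw [norm_mul, norm_star]
      exact mul_le_mul (hent i j hij) (hnK ▸ norm_entry_le K' i j) (norm_nonneg _) (by positivity)
    · push Not at hij
      rw [hzero i j hij.1 hij.2]
      simp only [mul_zero, map_zero, abs_zero]
      positivity
  calc |∑ i, ∑ j, RCLike.re (star ((A' - D) i j) * K' i j)|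
      ≤ ∑ i, ∑ j, |RCLike.re (star ((A' - D) i j) * K' i j)| :=
        (Finset.abs_sum_le_sum_abs _ _).trans
          (Finset.sum_le_sum fun i _ => Finset.abs_sum_le_sum_abs _ _)
    _ ≤ ∑ _i : Fin n₁, ∑ _j : Fin n₂, √(2 / s) * q * ‖K‖ :=
        Finset.sum_le_sum fun i _ => Finset.sum_le_sum fun j _ => hterm i j
    _ = n₁ * n₂ * √(2 / s) * q * ‖K‖ := by simp; ring

end Polar

/-! ### Perturbation of singular values -/

section Perturbation

variable {𝕜 : Type*} [RCLike 𝕜] {n₁ n₂ : ℕ}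

/-- The `k`-th singular value is at most the distance to any matrix of rank at most `k`. -/
theorem singVals_le_norm_sub (X Y : Matrix (Fin n₁) (Fin n₂) 𝕜) (k : Fin (min n₁ n₂))
    (hk : Y.rank ≤ k.val) : singVals X k ≤ ‖X - Y‖ := by
  obtain ⟨⟨U, W⟩, hU, hW, hX⟩ := exists_isSVD X
  simp only at hU hW hX
  have hle : k.val + 1 ≤ min n₁ n₂ := k.isLt
  set f : Fin (k.val + 1) → Fin n₂ := fun i => colIdx (Fin.castLE hle i) with hf
  have hfinj : Function.Injective f := fun a b h => Fin.ext (by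
    simpa [hf, colIdx] using congrArg Fin.val h)
  have hrk : (Y * W.submatrix id f).rank < k.val + 1 :=
    lt_of_le_of_lt (rank_mul_le_left _ _) (by omega)
  -- Dimension count: on the span of the first `k + 1` right singular vectors of `X`, the matrix `Y`
  -- of rank at most `k` kills some nonzero `W * d`. There `X` agrees with `X - Y` and stretches by
  -- at least the singular value of index `k`.
  obtain ⟨c, hc0, hc⟩ : ∃ c : Fin (k.val + 1) → 𝕜, c ≠ 0 ∧ (Y * W.submatrix id f) *ᵥ c = 0 := by
    have hker : (LinearMap.ker ((Y * W.submatrix id f).mulVecLin.rangeRestrict)) ≠ ⊥ := by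
      refine LinearMap.ker_ne_bot_of_finrank_lt ?_
      rw [Module.finrank_fin_fun]
      exact hrk
    obtain ⟨c, hc, hc0⟩ := (Submodule.ne_bot_iff _).mp hker
    rw [LinearMap.ker_rangeRestrict] at hc
    exact ⟨c, hc0, by simpa using hc⟩
  set d : Matrix (Fin n₂) (Fin 1) 𝕜 :=
    Matrix.of fun j _ => ∑ i, if f i = j then c i else 0 with hd
  have hdf : ∀ i, d (f i) 0 = c i := by
    intro i
    simp [hd, hfinj.eq_iff]
  have hd0 : ∀ j, (∀ i, f i ≠ j) → d j 0 = 0 := by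
    intro j hj
    simp [hd, hj]
  have hYd : Y * (W * d) = 0 := by
    rw [← Matrix.mul_assoc]
    ext a b
    have := congrFun hc a
    simp only [Matrix.mul_apply, mulVec, dotProduct, submatrix_apply, id_eq, Pi.zero_apply] at this
    rw [Matrix.mul_apply]
    simp only [hd, of_apply, Matrix.zero_apply, Finset.mul_sum, mul_ite, mul_zero]
    rw [Finset.sum_comm]
    simp only [Finset.sum_ite_eq, Finset.mem_univ, if_true]
    simpa [Matrix.mul_apply] using this
  have hsum : ∀ g : Fin n₂ → ℝ, (∀ j, (∀ i, f i ≠ j) → g j = 0) → ∑ j, g j = ∑ i, g (f i) := by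
    intro g hg
    rw [← Finset.sum_image (f := g) (s := Finset.univ) (g := f) (fun a _ b _ h => hfinj h)]
    refine (Finset.sum_subset (Finset.subset_univ _) fun j _ hj => hg j fun i hi => hj ?_).symm
    exact Finset.mem_image.mpr ⟨i, Finset.mem_univ _, hi⟩
  have hnd : ‖d‖ ^ 2 = ∑ i, ‖c i‖ ^ 2 := by
    rw [frobenius_norm_sq]
    simp only [Finset.univ_unique, Finset.sum_singleton]
    rw [hsum (fun j => ‖d j default‖ ^ 2)]
    · exact Finset.sum_congr rfl fun i _ => by rw [← hdf i]; rfl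
    · intro j hj
      have := hd0 j hj
      simp only [Fin.default_eq_zero, Fin.isValue, this]
      simp
  have hdpos : 0 < ‖d‖ := by
    rw [norm_pos_iff]
    intro h
    refine hc0 (funext fun i => ?_)
    rw [← hdf i, h]
    rfl
  have hlow : singVals X k ^ 2 * ‖d‖ ^ 2 ≤ ‖rectDiag 𝕜 (singVals X) * d‖ ^ 2 := by
    rw [hnd, frobenius_norm_sq, Finset.mul_sum]
    simp only [Finset.univ_unique, Finset.sum_singleton]
    set e : Fin (k.val + 1) → Fin n₁ := fun i => rowIdx (Fin.castLE hle i) with he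
    have heinj : Function.Injective e := fun a b h => Fin.ext (by
      simpa [he, rowIdx] using congrArg Fin.val h)
    calc ∑ i, singVals X k ^ 2 * ‖c i‖ ^ 2
        ≤ ∑ i, ‖((rectDiag 𝕜 (singVals X) : Matrix (Fin n₁) (Fin n₂) 𝕜) * d) (e i) default‖ ^ 2 :=
          Finset.sum_le_sum fun i _ => ?_
      _ ≤ _ := by
          rw [← Finset.sum_image (s := Finset.univ) (g := e) (f := fun a =>
            ‖((rectDiag 𝕜 (singVals X) : Matrix (Fin n₁) (Fin n₂) 𝕜) * d) a default‖ ^ 2)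
            (fun a _ b _ h => heinj h)]
          exact Finset.sum_le_sum_of_subset_of_nonneg (Finset.subset_univ _)
            fun _ _ _ => by positivity
    rw [Matrix.mul_apply, Finset.sum_eq_single (f i)]
    · rw [show d (f i) default = c i from hdf i]
      have e1 : (rectDiag 𝕜 (singVals X) : Matrix (Fin n₁) (Fin n₂) 𝕜) (e i) (f i) = _ :=
        rectDiag_apply_diag (singVals X) (Fin.castLE hle i)
      rw [e1, norm_mul, mul_pow, RCLike.norm_ofReal, sq_abs]
      refine mul_le_mul_of_nonneg_right ?_ (by positivity)
      refine pow_le_pow_left₀ (singVals_nonneg _ _) (singVals_antitone X ?_) 2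
      rw [Fin.le_def]
      have := i.isLt
      simp only [Fin.val_castLE]
      omega
    · intro j _ hj
      have : ¬ (e i).val = j.val := fun h => hj (Fin.ext h.symm)
      simp [rectDiag, this]
    · simp
  have hup : ‖rectDiag 𝕜 (singVals X) * d‖ ≤ ‖X - Y‖ * ‖d‖ := by
    have e1 : (X - Y) * (W * d) = U * (rectDiag 𝕜 (singVals X) * d) := by
      rw [Matrix.sub_mul, hYd, sub_zero]
      nth_rewrite 1 [hX]
      simp only [Matrix.mul_assoc]
      rw [← Matrix.mul_assoc Wᴴ, conjTranspose_mul_self_of_mem hW, Matrix.one_mul]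
    rw [← norm_unitary_mul hU, ← e1, ← norm_unitary_mul hW d]
    exact frobenius_norm_mul _ _
  have h3 : singVals X k * ‖d‖ ≤ ‖X - Y‖ * ‖d‖ := by
    refine le_trans ?_ hup
    refine abs_le_of_sq_le_sq' ?_ (norm_nonneg _) |>.2
    rw [mul_pow]
    exact hlow
  exact le_of_mul_le_mul_right h3 hdpos

end Perturbation

/-! ### The rank-correction function near a fixed matrix -/

section Phi

variable {τ ε t : ℝ}

theorem phi_of_nonneg (hτ : 0 < τ) (ht : 0 ≤ t) :
    phi τ ε t = (1 + ε ^ τ) * (t ^ τ / (t ^ τ + ε ^ τ)) := by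
  rcases ht.eq_or_lt with rfl | h
  · simp [phi, Real.zero_rpow hτ.ne']
  · rw [phi, Real.sign_of_pos h, abs_of_pos h, one_mul]

theorem phi_nonneg (hτ : 0 < τ) (hε : 0 < ε) (ht : 0 ≤ t) : 0 ≤ phi τ ε t := by
  rw [phi_of_nonneg hτ ht]
  positivity

theorem phi_le_one (hτ : 0 < τ) (hε : 0 < ε) (ht : 0 ≤ t) (ht1 : t ≤ 1) : phi τ ε t ≤ 1 := by
  rw [phi_of_nonneg hτ ht, mul_div_assoc', div_le_one (by positivity)]
  have h1 : t ^ τ ≤ 1 := Real.rpow_le_one ht ht1 hτ.le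
  have h2 : 0 ≤ ε ^ τ := by positivity
  nlinarith

/-- For fixed `ε` this makes `φ` vanish at `0` at rate `t ^ τ`, which suppresses the trailing
singular values of matrices near `Xbar`. -/
theorem phi_le_mul_rpow (hτ : 0 < τ) (hε : 0 < ε) (ht : 0 ≤ t) :
    phi τ ε t ≤ (1 + ε ^ τ) / ε ^ τ * t ^ τ := by
  rw [phi_of_nonneg hτ ht, div_mul_eq_mul_div, mul_div_assoc]
  have h2 : 0 < ε ^ τ := by positivity
  have h3 : 0 ≤ t ^ τ := by positivity
  gcongr
  linarith

theorem mul_one_sub_phi_le (hτ : 0 < τ) (hε : 0 < ε) (ht : 0 ≤ t) :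
    t * (1 - phi τ ε t) ≤ t * (ε ^ τ / (t ^ τ + ε ^ τ)) := by
  refine mul_le_mul_of_nonneg_left ?_ ht
  rw [phi_of_nonneg hτ ht, mul_div_assoc', sub_le_iff_le_add, ← add_div,
    le_div_iff₀ (by positivity)]
  have h1 : 0 ≤ ε ^ τ * t ^ τ := by positivity
  nlinarith

/-- Splitting at `t = √ε` gives a bound uniform in `t`: below, the factor `t` is small; above, `ε ^
τ / t ^ τ ≤ √ε ^ τ`. -/
theorem mul_one_sub_phi_le_add (hτ : 0 < τ) (hε : 0 < ε) (ht : 0 ≤ t) (ht1 : t ≤ 1) :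
    t * (1 - phi τ ε t) ≤ √ε + √ε ^ τ := by
  refine (mul_one_sub_phi_le hτ hε ht).trans ?_
  have hs : 0 < √ε := Real.sqrt_pos.mpr hε
  have he : 0 < ε ^ τ := by positivity
  have h3 : 0 ≤ t ^ τ := by positivity
  rcases le_total t (√ε) with h | h
  · have h1 : ε ^ τ / (t ^ τ + ε ^ τ) ≤ 1 := by
      rw [div_le_one (by positivity)]
      linarith
    have h2 : t * (ε ^ τ / (t ^ τ + ε ^ τ)) ≤ t * 1 := by gcongr
    have h4 : 0 ≤ √ε ^ τ := by positivity
    linarith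
  · have h1 : ε ^ τ / (t ^ τ + ε ^ τ) ≤ √ε ^ τ := by
      rw [div_le_iff₀ (by positivity)]
      have e1 : ε ^ τ = √ε ^ τ * √ε ^ τ := by
        rw [← Real.mul_rpow hs.le hs.le, Real.mul_self_sqrt hε.le]
      have h5 : √ε ^ τ ≤ t ^ τ := Real.rpow_le_rpow hs.le h hτ.le
      have h6 : 0 ≤ √ε ^ τ := by positivity
      nlinarith
    have h2 : t * (ε ^ τ / (t ^ τ + ε ^ τ)) ≤ 1 * (√ε ^ τ) := by gcongr
    linarith

end Phi

/-! ### Alignment and Frobenius norm of the rank-correction function -/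

section RankCorr

variable {𝕜 : Type*} [RCLike 𝕜] {n₁ n₂ : ℕ}

theorem singVals_div_norm_mem (X : Matrix (Fin n₁) (Fin n₂) 𝕜) (k : Fin (min n₁ n₂)) :
    0 ≤ singVals X k / ‖singVals X‖ ∧ singVals X k / ‖singVals X‖ ≤ 1 := by
  refine ⟨div_nonneg (singVals_nonneg X k) (norm_nonneg _), div_le_one_of_le₀ ?_ (norm_nonneg _)⟩
  exact (le_abs_self _).trans (norm_le_pi_norm (singVals X) k)

theorem rankCorrVec_apply {n : ℕ} {x : Fin n → ℝ} (hx : x ≠ 0) (τ ε : ℝ) (k : Fin n) :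
    rankCorrVec τ ε x k = phi τ ε (x k / ‖x‖) := by
  rw [rankCorrVec, if_neg hx]

theorem nuclearNorm_le_card_mul_norm (X : Matrix (Fin n₁) (Fin n₂) 𝕜) :
    nuclearNorm X ≤ (min n₁ n₂ : ℕ) * ‖singVals X‖ := by
  calc nuclearNorm X ≤ ∑ _k : Fin (min n₁ n₂), ‖singVals X‖ :=
        Finset.sum_le_sum fun k _ => (le_abs_self _).trans (norm_le_pi_norm (singVals X) k)
    _ = _ := by simp

theorem norm_singVals_le_nuclearNorm (X : Matrix (Fin n₁) (Fin n₂) 𝕜) :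
    ‖singVals X‖ ≤ nuclearNorm X := by
  have h0 : 0 ≤ nuclearNorm X := Finset.sum_nonneg fun k _ => singVals_nonneg X k
  refine (pi_norm_le_iff_of_nonneg h0).mpr fun k => ?_
  rw [Real.norm_of_nonneg (singVals_nonneg X k)]
  exact Finset.single_le_sum (f := singVals X) (fun k _ => singVals_nonneg X k) (Finset.mem_univ k)

theorem nuclearNorm_pos {X : Matrix (Fin n₁) (Fin n₂) 𝕜} (h : 1 ≤ X.rank) :
    0 < nuclearNorm X := by
  have hk : 0 < min n₁ n₂ := lt_of_lt_of_le h (rank_le_min X)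
  exact ((singVals_pos_iff X ⟨0, hk⟩).mpr h).trans_le
    (Finset.single_le_sum (f := singVals X) (fun k _ => singVals_nonneg X k) (Finset.mem_univ _))

/-- Both sides are sums over the singular directions of `X`. The right side weights each defect by
its singular value, which is at least `s` when positive. -/
theorem sub_trInner_polarFactor_le {A X : Matrix (Fin n₁) (Fin n₂) 𝕜} (hA : IsContraction A)
    {s : ℝ} (hmin : ∀ k, 0 < singVals X k → s ≤ singVals X k) :
    s * (X.rank - trInner A (polarFactor X)) ≤ nuclearNorm X - trInner A X := by
  have h := (exists_isSVD X).choose_spec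
  obtain ⟨hU, hW, -⟩ := (exists_isSVD X).choose_spec
  rw [nuclearNorm_sub_trInner h, polarFactor, trInner_unitary_conj, trInner_rectDiag]
  rw [← card_singVals_pos, Finset.card_filter, Nat.cast_sum, ← Finset.sum_sub_distrib,
    Finset.mul_sum]
  refine Finset.sum_le_sum fun k _ => ?_
  have h0 := (hA.unitary_conj hU hW).re_le (rowIdx k) (colIdx k)
  split_ifs with hk
  · rw [Nat.cast_one, one_mul]
    exact mul_le_mul_of_nonneg_right (hmin k hk) (sub_nonneg.mpr h0)
  · simp only [Nat.cast_zero, zero_mul, sub_zero, mul_zero]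
    exact mul_nonneg (singVals_nonneg X k) (sub_nonneg.mpr h0)

section Bounds

variable {τ ε : ℝ} {X : Matrix (Fin n₁) (Fin n₂) 𝕜}

theorem rankCorrVec_singVals_mem (hτ : 0 < τ) (hε : 0 < ε) (hX : singVals X ≠ 0)
    (k : Fin (min n₁ n₂)) :
    0 ≤ rankCorrVec τ ε (singVals X) k ∧ rankCorrVec τ ε (singVals X) k ≤ 1 := by
  obtain ⟨h0, h1⟩ := singVals_div_norm_mem X k
  rw [rankCorrVec_apply hX]
  exact ⟨phi_nonneg hτ hε h0, phi_le_one hτ hε h0 h1⟩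

theorem isContraction_rankCorr (hτ : 0 < τ) (hε : 0 < ε) (hX : singVals X ≠ 0) :
    IsContraction (rankCorr τ ε X) := by
  obtain ⟨hU, hW, -⟩ := (exists_isSVD X).choose_spec
  refine isContraction_unitary_rectDiag hU hW fun k => ?_
  obtain ⟨h0, h1⟩ := rankCorrVec_singVals_mem hτ hε hX k
  rwa [abs_of_nonneg h0]

/-- The defect `1 - φ` may be large at small singular values, but there it is weighted by the
singular value itself. The factor tends to `0` with `ε`, independently of `X`. -/
theorem nuclearNorm_sub_trInner_rankCorr_le (hτ : 0 < τ) (hε : 0 < ε) (hX : singVals X ≠ 0) :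
    nuclearNorm X - trInner (rankCorr τ ε X) X ≤
      (min n₁ n₂ : ℕ) * (√ε + √ε ^ τ) * nuclearNorm X := by
  have h := (exists_isSVD X).choose_spec
  obtain ⟨hU, hW, -⟩ := (exists_isSVD X).choose_spec
  have hpos : 0 < ‖singVals X‖ := norm_pos_iff.mpr hX
  rw [nuclearNorm_sub_trInner h, rankCorr, spectralOp, unitary_conj_conj' hU hW]
  simp only [rectDiag_apply_diag, RCLike.ofReal_re]
  calc ∑ k, singVals X k * (1 - rankCorrVec τ ε (singVals X) k)
      ≤ ∑ _k : Fin (min n₁ n₂), (√ε + √ε ^ τ) * nuclearNorm X :=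
        Finset.sum_le_sum fun k _ => ?_
    _ = _ := by simp; ring
  obtain ⟨h0, h1⟩ := singVals_div_norm_mem X k
  have h2 := mul_one_sub_phi_le_add hτ hε h0 h1
  rw [rankCorrVec_apply hX]
  have e : singVals X k * (1 - phi τ ε (singVals X k / ‖singVals X‖)) =
      (singVals X k / ‖singVals X‖ * (1 - phi τ ε (singVals X k / ‖singVals X‖))) *
        ‖singVals X‖ := by
    field_simp
  rw [e]
  exact mul_le_mul h2 (norm_singVals_le_nuclearNorm X) (norm_nonneg _) (by positivity)

/-- The first `Y.rank` diagonal values are at most `1`. The others come from singular values of `X`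
that are at most `‖X - Y‖`, normalized by the largest one, which is at least the nuclear norm
divided by `min n₁ n₂`. -/
theorem norm_rankCorr_sq_le (hτ : 0 < τ) (hε : 0 < ε) (hX : singVals X ≠ 0)
    (Y : Matrix (Fin n₁) (Fin n₂) 𝕜) :
    ‖rankCorr τ ε X‖ ^ 2 ≤ Y.rank + (min n₁ n₂ : ℕ) * ((1 + ε ^ τ) / ε ^ τ *
      ((min n₁ n₂ : ℕ) * ‖X - Y‖ / nuclearNorm X) ^ τ) ^ 2 := by
  obtain ⟨hU, hW, -⟩ := (exists_isSVD X).choose_spec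
  have hpos : 0 < ‖singVals X‖ := norm_pos_iff.mpr hX
  have hnpos : 0 < nuclearNorm X := hpos.trans_le (norm_singVals_le_nuclearNorm X)
  rw [rankCorr, spectralOp, norm_mul_unitary (conjTranspose_mem hW), norm_unitary_mul hU,
    norm_rectDiag_sq]
  set b := ((1 + ε ^ τ) / ε ^ τ * ((min n₁ n₂ : ℕ) * ‖X - Y‖ / nuclearNorm X) ^ τ) ^ 2 with hb
  have hb0 : 0 ≤ b := by positivity
  calc ∑ k, rankCorrVec τ ε (singVals X) k ^ 2
      ≤ ∑ k : Fin (min n₁ n₂), ((if k.val < Y.rank then 1 else 0) + b) :=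
        Finset.sum_le_sum fun k _ => ?_
    _ = _ := by
        rw [Finset.sum_add_distrib, ← Nat.cast_one (R := ℝ), ← Nat.cast_zero (R := ℝ)]
        simp only [← Nat.cast_ite]
        rw [← Nat.cast_sum, ← Finset.card_filter, Fin.card_filter_val_lt,
          min_eq_right (rank_le_min Y)]
        simp
  obtain ⟨h0, h1⟩ := rankCorrVec_singVals_mem hτ hε hX k
  split_ifs with hk
  · have := pow_le_one₀ h0 h1 (n := 2)
    linarith
  · rw [zero_add, hb]
    refine pow_le_pow_left₀ h0 ?_ 2
    rw [rankCorrVec_apply hX]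
    refine (phi_le_mul_rpow hτ hε (singVals_div_norm_mem X k).1).trans ?_
    refine mul_le_mul_of_nonneg_left ?_ (by positivity)
    refine Real.rpow_le_rpow (singVals_div_norm_mem X k).1 ?_ hτ.le
    rw [div_le_div_iff₀ hpos hnpos]
    have h3 := singVals_le_norm_sub X Y k (not_lt.mp hk)
    have h4 := nuclearNorm_le_card_mul_norm X
    calc singVals X k * nuclearNorm X ≤ ‖X - Y‖ * ((min n₁ n₂ : ℕ) * ‖singVals X‖) := by gcongr
      _ = _ := by ring

end Bounds

/-- The rank-correction function of a matrix near `X` is close to the polar factor of `X`, once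
`ε` is small. -/
theorem exists_eventually_norm_rankCorr_sub_lt {X : Matrix (Fin n₁) (Fin n₂) 𝕜}
    (hX : 1 ≤ X.rank) {τ : ℝ} (hτ : 0 < τ) {η : ℝ} (hη : 0 < η) :
    ∃ ε₀ : ℝ, 0 < ε₀ ∧ ∀ ε : ℝ, 0 < ε → ε ≤ ε₀ →
      ∀ᶠ Y in 𝓝 X, ‖rankCorr τ ε Y - polarFactor X‖ < η := by
  obtain ⟨s, hs, hmin⟩ := exists_pos_le_singVals X
  set N : ℝ := ((min n₁ n₂ : ℕ) : ℝ)
  have hpos := nuclearNorm_pos hX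
  have hlim : Tendsto (fun ε : ℝ => 2 / s * (N * (√ε + √ε ^ τ) * nuclearNorm X)) (𝓝[>] 0)
      (𝓝 0) := by
    have h1 : ContinuousAt (fun ε : ℝ => 2 / s * (N * (√ε + √ε ^ τ) * nuclearNorm X)) 0 := by
      have h2 : ContinuousAt (fun ε : ℝ => √ε ^ τ) 0 :=
        (Real.continuous_sqrt.continuousAt).rpow_const (Or.inr hτ.le)
      exact continuousAt_const.mul ((continuousAt_const.mul
        (Real.continuous_sqrt.continuousAt.add h2)).mul continuousAt_const)
    have h3 := h1.tendsto.mono_left (nhdsWithin_le_nhds (s := Set.Ioi 0))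
    simpa [Real.zero_rpow hτ.ne'] using h3
  obtain ⟨ε₀, hε₀, hsub⟩ := mem_nhdsGT_iff_exists_Ioc_subset.mp
    (hlim.eventually_lt_const (show (0 : ℝ) < η ^ 2 by positivity))
  refine ⟨ε₀, hε₀, fun ε hε hle => ?_⟩
  have hb : 2 / s * (N * (√ε + √ε ^ τ) * nuclearNorm X) < η ^ 2 := hsub ⟨hε, hle⟩
  have hcont : ContinuousAt (nuclearNorm : Matrix (Fin n₁) (Fin n₂) 𝕜 → ℝ) X :=
    continuous_nuclearNorm.continuousAt
  have hnorm : ContinuousAt (fun Y : Matrix (Fin n₁) (Fin n₂) 𝕜 => ‖Y - X‖) X := by fun_prop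
  -- With `ε` fixed, this continuous function of `Y` will bound `‖F - polarFactor X‖ ^ 2`. At `Y =
  -- X` only the alignment defect remains, and the choice of `ε₀` puts it below `η ^ 2`.
  have hB : ContinuousAt (fun Y : Matrix (Fin n₁) (Fin n₂) 𝕜 =>
      N * ((1 + ε ^ τ) / ε ^ τ * (N * ‖Y - X‖ / nuclearNorm Y) ^ τ) ^ 2 +
        2 / s * (N * (√ε + √ε ^ τ) * nuclearNorm Y + 2 * (√(n₁ : ℝ) * ‖Y - X‖))) X := by
    refine ContinuousAt.add (continuousAt_const.mul ((continuousAt_const.mul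
      (((continuousAt_const.mul hnorm).div hcont hpos.ne').rpow_const (Or.inr hτ.le))).pow 2))
      (continuousAt_const.mul ((continuousAt_const.mul hcont).add
        (continuousAt_const.mul (continuousAt_const.mul hnorm))))
  have hev := hB.eventually_lt_const (u := η ^ 2) (by
    simpa [Real.zero_rpow hτ.ne'] using hb)
  filter_upwards [hev, hcont.eventually_const_lt hpos] with Y hY hYpos
  have hYs : singVals Y ≠ 0 := by
    intro h
    rw [nuclearNorm, h] at hYpos
    simp at hYpos
  set F := rankCorr τ ε Y
  have hF : IsContraction F := isContraction_rankCorr hτ hε hYs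
  have h1 := nuclearNorm_sub_trInner_rankCorr_le hτ hε hYs
  have h2 := norm_rankCorr_sq_le hτ hε hYs X
  have h3 := sub_trInner_polarFactor_le hF hmin
  have h4 := nuclearNorm_le_add X Y
  have h5 := (le_abs_self _).trans (hF.abs_trInner_le (Y - X))
  rw [norm_sub_rev X Y] at h4
  rw [trInner_sub_right] at h5
  have h6 : nuclearNorm X - trInner F X ≤
      N * (√ε + √ε ^ τ) * nuclearNorm Y + 2 * (√(n₁ : ℝ) * ‖Y - X‖) := by linarith
  have h7 : 2 * (X.rank - trInner F (polarFactor X)) ≤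
      2 / s * (N * (√ε + √ε ^ τ) * nuclearNorm Y + 2 * (√(n₁ : ℝ) * ‖Y - X‖)) := by
    rw [div_mul_eq_mul_div, le_div_iff₀ hs]
    linarith
  -- Expanding the square, the upper bound on `‖F‖ ^ 2` and the lower bound on the alignment
  -- suffice.
  have h8 : ‖F - polarFactor X‖ ^ 2 < η ^ 2 := by
    have e : ‖F - polarFactor X‖ ^ 2 =
        ‖F‖ ^ 2 + X.rank - 2 * trInner F (polarFactor X) := by
      rw [← trInner_self, trInner_sub_left, trInner_sub_right, trInner_sub_right, trInner_self,
        trInner_self, trInner_comm _ F, norm_polarFactor_sq]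
      ring
    rw [e]
    linarith
  exact lt_of_pow_lt_pow_left₀ 2 hη.le h8

end RankCorr

/-! ### Coordinates and the least squares loss -/

section Coordinates

variable {𝕜 : Type*} [RCLike 𝕜] {n₁ n₂ d : ℕ}

theorem continuous_trInner (A : Matrix (Fin n₁) (Fin n₂) 𝕜) : Continuous (trInner A) := by
  refine LipschitzWith.continuous (K := ‖A‖₊)
    (LipschitzWith.of_le_add_mul _ fun X Y => ?_)
  have := trInner_le A (X - Y)
  rw [trInner_sub_right] at this
  rw [dist_eq_norm, coe_nnnorm]
  linarith

variable {V : Submodule ℝ (Matrix (Fin n₁) (Fin n₂) 𝕜)} {Θ : Fin d → Matrix (Fin n₁) (Fin n₂) 𝕜}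

theorem IsONBasis.norm_eq_one (hΘ : IsONBasis V Θ) (k : Fin d) : ‖Θ k‖ = 1 := by
  have h := hΘ.inner_eq k k
  rw [trInner_self, if_pos rfl] at h
  exact (pow_eq_one_iff_of_nonneg (norm_nonneg _) two_ne_zero).mp h

theorem IsONBasis.abs_trInner_le (hΘ : IsONBasis V Θ) (k : Fin d)
    (X : Matrix (Fin n₁) (Fin n₂) 𝕜) : |trInner (Θ k) X| ≤ ‖X‖ := by
  have h := RankCorrection.abs_trInner_le (Θ k) X
  rwa [hΘ.norm_eq_one k, one_mul] at h

theorem IsONBasis.sum_trInner_sq (hΘ : IsONBasis V Θ) {X : Matrix (Fin n₁) (Fin n₂) 𝕜}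
    (hX : X ∈ V) : ∑ k, trInner (Θ k) X ^ 2 = ‖X‖ ^ 2 := by
  rw [← hΘ.span_eq, Submodule.mem_span_range_iff_exists_fun] at hX
  obtain ⟨c, rfl⟩ := hX
  have h : ∀ k, trInner (Θ k) (∑ i, c i • Θ i) = c k := by
    intro k
    simp [trInner_sum_right, trInner_smul_right, hΘ.inner_eq]
  rw [← trInner_self, trInner_sum_right]
  refine Finset.sum_congr rfl fun k _ => ?_
  rw [trInner_smul_right, trInner_comm _ (Θ k), h, sq]

/-- The empirical frequency of the index `k` among the first `m` samples. -/
noncomputable def freq (m : ℕ) (ω : ℕ → Fin d) (k : Fin d) : ℝ :=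
  (m : ℝ)⁻¹ * ∑ i ∈ Finset.range m, if ω i = k then 1 else 0

/-- The average contribution of the noise to the coefficient `k`. -/
noncomputable def noiseMean (m : ℕ) (ω : ℕ → Fin d) (ξ : ℕ → ℝ) (k : Fin d) : ℝ :=
  (m : ℝ)⁻¹ * ∑ i ∈ Finset.range m, ξ i * if ω i = k then 1 else 0

theorem freq_nonneg (m : ℕ) (ω : ℕ → Fin d) (k : Fin d) : 0 ≤ freq m ω k :=
  mul_nonneg (by positivity) (Finset.sum_nonneg fun i _ => by split_ifs <;> norm_num)

theorem freq_le_one (m : ℕ) (ω : ℕ → Fin d) (k : Fin d) : freq m ω k ≤ 1 := by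
  rcases m.eq_zero_or_pos with rfl | hm
  · simp [freq]
  · rw [freq, inv_mul_le_iff₀ (by positivity), mul_one]
    refine (Finset.sum_le_card_nsmul (Finset.range m) _ (1 : ℝ) fun i _ => ?_).trans (by simp)
    split_ifs <;> norm_num

/-- Grouping the samples by index makes the loss separable in the coefficients of `X - Xbar`: the
frequencies are the curvatures, and the averaged noise is the linear part. -/
theorem loss_eq (Θ : Fin d → Matrix (Fin n₁) (Fin n₂) 𝕜) (Xbar : Matrix (Fin n₁) (Fin n₂) 𝕜)
    (ν : ℝ) (m : ℕ) (ω : ℕ → Fin d) (ξ : ℕ → ℝ) (X : Matrix (Fin n₁) (Fin n₂) 𝕜) :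
    loss Θ Xbar ν m ω ξ X =
      ∑ k, (1 / 2 * freq m ω k * trInner (Θ k) (X - Xbar) ^ 2 -
        ν * noiseMean m ω ξ k * trInner (Θ k) (X - Xbar)) +
      1 / (2 * (m : ℝ)) * ∑ i ∈ Finset.range m, (ν * ξ i) ^ 2 := by
  set c : Fin d → ℝ := fun k => trInner (Θ k) (X - Xbar) with hc
  have h1 : ∀ i, ((trInner (Θ (ω i)) Xbar + ν * ξ i) - trInner (Θ (ω i)) X) ^ 2 =
      ∑ k, ((if ω i = k then 1 else 0) * c k ^ 2 -
        2 * ν * (ξ i * if ω i = k then 1 else 0) * c k) + (ν * ξ i) ^ 2 := by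
    intro i
    rw [Finset.sum_eq_single (ω i)]
    · simp only [hc, if_true, trInner_sub_right]
      ring
    · intro k _ hk
      simp [hk.symm]
    · simp
  have h2 : ∑ k, (1 / 2 * freq m ω k * c k ^ 2 - ν * noiseMean m ω ξ k * c k) =
      1 / (2 * (m : ℝ)) * ∑ i ∈ Finset.range m, ∑ k, ((if ω i = k then 1 else 0) * c k ^ 2 -
        2 * ν * (ξ i * if ω i = k then 1 else 0) * c k) := by
    rw [Finset.sum_comm, Finset.mul_sum]
    refine Finset.sum_congr rfl fun k _ => ?_
    rw [Finset.sum_sub_distrib, ← Finset.sum_mul, ← Finset.sum_mul, ← Finset.mul_sum, freq,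
      noiseMean, show 1 / (2 * (m : ℝ)) = 2⁻¹ * (m : ℝ)⁻¹ by rw [one_div, mul_inv]]
    ring
  rw [loss, h2, ← mul_add, ← Finset.sum_add_distrib]
  simp only [h1]

theorem continuous_loss (Θ : Fin d → Matrix (Fin n₁) (Fin n₂) 𝕜)
    (Xbar : Matrix (Fin n₁) (Fin n₂) 𝕜) (ν : ℝ) (m : ℕ) (ω : ℕ → Fin d) (ξ : ℕ → ℝ) :
    Continuous (loss Θ Xbar ν m ω ξ) :=
  continuous_const.mul (continuous_finsetSum _ fun i _ =>
    (continuous_const.sub (continuous_trInner (Θ (ω i)))).pow 2)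

theorem continuous_objective (Θ : Fin d → Matrix (Fin n₁) (Fin n₂) 𝕜)
    (Xbar : Matrix (Fin n₁) (Fin n₂) 𝕜) (ν : ℝ) (m : ℕ) (ω : ℕ → Fin d) (ξ : ℕ → ℝ) (ρ γ : ℝ)
    (G Xt : Matrix (Fin n₁) (Fin n₂) 𝕜) : Continuous (objective Θ Xbar ν m ω ξ ρ γ G Xt) := by
  have h1 := continuous_loss Θ Xbar ν m ω ξ
  have h2 := continuous_nuclearNorm (𝕜 := 𝕜) (n₁ := n₁) (n₂ := n₂)
  have h3 := continuous_trInner G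
  unfold objective
  fun_prop

/-- Quadratic growth of the loss on the feasible set. -/
theorem le_loss_sub_loss (hΘ : IsONBasis V Θ) {α : Finset (Fin d)}
    {Xbar X : Matrix (Fin n₁) (Fin n₂) 𝕜} (hXbar : Xbar ∈ V) (hX : X ∈ feasible V Θ α Xbar)
    {ν : ℝ} {m : ℕ} {ω : ℕ → Fin d} {ξ : ℕ → ℝ} {q b : ℝ}
    (hfreq : ∀ k ∉ α, q ≤ freq m ω k) (hnoise : ∀ k, |ν * noiseMean m ω ξ k| ≤ b) :
    q / 2 * ‖X - Xbar‖ ^ 2 - d * b * ‖X - Xbar‖ ≤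
      loss Θ Xbar ν m ω ξ X - loss Θ Xbar ν m ω ξ Xbar := by
  rw [loss_eq, loss_eq]
  have h0 : ∀ k, trInner (Θ k) (Xbar - Xbar) = 0 := fun k => by rw [trInner_sub_right, sub_self]
  simp only [h0]
  have e : q / 2 * ‖X - Xbar‖ ^ 2 - d * b * ‖X - Xbar‖ =
      ∑ k : Fin d, (q / 2 * trInner (Θ k) (X - Xbar) ^ 2 - b * ‖X - Xbar‖) := by
    rw [Finset.sum_sub_distrib, ← Finset.mul_sum, hΘ.sum_trInner_sq (V.sub_mem hX.1 hXbar)]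
    simp
    ring
  have h1 : ∑ k : Fin d, (q / 2 * trInner (Θ k) (X - Xbar) ^ 2 - b * ‖X - Xbar‖) ≤
      ∑ k, (1 / 2 * freq m ω k * trInner (Θ k) (X - Xbar) ^ 2 -
        ν * noiseMean m ω ξ k * trInner (Θ k) (X - Xbar)) := by
    refine Finset.sum_le_sum fun k _ => ?_
    have h2 : ν * noiseMean m ω ξ k * trInner (Θ k) (X - Xbar) ≤ b * ‖X - Xbar‖ := by
      refine (le_abs_self _).trans ?_
      rw [abs_mul]
      exact mul_le_mul (hnoise k) (hΘ.abs_trInner_le k _) (abs_nonneg _)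
        ((abs_nonneg _).trans (hnoise k))
    have h3 : q / 2 * trInner (Θ k) (X - Xbar) ^ 2 ≤
        1 / 2 * freq m ω k * trInner (Θ k) (X - Xbar) ^ 2 := by
      -- A fixed index may never be sampled, but its coefficient of `X - Xbar` is zero.
      by_cases hk : k ∈ α
      · have : trInner (Θ k) (X - Xbar) = 0 := by
          have := congrFun hX.2 ⟨k, hk⟩
          simp only [coeffs] at this
          rw [trInner_sub_right, this, sub_self]
        simp [this]
      · have := hfreq k hk
        nlinarith [sq_nonneg (trInner (Θ k) (X - Xbar))]
    linarith
  rw [e]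
  simp only [ne_eq, OfNat.ofNat_ne_zero, not_false_eq_true, zero_pow, mul_zero, sub_zero,
    Finset.sum_const_zero, zero_add]
  linarith

/-- The variation of the loss in a fixed direction. -/
theorem loss_add_smul_sub_le (hΘ : IsONBasis V Θ) {Xbar X H : Matrix (Fin n₁) (Fin n₂) 𝕜}
    {ν : ℝ} {m : ℕ} {ω : ℕ → Fin d} {ξ : ℕ → ℝ} {b t : ℝ} (ht : 0 ≤ t)
    (hnoise : ∀ k, |ν * noiseMean m ω ξ k| ≤ b) :
    loss Θ Xbar ν m ω ξ (X + t • H) - loss Θ Xbar ν m ω ξ X ≤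
      t * (d * (‖X - Xbar‖ + b) * ‖H‖ + t * (d * ‖H‖ ^ 2)) := by
  rw [loss_eq, loss_eq, add_sub_add_right_eq_sub, ← Finset.sum_sub_distrib]
  have e : t * (d * (‖X - Xbar‖ + b) * ‖H‖ + t * (d * ‖H‖ ^ 2)) =
      ∑ _k : Fin d, t * ((‖X - Xbar‖ + b) * ‖H‖ + t * ‖H‖ ^ 2) := by
    simp
    ring
  rw [e]
  refine Finset.sum_le_sum fun k _ => ?_
  have e1 : trInner (Θ k) (X + t • H - Xbar) = trInner (Θ k) (X - Xbar) + t * trInner (Θ k) H := by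
    rw [trInner_sub_right, trInner_add_right, trInner_smul_right, trInner_sub_right]
    ring
  rw [e1]
  set c := trInner (Θ k) (X - Xbar)
  set h := trInner (Θ k) H
  have hc : |c| ≤ ‖X - Xbar‖ := hΘ.abs_trInner_le k _
  have hh : |h| ≤ ‖H‖ := hΘ.abs_trInner_le k _
  have hf0 := freq_nonneg m ω k
  have hf1 := freq_le_one m ω k
  have h1 : freq m ω k * (c * h) ≤ ‖X - Xbar‖ * ‖H‖ := by
    refine (le_abs_self _).trans ?_
    rw [abs_mul, abs_mul, abs_of_nonneg hf0]
    calc freq m ω k * (|c| * |h|) ≤ 1 * (‖X - Xbar‖ * ‖H‖) := by gcongr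
      _ = _ := one_mul _
  have h2 : -(ν * noiseMean m ω ξ k * h) ≤ b * ‖H‖ := by
    refine (neg_le_abs _).trans ?_
    rw [abs_mul]
    exact mul_le_mul (hnoise k) hh (abs_nonneg _) ((abs_nonneg _).trans (hnoise k))
  have h3 : 1 / 2 * freq m ω k * h ^ 2 ≤ ‖H‖ ^ 2 := by
    have : h ^ 2 ≤ ‖H‖ ^ 2 := sq_le_sq' (by linarith [neg_abs_le h]) ((le_abs_self _).trans hh)
    nlinarith [sq_nonneg h]
  have h4 : t * (freq m ω k * (c * h) - ν * noiseMean m ω ξ k * h +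
      t * (1 / 2 * freq m ω k * h ^ 2)) ≤
      t * ((‖X - Xbar‖ + b) * ‖H‖ + t * ‖H‖ ^ 2) := by
    refine mul_le_mul_of_nonneg_left ?_ ht
    have := mul_le_mul_of_nonneg_left h3 ht
    linarith
  refine le_trans (le_of_eq ?_) h4
  ring

end Coordinates

/-! ### From a descent direction to the rank of the estimator -/

section Core

variable {𝕜 : Type*} [RCLike 𝕜] {n₁ n₂ d : ℕ}

/-- Near `Xbar`, at every point of `S` whose rank differs from that of `Xbar`, there is a feasible
direction along which the nuclear norm decreases faster than its linearization at `Xbar` along the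
polar factor. -/
def HasRankDescent (V : Submodule ℝ (Matrix (Fin n₁) (Fin n₂) 𝕜))
    (S : Set (Matrix (Fin n₁) (Fin n₂) 𝕜)) (Xbar : Matrix (Fin n₁) (Fin n₂) 𝕜) : Prop :=
  ∃ κ : ℝ, 0 < κ ∧ ∃ C : ℝ, 0 ≤ C ∧ ∃ r : ℝ, 0 < r ∧ ∀ X ∈ S, ‖X - Xbar‖ < r →
    X.rank ≠ Xbar.rank → ∃ H ∈ V, ‖H‖ ≤ C ∧ ∃ t₀ : ℝ, 0 < t₀ ∧ ∀ t : ℝ, 0 < t → t ≤ t₀ →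
      X + t • H ∈ S ∧
        nuclearNorm (X + t • H) - nuclearNorm X ≤ t * (trInner (polarFactor Xbar) H - κ)

variable {V : Submodule ℝ (Matrix (Fin n₁) (Fin n₂) 𝕜)} {Θ : Fin d → Matrix (Fin n₁) (Fin n₂) 𝕜}
  {α : Finset (Fin d)} {Xbar : Matrix (Fin n₁) (Fin n₂) 𝕜}
  {S : Set (Matrix (Fin n₁) (Fin n₂) 𝕜)}

theorem norm_add_sq_eq (X Y : Matrix (Fin n₁) (Fin n₂) 𝕜) :
    ‖X + Y‖ ^ 2 = ‖X‖ ^ 2 + 2 * trInner X Y + ‖Y‖ ^ 2 := by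
  rw [← trInner_self, trInner_add_left, trInner_add_right, trInner_add_right, trInner_self,
    trInner_self, trInner_comm Y X]
  ring

/-- Points that are at least as good as `Xbar` are close to `Xbar`. -/
theorem norm_sub_le_of_objective_le (hΘ : IsONBasis V Θ) (hXbar : Xbar ∈ V) {q δ : ℝ}
    (hq : 0 < q)
    {ν : ℝ} {m : ℕ} {ω : ℕ → Fin d} {ξ : ℕ → ℝ} {ρ γ : ℝ} (hρ : 0 < ρ) (hγ : 0 ≤ γ)
    {G Xt X : Matrix (Fin n₁) (Fin n₂) 𝕜}
    (hfreq : ∀ k ∉ α, q ≤ freq m ω k) (hnoise : ∀ k, |ν * noiseMean m ω ξ k| ≤ δ * ρ)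
    (hG : ‖G - polarFactor Xbar‖ ≤ δ) (hXt : γ * ‖Xt - Xbar‖ ≤ δ)
    (hX : X ∈ feasible V Θ α Xbar)
    (hle : objective Θ Xbar ν m ω ξ ρ γ G Xt X ≤ objective Θ Xbar ν m ω ξ ρ γ G Xt Xbar) :
    ‖X - Xbar‖ ≤ 2 * (d + 2) / q * (δ * ρ) := by
  set D := X - Xbar with hD
  have h1 := le_loss_sub_loss hΘ hXbar hX hfreq hnoise
  have h2 := nuclearNorm_add_trInner_polarFactor_le Xbar X
  have h3 := trInner_le (G - polarFactor Xbar) D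
  have h4 : ‖X - Xt‖ ^ 2 = ‖Xbar - Xt‖ ^ 2 + 2 * trInner (Xbar - Xt) D + ‖D‖ ^ 2 := by
    rw [← norm_add_sq_eq, hD]
    congr 2
    abel
  have h5 := (neg_le_abs _).trans (abs_trInner_le (Xbar - Xt) D)
  rw [norm_sub_rev Xbar Xt] at h5
  have h6 : ‖G - polarFactor Xbar‖ * ‖D‖ ≤ δ * ‖D‖ := by gcongr
  have h7 : γ * ‖Xt - Xbar‖ * ‖D‖ ≤ δ * ‖D‖ := by gcongr
  rw [trInner_sub_left] at h3
  have h8 : trInner G X - trInner G Xbar = trInner G D := by rw [hD, trInner_sub_right]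
  simp only [objective] at hle
  have h9 : -(δ * ‖D‖) ≤ γ / 2 * ‖X - Xt‖ ^ 2 - γ / 2 * ‖Xbar - Xt‖ ^ 2 := by
    rw [h4]
    nlinarith [mul_nonneg hγ (sq_nonneg ‖D‖), mul_le_mul_of_nonneg_left h5 hγ]
  -- The linear part of the penalty is `polarFactor Xbar - G` up to the subgradient inequality,
  -- costing `δ ‖D‖`; the proximal term costs another `δ ‖D‖`.
  have h10 : -(2 * δ * ‖D‖) ≤ (nuclearNorm X - trInner G X + γ / 2 * ‖X - Xt‖ ^ 2) -
      (nuclearNorm Xbar - trInner G Xbar + γ / 2 * ‖Xbar - Xt‖ ^ 2) := by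
    rw [← hD] at h2
    linarith
  have h11 : q / 2 * ‖D‖ ^ 2 ≤ (d + 2) * (δ * ρ) * ‖D‖ := by
    have := mul_le_mul_of_nonneg_left h10 hρ.le
    nlinarith
  have hδ : 0 ≤ δ := (norm_nonneg _).trans hG
  rcases (norm_nonneg D).eq_or_lt with h0 | h0
  · rw [← h0]; positivity
  · rw [div_mul_eq_mul_div, le_div_iff₀ hq]
    nlinarith

/-- `Solves` carries information only when a minimizer exists. The points no worse than `Xbar` lie
in a fixed ball, so it is enough to minimize over a compact set. -/
theorem exists_isMinimizer (hΘ : IsONBasis V Θ) (hXbar : Xbar ∈ V) (hS : S ⊆ feasible V Θ α Xbar)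
    (hclosed : IsClosed S) (hmem : Xbar ∈ S) {q δ : ℝ} (hq : 0 < q)
    {ν : ℝ} {m : ℕ} {ω : ℕ → Fin d} {ξ : ℕ → ℝ} {ρ γ : ℝ} (hρ : 0 < ρ) (hγ : 0 ≤ γ)
    {G Xt : Matrix (Fin n₁) (Fin n₂) 𝕜}
    (hfreq : ∀ k ∉ α, q ≤ freq m ω k) (hnoise : ∀ k, |ν * noiseMean m ω ξ k| ≤ δ * ρ)
    (hG : ‖G - polarFactor Xbar‖ ≤ δ) (hXt : γ * ‖Xt - Xbar‖ ≤ δ) :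
    ∃ Y, IsMinimizer (objective Θ Xbar ν m ω ξ ρ γ G Xt) S Y := by
  have : ProperSpace (Matrix (Fin n₁) (Fin n₂) 𝕜) := FiniteDimensional.proper ℝ _
  set R := 2 * (d + 2) / q * (δ * ρ)
  have hδ : 0 ≤ δ := (norm_nonneg _).trans hG
  have hR : 0 ≤ R := by positivity
  have hcomp : IsCompact (S ∩ Metric.closedBall Xbar R) :=
    (isCompact_closedBall Xbar R).inter_left hclosed
  have hxm : Xbar ∈ S ∩ Metric.closedBall Xbar R := ⟨hmem, Metric.mem_closedBall_self hR⟩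
  obtain ⟨Y, hY, hmin⟩ := hcomp.exists_isMinOn ⟨Xbar, hxm⟩
    (continuous_objective Θ Xbar ν m ω ξ ρ γ G Xt).continuousOn
  refine ⟨Y, hY.1, fun Z hZ => ?_⟩
  rcases le_total (objective Θ Xbar ν m ω ξ ρ γ G Xt Z)
    (objective Θ Xbar ν m ω ξ ρ γ G Xt Xbar) with h | h
  · refine hmin ⟨hZ, ?_⟩
    rw [Metric.mem_closedBall, dist_eq_norm]
    exact norm_sub_le_of_objective_le hΘ hXbar hq hρ hγ hfreq hnoise hG hXt (hS hZ) h
  · exact (hmin hxm).trans h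

/-- If the sampling is balanced and the noise, the rank-correction function and the initial
estimator are accurate enough, then every solution of the rank-correction step has the rank of
`Xbar`. -/
theorem exists_rank_eq_of_solves (hΘ : IsONBasis V Θ) (hXbar : Xbar ∈ V)
    (hS : S ⊆ feasible V Θ α Xbar) (hclosed : IsClosed S) (hmem : Xbar ∈ S)
    (hdesc : HasRankDescent V S Xbar) {q : ℝ} (hq : 0 < q) :
    ∃ δ : ℝ, 0 < δ ∧ ∀ (ν : ℝ) (m : ℕ) (ω : ℕ → Fin d) (ξ : ℕ → ℝ) (ρ γ : ℝ)
      (G Xt X : Matrix (Fin n₁) (Fin n₂) 𝕜), 0 < ρ → ρ ≤ 1 → 0 ≤ γ → γ * ρ ≤ 1 →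
      (∀ k ∉ α, q ≤ freq m ω k) → (∀ k, |ν * noiseMean m ω ξ k| ≤ δ * ρ) →
      ‖G - polarFactor Xbar‖ ≤ δ → γ * ‖Xt - Xbar‖ ≤ δ →
      Solves (objective Θ Xbar ν m ω ξ ρ γ G Xt) S X → X.rank = Xbar.rank := by
  obtain ⟨κ, hκ, C, hC, r, hr, hdir⟩ := hdesc
  set a : ℝ := 2 * (d + 2) / q with ha
  have ha0 : 0 ≤ a := by positivity
  -- `M` collects the coefficients of `δ` in the first-order change of the objective: the first two
  -- terms come from the loss, the third from `G`, the last two from the proximal term.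
  set M : ℝ := d * a * C + d * C + C + a * C + C with hM
  have hM0 : 0 ≤ M := by positivity
  -- The first bound keeps the errors below half of the descent rate; the second keeps the minimizer
  -- in the ball where descent directions exist.
  refine ⟨min (κ / (2 * (M + 1))) (r / (2 * (a + 1))), by positivity, ?_⟩
  set δ := min (κ / (2 * (M + 1))) (r / (2 * (a + 1))) with hδdef
  have hδ : 0 < δ := by positivity
  have hδ1 : δ * M ≤ κ / 2 := by
    have h : δ ≤ κ / (2 * (M + 1)) := min_le_left _ _
    rw [le_div_iff₀ (by positivity)] at h
    nlinarith
  have hδ2 : a * δ < r := by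
    have h : δ ≤ r / (2 * (a + 1)) := min_le_right _ _
    rw [le_div_iff₀ (by positivity)] at h
    nlinarith
  intro ν m ω ξ ρ γ G Xt X hρ hρ1 hγ hγρ hfreq hnoise hG hXt hsol
  obtain ⟨hXS, hXmin⟩ :=
    hsol (exists_isMinimizer hΘ hXbar hS hclosed hmem hq hρ hγ hfreq hnoise hG hXt)
  have hdist : ‖X - Xbar‖ ≤ a * (δ * ρ) :=
    norm_sub_le_of_objective_le hΘ hXbar hq hρ hγ hfreq hnoise hG hXt (hS hXS) (hXmin Xbar hmem)
  by_contra hne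
  have hlt : ‖X - Xbar‖ < r := by
    refine hdist.trans_lt (lt_of_le_of_lt ?_ hδ2)
    have : δ * ρ ≤ δ * 1 := by gcongr
    nlinarith
  obtain ⟨H, hHV, hHC, t₀, ht₀, hstep⟩ := hdir X hXS hlt hne
  set B : ℝ := d * C ^ 2 + ρ * (γ / 2 * C ^ 2) with hB
  have hB0 : 0 ≤ B := by positivity
  -- The second bound makes the second-order terms at most `ρ * κ / 4` per unit step. It may depend
  -- on `γ` and `ρ`, as a single descending step is enough.
  set t := min t₀ (ρ * κ / (4 * (B + 1))) with ht
  have htpos : 0 < t := by positivity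
  have htB : t * B ≤ ρ * κ / 4 := by
    have h : t ≤ ρ * κ / (4 * (B + 1)) := min_le_right _ _
    rw [le_div_iff₀ (by positivity)] at h
    nlinarith
  obtain ⟨hmemt, hdec⟩ := hstep t htpos (min_le_left _ _)
  have hopt := hXmin _ hmemt
  have h1 := loss_add_smul_sub_le hΘ (Xbar := Xbar) (X := X) (H := H) htpos.le hnoise
  have h2 : ‖X + t • H - Xt‖ ^ 2 =
      ‖X - Xt‖ ^ 2 + 2 * (t * trInner (X - Xt) H) + t ^ 2 * ‖H‖ ^ 2 := by
    have e : X + t • H - Xt = (X - Xt) + t • H := by abel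
    rw [e, norm_add_sq_eq, trInner_smul_right, norm_smul, mul_pow, Real.norm_of_nonneg htpos.le]
  have h3 : trInner (polarFactor Xbar) H - trInner G H ≤ δ * C := by
    rw [← trInner_sub_left]
    refine (trInner_le _ _).trans (mul_le_mul ?_ hHC (norm_nonneg _) hδ.le)
    rwa [norm_sub_rev]
  have h4 : γ * trInner (X - Xt) H ≤ (a * δ + δ) * C := by
    have h5 : trInner (X - Xt) H ≤ (‖X - Xbar‖ + ‖Xt - Xbar‖) * C := by
      refine (trInner_le _ _).trans (mul_le_mul ?_ hHC (norm_nonneg _) (by positivity))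
      calc ‖X - Xt‖ = ‖(X - Xbar) - (Xt - Xbar)‖ := by congr 1; abel
        _ ≤ _ := norm_sub_le _ _
    -- The distance to `Xbar` is `O(δ ρ)`, and `γ ρ ≤ 1` absorbs the possibly large `γ`.
    have h6 : γ * ‖X - Xbar‖ ≤ a * δ := by
      calc γ * ‖X - Xbar‖ ≤ γ * (a * (δ * ρ)) := by gcongr
        _ = (γ * ρ) * (a * δ) := by ring
        _ ≤ 1 * (a * δ) := by gcongr
        _ = _ := one_mul _
    calc γ * trInner (X - Xt) H ≤ γ * ((‖X - Xbar‖ + ‖Xt - Xbar‖) * C) := by gcongr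
      _ = (γ * ‖X - Xbar‖ + γ * ‖Xt - Xbar‖) * C := by ring
      _ ≤ _ := by gcongr
  have h7 : d * (‖X - Xbar‖ + δ * ρ) * ‖H‖ + t * (d * ‖H‖ ^ 2) ≤
      d * (a * (δ * ρ) + δ * ρ) * C + t * (d * C ^ 2) := by gcongr
  have h8 : γ / 2 * ‖H‖ ^ 2 ≤ γ / 2 * C ^ 2 := by gcongr
  have h9 : objective Θ Xbar ν m ω ξ ρ γ G Xt (X + t • H) -
      objective Θ Xbar ν m ω ξ ρ γ G Xt X ≤
      t * (d * (a * (δ * ρ) + δ * ρ) * C + t * (d * C ^ 2) +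
        ρ * (δ * C - κ + (a * δ + δ) * C + t * (γ / 2 * C ^ 2))) := by
    have e : objective Θ Xbar ν m ω ξ ρ γ G Xt (X + t • H) -
        objective Θ Xbar ν m ω ξ ρ γ G Xt X =
        (loss Θ Xbar ν m ω ξ (X + t • H) - loss Θ Xbar ν m ω ξ X) +
        ρ * ((nuclearNorm (X + t • H) - nuclearNorm X) - t * trInner G H +
          t * (γ * trInner (X - Xt) H) + t * (t * (γ / 2 * ‖H‖ ^ 2))) := by
      simp only [objective]
      rw [h2, trInner_add_right, trInner_smul_right]
      ring
    rw [e, mul_add t]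
    refine add_le_add (h1.trans (mul_le_mul_of_nonneg_left h7 htpos.le)) ?_
    rw [mul_left_comm t ρ]
    refine mul_le_mul_of_nonneg_left ?_ hρ.le
    have h10 := mul_le_mul_of_nonneg_left h3 htpos.le
    have h11 := mul_le_mul_of_nonneg_left h4 htpos.le
    have h12 := mul_le_mul_of_nonneg_left (mul_le_mul_of_nonneg_left h8 htpos.le) htpos.le
    linarith
  have h13 : d * (a * (δ * ρ) + δ * ρ) * C + t * (d * C ^ 2) +
        ρ * (δ * C - κ + (a * δ + δ) * C + t * (γ / 2 * C ^ 2)) =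
        ρ * (δ * M - κ) + t * B := by
    rw [hM, hB]
    ring
  rw [h13] at h9
  have h14 : ρ * (δ * M - κ) + t * B < 0 := by
    have h15 : ρ * (δ * M - κ) ≤ ρ * (-(κ / 2)) :=
      mul_le_mul_of_nonneg_left (by linarith) hρ.le
    have h16 := mul_pos hρ hκ
    linarith
  linarith [mul_neg_of_pos_of_neg htpos h14]

end Core

/-! ### Events of probability tending to one -/

section HighProb

variable {Ω : Type*} [MeasurableSpace Ω] {μ : Measure Ω}

/-- The exceptional sets of the events `P m` have (outer) measure tending to zero. -/
def HighProb (μ : Measure Ω) (P : ℕ → Ω → Prop) : Prop :=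
  Tendsto (fun m => μ {a | ¬ P m a}) atTop (𝓝 0)

theorem HighProb.mono {P Q : ℕ → Ω → Prop} (hP : HighProb μ P)
    (h : ∀ᶠ m in atTop, ∀ᵐ a ∂μ, P m a → Q m a) : HighProb μ Q := by
  refine tendsto_of_tendsto_of_tendsto_of_le_of_le' tendsto_const_nhds hP
    (Eventually.of_forall fun _ => zero_le) ?_
  filter_upwards [h] with m hm
  refine measure_mono_ae ?_
  filter_upwards [hm] with a ha hQ hPa
  exact hQ (ha hPa)

theorem HighProb.and {P Q : ℕ → Ω → Prop} (hP : HighProb μ P) (hQ : HighProb μ Q) :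
    HighProb μ fun m a => P m a ∧ Q m a := by
  have h := Tendsto.add hP hQ
  rw [add_zero] at h
  refine tendsto_of_tendsto_of_tendsto_of_le_of_le tendsto_const_nhds h
    (fun _ => zero_le) fun m => ?_
  refine (measure_mono fun a ha => ?_).trans (measure_union_le _ _)
  simp only [Set.mem_ofPred_eq, not_and_or] at ha
  exact ha

theorem HighProb.forall {ι : Type*} [Finite ι] {P : ι → ℕ → Ω → Prop}
    (hP : ∀ k, HighProb μ (P k)) : HighProb μ fun m a => ∀ k, P k m a := by
  cases nonempty_fintype ι
  have h := tendsto_finsetSum Finset.univ fun k _ => hP k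
  rw [Finset.sum_const_zero] at h
  refine tendsto_of_tendsto_of_tendsto_of_le_of_le tendsto_const_nhds h
    (fun _ => zero_le) fun m => ?_
  refine (measure_mono fun a ha => ?_).trans (measure_iUnion_fintype_le μ _)
  simp only [Set.mem_ofPred_eq, not_forall] at ha
  exact Set.mem_iUnion.mpr ha

theorem HighProb.tendsto_one [IsProbabilityMeasure μ] {P : ℕ → Ω → Prop} (hP : HighProb μ P) :
    Tendsto (fun m => μ {a | P m a}) atTop (𝓝 1) := by
  have h : Tendsto (fun m => 1 - μ {a | ¬ P m a}) atTop (𝓝 (1 - 0)) :=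
    ENNReal.Tendsto.sub tendsto_const_nhds hP (Or.inl ENNReal.one_ne_top)
  rw [tsub_zero] at h
  refine tendsto_of_tendsto_of_tendsto_of_le_of_le h tendsto_const_nhds (fun m => ?_)
    fun m => prob_le_one
  rw [tsub_le_iff_right, ← measure_univ (μ := μ)]
  refine (measure_mono fun a _ => ?_).trans (measure_union_le _ _)
  exact em (P m a)

theorem highProb_of_tendstoInMeasure {E : Type*} [PseudoEMetricSpace E] {X : ℕ → Ω → E} {x : E}
    (hX : TendstoInMeasure μ X atTop fun _ => x) {p : E → Prop} (hp : ∀ᶠ y in 𝓝 x, p y) :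
    HighProb μ fun m a => p (X m a) := by
  obtain ⟨ε, hε, hsub⟩ := EMetric.mem_nhds_iff.mp hp
  refine tendsto_of_tendsto_of_tendsto_of_le_of_le tendsto_const_nhds (hX ε hε)
    (fun _ => zero_le) fun m => measure_mono fun a ha => ?_
  by_contra hcon
  exact ha (hsub (show edist (X m a) x < ε from not_le.mp hcon))

/-- Truncation: outside an event of small probability the random sequence may be treated as bounded
by a constant. -/
theorem BoundedInProb.highProb {γ : ℕ → Ω → ℝ} (hγ : BoundedInProb μ γ) {Q : ℕ → Ω → Prop}
    (h : ∀ M : ℝ, 0 < M → HighProb μ fun m a => |γ m a| ≤ M → Q m a) : HighProb μ Q := by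
  rw [HighProb, ENNReal.tendsto_nhds_zero]
  intro ε hε
  obtain ⟨δ, hδ, hδε⟩ : ∃ δ : ℝ, 0 < δ ∧ ENNReal.ofReal δ ≤ ε / 2 := by
    rcases eq_or_ne ε ⊤ with rfl | htop
    · exact ⟨1, one_pos, by rw [ENNReal.top_div_of_ne_top (by norm_num)]; exact le_top⟩
    · have h2 : ε / 2 ≠ ⊤ := ENNReal.div_ne_top htop (by norm_num)
      exact ⟨(ε / 2).toReal, ENNReal.toReal_pos (ENNReal.half_pos hε.ne').ne' h2,
        (ENNReal.ofReal_toReal h2).le⟩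
  obtain ⟨M, hM⟩ := hγ δ hδ
  have h1 := (ENNReal.tendsto_nhds_zero.mp (h (max M 1) (by positivity))) (ε / 2)
    (ENNReal.half_pos hε.ne')
  filter_upwards [hM, h1] with m hm1 hm2
  calc μ {a | ¬ Q m a}
      ≤ μ ({a | M < |γ m a|} ∪ {a | ¬ (|γ m a| ≤ max M 1 → Q m a)}) := measure_mono fun a ha => ?_
    _ ≤ ε / 2 + ε / 2 := (measure_union_le _ _).trans (add_le_add (hm1.trans hδε) hm2)
    _ = ε := ENNReal.add_halves ε
  by_cases hle : M < |γ m a|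
  · exact Or.inl hle
  · exact Or.inr fun hcon => ha (hcon ((not_lt.mp hle).trans (le_max_left _ _)))

/-- Weak law of large numbers for uncorrelated sequences with bounded second moments, with a
rate. -/
theorem highProb_abs_mean_le [IsProbabilityMeasure μ] {Y : ℕ → Ω → ℝ} {B : ℝ}
    (hL : ∀ i, MemLp (Y i) 2 μ) (hcross : ∀ i j, i ≠ j → ∫ a, Y i a * Y j a ∂μ = 0)
    (hsq : ∀ i, ∫ a, Y i a * Y i a ∂μ ≤ B) {b : ℕ → ℝ} (hb : ∀ m, 0 < b m)
    (hlim : Tendsto (fun m : ℕ => √(m : ℝ) * b m) atTop atTop) :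
    HighProb μ fun m a => |(m : ℝ)⁻¹ * ∑ i ∈ Finset.range m, Y i a| ≤ b m := by
  have hint : ∀ i j, Integrable (fun a => Y i a * Y j a) μ := fun i j =>
    (hL i).integrable_mul (hL j)
  have hexp : ∀ (m : ℕ) (a : Ω), ((m : ℝ)⁻¹ * ∑ i ∈ Finset.range m, Y i a) ^ 2 =
      ((m : ℝ)⁻¹) ^ 2 * ∑ i ∈ Finset.range m, ∑ j ∈ Finset.range m, Y i a * Y j a := by
    intro m a
    rw [mul_pow, sq (∑ i ∈ Finset.range m, Y i a), Finset.sum_mul_sum]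
  have hint2 : ∀ m : ℕ, Integrable
      (fun a => ((m : ℝ)⁻¹ * ∑ i ∈ Finset.range m, Y i a) ^ 2) μ := by
    intro m
    simp only [hexp]
    exact (integrable_finsetSum _ fun i _ => integrable_finsetSum _ fun j _ =>
      hint i j).const_mul _
  have hmean : ∀ m : ℕ, ∫ a, ((m : ℝ)⁻¹ * ∑ i ∈ Finset.range m, Y i a) ^ 2 ∂μ ≤
      ((m : ℝ)⁻¹) ^ 2 * (m * B) := by
    intro m
    simp only [hexp]
    rw [integral_const_mul]
    refine mul_le_mul_of_nonneg_left ?_ (by positivity)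
    rw [integral_finsetSum _ fun i _ => integrable_finsetSum _ fun j _ => hint i j]
    calc ∑ i ∈ Finset.range m, ∫ a, ∑ j ∈ Finset.range m, Y i a * Y j a ∂μ
        ≤ ∑ _i ∈ Finset.range m, B := Finset.sum_le_sum fun i hi => ?_
      _ = m * B := by simp
    -- Uncorrelatedness leaves only the diagonal, so the second moment of the mean is at most `B /
    -- m` for `m > 0`.
    rw [integral_finsetSum _ fun j _ => hint i j, Finset.sum_eq_single i]
    · exact hsq i
    · exact fun j _ hj => hcross i j hj.symm
    · exact fun h => (h hi).elim
  have hbound : ∀ m : ℕ, 0 < m →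
      μ.real {a | ¬ |(m : ℝ)⁻¹ * ∑ i ∈ Finset.range m, Y i a| ≤ b m} ≤
        B * ((√(m : ℝ) * b m) ^ 2)⁻¹ := by
    intro m hm
    -- Markov's inequality for the squared mean, that is, Chebyshev's inequality.
    have h1 := mul_meas_ge_le_integral_of_nonneg (μ := μ)
      (Eventually.of_forall fun a => sq_nonneg _) (hint2 m) (b m ^ 2)
    have h2 : μ.real {a | ¬ |(m : ℝ)⁻¹ * ∑ i ∈ Finset.range m, Y i a| ≤ b m} ≤
        μ.real {a | b m ^ 2 ≤ ((m : ℝ)⁻¹ * ∑ i ∈ Finset.range m, Y i a) ^ 2} := by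
      refine measureReal_mono fun a ha => ?_
      have h3 : b m < |(m : ℝ)⁻¹ * ∑ i ∈ Finset.range m, Y i a| := not_le.mp ha
      have h4 := pow_le_pow_left₀ (hb m).le h3.le 2
      rwa [sq_abs] at h4
    have hm' : (0 : ℝ) < m := by exact_mod_cast hm
    have hb2 : 0 < b m ^ 2 := pow_pos (hb m) 2
    rw [mul_pow, Real.sq_sqrt hm'.le, ← div_eq_mul_inv, le_div_iff₀ (by positivity)]
    have h5 := (mul_le_mul_of_nonneg_left h2 hb2.le).trans (h1.trans (hmean m))
    have h6 := mul_le_mul_of_nonneg_left h5 hm'.le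
    have e : (m : ℝ) * (((m : ℝ)⁻¹) ^ 2 * (m * B)) = B := by field_simp
    rw [e] at h6
    linarith
  have hzero : Tendsto (fun m : ℕ => B * ((√(m : ℝ) * b m) ^ 2)⁻¹) atTop (𝓝 0) := by
    have := (((tendsto_pow_atTop (α := ℝ) two_ne_zero).comp hlim).inv_tendsto_atTop).const_mul B
    simpa using this
  have hreal : Tendsto (fun m : ℕ =>
      μ.real {a | ¬ |(m : ℝ)⁻¹ * ∑ i ∈ Finset.range m, Y i a| ≤ b m}) atTop (𝓝 0) := by
    refine tendsto_of_tendsto_of_tendsto_of_le_of_le' tendsto_const_nhds hzero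
      (Eventually.of_forall fun _ => measureReal_nonneg) ?_
    filter_upwards [eventually_gt_atTop 0] with m hm using hbound m hm
  have := ENNReal.tendsto_ofReal hreal
  simpa [HighProb, ofReal_measureReal] using this

end HighProb

/-! ### The sampling scheme -/

section Sampling

variable {Ω : Type*} [MeasurableSpace Ω] {μ : Measure Ω} {d : ℕ} {α : Finset (Fin d)}
  {p : Fin d → ℝ} {ω : ℕ → Ω → Fin d} {ξ : ℕ → Ω → ℝ}

theorem measurable_ite_index {ι : Type*} [MeasurableSpace ι] [MeasurableSingletonClass ι]
    [DecidableEq ι] (k : ι) : Measurable fun j : ι => if j = k then (1 : ℝ) else 0 :=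
  Measurable.ite (measurableSet_singleton k) measurable_const measurable_const

theorem IsSampling.integral_index (h : IsSampling μ α p ω ξ) {k : Fin d} (hk : 0 ≤ p k) (i : ℕ) :
    ∫ a, (if ω i a = k then (1 : ℝ) else 0) ∂μ = p k := by
  have hm : MeasurableSet {a | ω i a = k} := h.measurable_index i (measurableSet_singleton k)
  have e : (fun a => if ω i a = k then (1 : ℝ) else 0) = {a | ω i a = k}.indicator 1 := by
    ext a
    simp [Set.indicator_apply]
  rw [e, integral_indicator_one hm, measureReal_def, h.law_index, ENNReal.toReal_ofReal hk]

variable [IsProbabilityMeasure μ]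

theorem IsSampling.memLp_index (h : IsSampling μ α p ω ξ) (k : Fin d) (i : ℕ) (c : ℝ) :
    MemLp (fun a => (if ω i a = k then (1 : ℝ) else 0) - c) 2 μ := by
  refine MemLp.of_bound (((measurable_ite_index k).comp
    (h.measurable_index i)).sub_const c).aestronglyMeasurable (1 + |c|)
    (Eventually.of_forall fun a => ?_)
  refine (norm_sub_le _ _).trans ?_
  split_ifs <;> simp

/-- Chebyshev's inequality for the centred indicators, with the constant deviation `p k / 2`. -/
theorem IsSampling.highProb_freq (h : IsSampling μ α p ω ξ) {k : Fin d} (hk : k ∉ α) :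
    HighProb μ fun m a => p k / 2 ≤ freq m (fun i => ω i a) k := by
  have hp := h.prob_pos k hk
  have hmz : ∀ i, ∫ a, ((if ω i a = k then (1 : ℝ) else 0) - p k) ∂μ = 0 := by
    intro i
    have h0 := (h.memLp_index k i 0).integrable one_le_two
    simp only [sub_zero] at h0
    rw [integral_sub h0 (integrable_const _), h.integral_index hp.le]
    simp
  have hmeas : Measurable fun j : Fin d => (if j = k then (1 : ℝ) else 0) - p k :=
    (measurable_ite_index k).sub_const _
  have key := highProb_abs_mean_le (μ := μ) (B := (1 + p k) ^ 2)
    (fun i => h.memLp_index k i (p k)) (fun i j hij => ?_) (fun i => ?_) (b := fun _ => p k / 2)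
    (fun _ => half_pos hp) ?_
  · refine key.mono ?_
    filter_upwards [eventually_gt_atTop 0] with m hm
    refine Eventually.of_forall fun a ha => ?_
    have hm' : (m : ℝ) ≠ 0 := by exact_mod_cast hm.ne'
    rw [Finset.sum_sub_distrib, mul_sub, Finset.sum_const, Finset.card_range, nsmul_eq_mul,
      inv_mul_cancel_left₀ hm', abs_le] at ha
    rw [freq]
    linarith [ha.1]
  · have hind := ((h.indep_index.indepFun hij).comp hmeas hmeas).integral_fun_mul_eq_mul_integral
      (hmeas.comp (h.measurable_index i)).aestronglyMeasurable
      (hmeas.comp (h.measurable_index j)).aestronglyMeasurable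
    simp only [Function.comp_apply] at hind
    rw [hind, hmz, zero_mul]
  · have hle := integral_mono ((h.memLp_index k i (p k)).integrable_mul (h.memLp_index k i (p k)))
      (integrable_const ((1 + p k) ^ 2)) (fun a => ?_)
    · simpa using hle
    · simp only [Pi.mul_apply]
      split_ifs <;> nlinarith
  · exact (Real.tendsto_sqrt_atTop.comp tendsto_natCast_atTop_atTop).atTop_mul_const (half_pos hp)

/-- Cross moments factor into an index part and a noise part by independence of the two families,
and `E ξ_i ξ_j = 0` for `i ≠ j`. The indicators only decrease the second moments. -/
theorem IsSampling.highProb_noise (h : IsSampling μ α p ω ξ) (k : Fin d) {b : ℕ → ℝ}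
    (hb : ∀ m, 0 < b m) (hlim : Tendsto (fun m : ℕ => √(m : ℝ) * b m) atTop atTop) :
    HighProb μ fun m a => |noiseMean m (fun i => ω i a) (fun i => ξ i a) k| ≤ b m := by
  have hξ : ∀ i, MemLp (ξ i) 2 μ := fun i =>
    (h.identDistrib_noise i).memLp_iff.mpr h.memLp_noise
  have hmz : ∀ i, ∫ a, ξ i a ∂μ = 0 := fun i => by
    rw [(h.identDistrib_noise i).integral_eq, h.mean_noise]
  have hvar : ∀ i, ∫ a, ξ i a ^ 2 ∂μ = 1 := fun i => by
    rw [← h.variance_noise]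
    exact ((h.identDistrib_noise i).comp (measurable_id.pow_const 2)).integral_eq
  have hI : ∀ i, Measurable fun a => if ω i a = k then (1 : ℝ) else 0 := fun i =>
    (measurable_ite_index k).comp (h.measurable_index i)
  have hL : ∀ i, MemLp (fun a => ξ i a * if ω i a = k then (1 : ℝ) else 0) 2 μ := fun i => by
    refine (hξ i).mono ((h.measurable_noise i).mul (hI i)).aestronglyMeasurable
      (Eventually.of_forall fun a => ?_)
    split_ifs <;> simp
  refine highProb_abs_mean_le (B := 1) hL (fun i j hij => ?_) (fun i => ?_) hb hlim
  · have hm1 : Measurable fun w : ℕ → Fin d =>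
        (if w i = k then (1 : ℝ) else 0) * if w j = k then (1 : ℝ) else 0 :=
      ((measurable_ite_index k).comp (measurable_pi_apply i)).mul
        ((measurable_ite_index k).comp (measurable_pi_apply j))
    have hm2 : Measurable fun x : ℕ → ℝ => x i * x j :=
      (measurable_pi_apply i).mul (measurable_pi_apply j)
    have hind := (h.indep_index_noise.comp hm1 hm2).integral_fun_mul_eq_mul_integral
      ((hI i).mul (hI j)).aestronglyMeasurable
      ((h.measurable_noise i).mul (h.measurable_noise j)).aestronglyMeasurable
    have hind2 := (h.indep_noise.indepFun hij).integral_fun_mul_eq_mul_integral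
      (h.measurable_noise i).aestronglyMeasurable (h.measurable_noise j).aestronglyMeasurable
    simp only [Function.comp_apply] at hind
    rw [hind2, hmz, zero_mul, mul_zero] at hind
    refine Eq.trans (integral_congr_ae (Eventually.of_forall fun a => ?_)) hind
    ring
  · refine le_trans ?_ (hvar i).le
    refine integral_mono ((hL i).integrable_mul (hL i)) (hξ i).integrable_sq fun a => ?_
    beta_reduce
    split_ifs
    · exact le_of_eq (by ring)
    · simpa using sq_nonneg (ξ i a)

end Sampling

/-! ### Rank consistency from descent directions -/

section Consistency

variable {𝕜 : Type*} [RCLike 𝕜] {Ω : Type*} [MeasurableSpace Ω] {μ : Measure Ω}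
  [IsProbabilityMeasure μ] {d : ℕ} {α : Finset (Fin d)} {p : Fin d → ℝ} {ω : ℕ → Ω → Fin d}
  {ξ : ℕ → Ω → ℝ} {n₁ n₂ : ℕ}

/-- The order of choices matters: `q` comes from the sampling law, `δ` from `q` and the geometry,
`ε₀` from `δ`. Only then is `ε` fixed and `m` sent to infinity, so the events for the given `δ`
become likely. -/
theorem exists_rankConsistent_of_hasRankDescent (hsamp : IsSampling μ α p ω ξ) {ν : ℝ}
    (hν : 0 < ν) {ρ : ℕ → ℝ} (hρpos : ∀ m, 0 < ρ m) (hρ0 : Tendsto ρ atTop (𝓝 0))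
    (hρ : Tendsto (fun m : ℕ => √(m : ℝ) * ρ m) atTop atTop)
    {γ : ℕ → Ω → ℝ} (hγ0 : ∀ m a, 0 ≤ γ m a) (hγ : BoundedInProb μ γ)
    {V : Submodule ℝ (Matrix (Fin n₁) (Fin n₂) 𝕜)} {Θ : Fin d → Matrix (Fin n₁) (Fin n₂) 𝕜}
    (hΘ : IsONBasis V Θ) {Xbar : Matrix (Fin n₁) (Fin n₂) 𝕜} (hXbar : Xbar ∈ V)
    (hrank : 1 ≤ Xbar.rank) {S : Set (Matrix (Fin n₁) (Fin n₂) 𝕜)}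
    (hS : S ⊆ feasible V Θ α Xbar) (hclosed : IsClosed S) (hmem : Xbar ∈ S)
    (hdesc : HasRankDescent V S Xbar)
    {Xtilde : ℕ → Ω → Matrix (Fin n₁) (Fin n₂) 𝕜}
    (hXt : TendstoInMeasure μ Xtilde atTop fun _ => Xbar) {τ : ℝ} (hτ : 0 < τ) :
    ∃ ε₀ : ℝ, 0 < ε₀ ∧ ∀ ε : ℝ, 0 < ε → ε ≤ ε₀ →
      ∀ Xhat : ℕ → Ω → Matrix (Fin n₁) (Fin n₂) 𝕜,
        (∀ m, 1 ≤ m → ∀ᵐ a ∂μ, Solves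
          (objective Θ Xbar ν m (fun i => ω i a) (fun i => ξ i a) (ρ m) (γ m a)
            (rankCorr τ ε (Xtilde m a)) (Xtilde m a)) S (Xhat m a)) →
        RankConsistent μ Xhat Xbar := by
  -- If every coefficient is fixed the condition is empty, and `q = 1` serves.
  obtain ⟨q, hq, hqp⟩ : ∃ q : ℝ, 0 < q ∧ ∀ k ∉ α, q ≤ p k / 2 := by
    by_cases hne : (αᶜ : Finset (Fin d)).Nonempty
    · obtain ⟨k, hk, hmin⟩ := Finset.exists_min_image αᶜ p hne
      refine ⟨p k / 2, half_pos (hsamp.prob_pos k (Finset.mem_compl.mp hk)), fun j hj => ?_⟩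
      linarith [hmin j (Finset.mem_compl.mpr hj)]
    · exact ⟨1, one_pos, fun k hk => (hne ⟨k, Finset.mem_compl.mpr hk⟩).elim⟩
  obtain ⟨δ, hδ, hcore⟩ := exists_rank_eq_of_solves hΘ hXbar hS hclosed hmem hdesc hq
  obtain ⟨ε₀, hε₀, hnear⟩ := exists_eventually_norm_rankCorr_sub_lt hrank hτ hδ
  refine ⟨ε₀, hε₀, fun ε hε hle Xhat hsol => ?_⟩
  have hfreq : HighProb μ fun m a => ∀ k ∉ α, q ≤ freq m (fun i => ω i a) k := by
    refine HighProb.forall fun k => ?_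
    by_cases hk : k ∈ α
    · simp [HighProb, hk]
    · refine (hsamp.highProb_freq hk).mono (Eventually.of_forall fun m =>
        Eventually.of_forall fun a ha _ => (hqp k hk).trans ha)
  have hnoise : HighProb μ fun m a => ∀ k,
      |ν * noiseMean m (fun i => ω i a) (fun i => ξ i a) k| ≤ δ * ρ m := by
    refine HighProb.forall fun k => ?_
    refine (hsamp.highProb_noise k (b := fun m => δ / ν * ρ m)
      (fun m => mul_pos (div_pos hδ hν) (hρpos m)) ?_).mono (Eventually.of_forall fun m =>
        Eventually.of_forall fun a ha => ?_)
    · have := hρ.const_mul_atTop (div_pos hδ hν)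
      refine this.congr fun m => by ring
    · rw [abs_mul, abs_of_pos hν]
      calc ν * _ ≤ ν * (δ / ν * ρ m) := by gcongr
        _ = δ * ρ m := by field_simp
  have hcorr : HighProb μ fun m a => ‖rankCorr τ ε (Xtilde m a) - polarFactor Xbar‖ < δ :=
    highProb_of_tendstoInMeasure hXt (hnear ε hε hle)
  have hγX : HighProb μ fun m a => γ m a * ‖Xtilde m a - Xbar‖ ≤ δ := by
    refine hγ.highProb fun M hM => ?_
    have hev : ∀ᶠ Y in 𝓝 Xbar, ‖Y - Xbar‖ < δ / M := by
      have hc : ContinuousAt (fun Y : Matrix (Fin n₁) (Fin n₂) 𝕜 => ‖Y - Xbar‖) Xbar := by fun_prop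
      exact hc.eventually_lt_const (by simpa using div_pos hδ hM)
    refine (highProb_of_tendstoInMeasure hXt hev).mono (Eventually.of_forall fun m =>
      Eventually.of_forall fun a ha hle => ?_)
    calc γ m a * ‖Xtilde m a - Xbar‖ ≤ M * (δ / M) :=
          mul_le_mul ((le_abs_self _).trans hle) ha.le (norm_nonneg _) hM.le
      _ = δ := by field_simp
  have hγρ : HighProb μ fun m a => γ m a * ρ m ≤ 1 := by
    refine hγ.highProb fun M hM => ?_
    have htriv : HighProb μ fun _ _ => True := by simp [HighProb]
    refine htriv.mono ?_
    filter_upwards [hρ0.eventually_lt_const (inv_pos.mpr hM)] with m hm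
    refine Eventually.of_forall fun a _ hle => ?_
    calc γ m a * ρ m ≤ M * M⁻¹ :=
          mul_le_mul ((le_abs_self _).trans hle) hm.le (hρpos m).le hM.le
      _ = 1 := mul_inv_cancel₀ hM.ne'
  refine HighProb.tendsto_one ?_
  refine ((((hfreq.and hnoise).and hcorr).and hγX).and hγρ).mono ?_
  filter_upwards [hρ0.eventually_lt_const one_pos, eventually_ge_atTop 1] with m hm1 hm
  filter_upwards [hsol m hm] with a ha
  rintro ⟨⟨⟨⟨h1, h2⟩, h3⟩, h4⟩, h5⟩
  exact hcore ν m _ _ (ρ m) (γ m a) _ _ _ (hρpos m) hm1.le (hγ0 m a) h5 h1 h2 h3.le h4 ha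

end Consistency

/-! ### Descent directions in the rectangular case -/

section Descent

variable {𝕜 : Type*} [RCLike 𝕜] {n₁ n₂ d : ℕ}

/-- The rank does not drop near a matrix. -/
theorem rank_le_rank_of_norm_sub_lt {X Y : Matrix (Fin n₁) (Fin n₂) 𝕜} {s : ℝ}
    (hmin : ∀ k, 0 < singVals X k → s ≤ singVals X k) (h : ‖Y - X‖ < s) : X.rank ≤ Y.rank := by
  by_contra hcon
  push Not at hcon
  have hlt : Y.rank < min n₁ n₂ := lt_of_lt_of_le hcon (rank_le_min X)
  have h1 := singVals_le_norm_sub X Y ⟨Y.rank, hlt⟩ le_rfl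
  have h2 := hmin ⟨Y.rank, hlt⟩ ((singVals_pos_iff X _).mpr hcon)
  rw [norm_sub_rev] at h
  linarith

theorem coeffs_add (Θ : Fin d → Matrix (Fin n₁) (Fin n₂) 𝕜) (α : Finset (Fin d))
    (X Y : Matrix (Fin n₁) (Fin n₂) 𝕜) : coeffs Θ α (X + Y) = coeffs Θ α X + coeffs Θ α Y :=
  funext fun _ => trInner_add_right _ _ _

theorem coeffs_sub (Θ : Fin d → Matrix (Fin n₁) (Fin n₂) 𝕜) (α : Finset (Fin d))
    (X Y : Matrix (Fin n₁) (Fin n₂) 𝕜) : coeffs Θ α (X - Y) = coeffs Θ α X - coeffs Θ α Y :=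
  funext fun _ => trInner_sub_right _ _ _

theorem coeffs_smul (Θ : Fin d → Matrix (Fin n₁) (Fin n₂) 𝕜) (α : Finset (Fin d)) (c : ℝ)
    (X : Matrix (Fin n₁) (Fin n₂) 𝕜) : coeffs Θ α (c • X) = c • coeffs Θ α X :=
  funext fun _ => trInner_smul_right _ _ _

/-- If the coefficients `R_α` map a subspace onto `ℝ^α`, they have a bounded right inverse with
values in this subspace. -/
theorem exists_bounded_preimage {Θ : Fin d → Matrix (Fin n₁) (Fin n₂) 𝕜} {α : Finset (Fin d)}
    (T : Submodule ℝ (Matrix (Fin n₁) (Fin n₂) 𝕜))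
    (h : coeffs Θ α '' (T : Set (Matrix (Fin n₁) (Fin n₂) 𝕜)) = Set.univ) :
    ∃ C : ℝ, 0 ≤ C ∧ ∀ v : α → ℝ, ∃ K ∈ T, coeffs Θ α K = v ∧ ‖K‖ ≤ C * ‖v‖ := by
  classical
  have h1 : ∀ j : α, ∃ K ∈ T, coeffs Θ α K = Pi.single j 1 := by
    intro j
    have hj : (Pi.single j 1 : α → ℝ) ∈ coeffs Θ α '' (T : Set (Matrix (Fin n₁) (Fin n₂) 𝕜)) := by
      rw [h]
      trivial
    simpa using hj
  choose K hKT hK using h1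
  refine ⟨∑ j, ‖K j‖, by positivity, fun v => ⟨∑ j, v j • K j,
    T.sum_mem fun j _ => T.smul_mem _ (hKT j), ?_, ?_⟩⟩
  · ext k
    have h2 : ∀ j, trInner (Θ k) (K j) = (Pi.single j 1 : α → ℝ) k := fun j => congrFun (hK j) k
    simp [coeffs, trInner_sum_right, trInner_smul_right, h2, Pi.single_apply]
  · rw [Finset.sum_mul]
    refine (norm_sum_le _ _).trans (Finset.sum_le_sum fun j _ => ?_)
    rw [norm_smul, mul_comm]
    exact mul_le_mul_of_nonneg_left (norm_le_pi_norm v j) (norm_nonneg _)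

/-- `tangentSpace V X` as a subspace. -/
def tangentSubmodule (V : Submodule ℝ (Matrix (Fin n₁) (Fin n₂) 𝕜))
    (X : Matrix (Fin n₁) (Fin n₂) 𝕜) : Submodule ℝ (Matrix (Fin n₁) (Fin n₂) 𝕜) where
  carrier := tangentSpace V X
  add_mem' := fun hA hB => ⟨V.add_mem hA.1 hB.1, fun U W h => by
    rw [Matrix.mul_add, Matrix.add_mul, hA.2 U W h, hB.2 U W h, add_zero]⟩
  zero_mem' := ⟨V.zero_mem, fun U W _ => by rw [Matrix.mul_zero, Matrix.zero_mul]⟩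
  smul_mem' := fun c A hA => ⟨V.smul_mem c hA.1, fun U W h => by
    rw [Matrix.mul_smul, Matrix.smul_mul, hA.2 U W h, smul_zero]⟩

/-- The orthogonal projection onto the matrix space preserves contractions. -/
theorem IsMatrixSpace.exists_projection {V : Submodule ℝ (Matrix (Fin n₁) (Fin n₂) 𝕜)}
    (hV : IsMatrixSpace 𝕜 V) :
    ∃ P : Matrix (Fin n₁) (Fin n₂) 𝕜 →ₗ[ℝ] Matrix (Fin n₁) (Fin n₂) 𝕜,
      (∀ X, P X ∈ V) ∧ (∀ X ∈ V, P X = X) ∧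
      (∀ X Y, trInner (P X) Y = trInner X (P Y)) ∧
      ∀ A, IsContraction A → IsContraction (P A) := by
  cases hV with
  | full =>
    exact ⟨LinearMap.id, fun _ => trivial, fun _ _ => rfl, fun _ _ => rfl, fun _ h => h⟩
  | hermitian =>
    refine ⟨{ toFun := fun X => (1 / 2 : ℝ) • (X + Xᴴ)
              map_add' := fun X Y => ?_
              map_smul' := fun c X => ?_ }, fun X => ?_, fun X hX => ?_, fun X Y => ?_,
              fun A hA => hA.convex hA.conjTranspose⟩
    · rw [conjTranspose_add, ← smul_add]
      congr 1
      abel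
    · rw [conjTranspose_smul, star_trivial, ← smul_add, smul_comm, RingHom.id_apply]
    · change ((1 / 2 : ℝ) • (X + Xᴴ))ᴴ = (1 / 2 : ℝ) • (X + Xᴴ)
      rw [conjTranspose_smul, conjTranspose_add, conjTranspose_conjTranspose, star_trivial,
        add_comm]
    · have hX' : Xᴴ = X := hX
      change (1 / 2 : ℝ) • (X + Xᴴ) = X
      rw [hX', ← two_smul ℝ X, smul_smul]
      norm_num
    · change trInner ((1 / 2 : ℝ) • (X + Xᴴ)) Y = trInner X ((1 / 2 : ℝ) • (Y + Yᴴ))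
      have h := trInner_conjTranspose X Yᴴ
      rw [conjTranspose_conjTranspose] at h
      rw [trInner_smul_left, trInner_smul_right, trInner_add_left, trInner_add_right, h]

/-- Among more than `X.rank` matrices whose sum is a contraction, one is poorly aligned with the
polar factor of `X`. -/
theorem exists_trInner_polarFactor_le {ι : Type*} {s : Finset ι}
    {E : ι → Matrix (Fin n₁) (Fin n₂) 𝕜} (hE : IsContraction (∑ k ∈ s, E k))
    (X : Matrix (Fin n₁) (Fin n₂) 𝕜) (hs : X.rank < s.card) :
    ∃ k ∈ s, trInner (polarFactor X) (E k) ≤ 1 - 1 / (X.rank + 1) := by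
  have h1 := hE.trInner_polarFactor_le X
  -- The pairings sum to at most the rank and there are at least `X.rank + 1` of them, so the
  -- smallest is at most their average.
  rw [trInner_comm, trInner_sum_right] at h1
  refine Finset.exists_le_of_sum_le (Finset.card_pos.mp (by omega)) (h1.trans ?_)
  have h2 : ((X.rank : ℝ) + 1) ≤ s.card := by exact_mod_cast hs
  have h3 : (0 : ℝ) < X.rank + 1 := by positivity
  have h4 : (1 : ℝ) - 1 / (X.rank + 1) = X.rank / (X.rank + 1) := by field_simp; ring
  rw [Finset.sum_const, nsmul_eq_mul, h4, mul_div_assoc', le_div_iff₀ h3, mul_comm]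
  gcongr

variable {V : Submodule ℝ (Matrix (Fin n₁) (Fin n₂) 𝕜)} {Θ : Fin d → Matrix (Fin n₁) (Fin n₂) 𝕜}
  {α : Finset (Fin d)} {Xbar : Matrix (Fin n₁) (Fin n₂) 𝕜}

/-- The direction is `K - P (E k)`: it removes a singular dyad of `X` poorly aligned with the polar
factor of `Xbar`, and `K`, tangent at `Xbar`, restores the fixed coefficients. The projection `P` is
needed because the dyads of a Hermitian matrix need not be Hermitian. -/
theorem hasRankDescent_feasible (hV : IsMatrixSpace 𝕜 V) (hΘ : IsONBasis V Θ)
    (hnd : ConstraintNondeg V Θ α Xbar) : HasRankDescent V (feasible V Θ α Xbar) Xbar := by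
  obtain ⟨P, hPV, hPid, hPadj, hPc⟩ := hV.exists_projection
  obtain ⟨s, hs, hmin⟩ := exists_pos_le_singVals Xbar
  obtain ⟨C₀, hC₀, hpre⟩ := exists_bounded_preimage (tangentSubmodule V Xbar) hnd
  obtain ⟨c, hc, hnear⟩ := exists_abs_trInner_sub_polarFactor_le Xbar
  set L : ℝ := √(n₁ : ℝ) with hL
  have hL0 : 0 ≤ L := Real.sqrt_nonneg _
  set κ : ℝ := 1 / (Xbar.rank + 1) with hκ
  have hκ0 : 0 < κ := by positivity
  have hPnorm : ∀ X, ‖P X‖ ≤ ‖X‖ := by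
    intro X
    have h1 : ‖P X‖ ^ 2 ≤ ‖X‖ * ‖P X‖ := by
      rw [← trInner_self, hPadj, hPid _ (hPV X)]
      exact trInner_le _ _
    rcases (norm_nonneg (P X)).eq_or_lt with h0 | h0
    · rw [← h0]; exact norm_nonneg _
    · nlinarith
  set C : ℝ := C₀ + 1 with hC
  -- the accuracy with which a contraction has to norm `Xbar`
  set e : ℝ := (κ / (4 * (c * C₀ + 1))) ^ 2 with he
  have he0 : 0 < e := by positivity
  have hcC : c * √e * C₀ ≤ κ / 4 := by
    rw [he, Real.sqrt_sq (by positivity)]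
    have h0 : 0 ≤ c * C₀ := by positivity
    have e1 : c * (κ / (4 * (c * C₀ + 1))) * C₀ = κ / 4 * (c * C₀ / (c * C₀ + 1)) := by
      field_simp
    rw [e1]
    refine mul_le_of_le_one_right (by positivity) ?_
    rw [div_le_one (by positivity)]
    linarith
  -- The bound `s` prevents the rank from dropping. The other one makes passing from `X` to `Xbar`
  -- cost at most `e / 2` in the duality gap; the step length accounts for the other half.
  refine ⟨κ / 2, half_pos hκ0, C, by positivity, min s (e / (4 * (L + 1))), by positivity,
    fun X hX hclose hrk => ?_⟩
  have hge := rank_le_rank_of_norm_sub_lt hmin (hclose.trans_le (min_le_left _ _))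
  have hdist : ‖X - Xbar‖ < e / (4 * (L + 1)) := hclose.trans_le (min_le_right _ _)
  have hgt : Xbar.rank < X.rank := lt_of_le_of_ne hge (Ne.symm hrk)
  obtain ⟨⟨U, W⟩, hSVD⟩ := exists_isSVD X
  simp only at hSVD
  have ⟨hU, hW, _⟩ := hSVD
  set E : Fin (min n₁ n₂) → Matrix (Fin n₁) (Fin n₂) 𝕜 := fun k =>
    U * rectDiag 𝕜 (Pi.single k 1) * Wᴴ with hE
  have hEtr : ∀ A k, trInner A (E k) = RCLike.re ((Uᴴ * A * W) (rowIdx k) (colIdx k)) := by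
    intro A k
    rw [hE, trInner_unitary_conj, trInner_rectDiag]
    simp [Pi.single_apply]
  have hEnorm : ∀ k, ‖E k‖ = 1 := by
    intro k
    have h1 : ‖E k‖ ^ 2 = 1 := by
      rw [hE, norm_mul_unitary (conjTranspose_mem hW), norm_unitary_mul hU, norm_rectDiag_sq]
      simp [Pi.single_apply, ite_pow]
    exact (pow_eq_one_iff_of_nonneg (norm_nonneg _) two_ne_zero).mp h1
  -- The dyads with positive singular value number `X.rank > Xbar.rank`, and their sum, the polar
  -- part of `X`, is a contraction.
  obtain ⟨k, hk, hkle⟩ : ∃ k ∈ Finset.univ.filter fun k => 0 < singVals X k,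
      trInner (polarFactor Xbar) (P (E k)) ≤ 1 - κ := by
    refine exists_trInner_polarFactor_le ?_ Xbar (by rwa [card_singVals_pos])
    rw [← map_sum]
    refine hPc _ ?_
    rw [hE, ← Matrix.sum_mul, ← Matrix.mul_sum, ← rectDiag_sum]
    refine isContraction_unitary_rectDiag hU hW fun j => ?_
    rw [Finset.sum_apply]
    simp only [Pi.single_apply, Finset.sum_ite_eq]
    split_ifs <;> simp
  have hkpos : 0 < singVals X k := (Finset.mem_filter.mp hk).2
  obtain ⟨K, hKT, hKα, hKn⟩ := hpre (coeffs Θ α (P (E k)))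
  have hKn' : ‖K‖ ≤ C₀ := by
    refine hKn.trans (mul_le_of_le_one_right hC₀ ((pi_norm_le_iff_of_nonneg zero_le_one).mpr
      fun j => ?_))
    exact (hΘ.abs_trInner_le j _).trans ((hPnorm _).trans (hEnorm k).le)
  have hHn : ‖K - P (E k)‖ ≤ C :=
    (norm_sub_le _ _).trans (add_le_add hKn' ((hPnorm _).trans (hEnorm k).le))
  set H := K - P (E k) with hH
  have hHV : H ∈ V := V.sub_mem hKT.1 (hPV _)
  -- The second bound involves `singVals X k`, which may be arbitrarily small near `Xbar`. This is
  -- harmless because the step length may depend on `X`.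
  refine ⟨H, hHV, hHn, min (e / (4 * (L + 1) * (C + 1)))
    (singVals X k * κ / (8 * (L + 1) * (C + 1))), by positivity, fun t ht htle => ⟨⟨?_, ?_⟩, ?_⟩⟩
  · exact V.add_mem hX.1 (V.smul_mem t hHV)
  · rw [coeffs_add, coeffs_smul, hH, coeffs_sub, hKα, sub_self, smul_zero, add_zero, hX.2]
  · have ht1 : t * (4 * (L + 1) * (C + 1)) ≤ e := by
      have := htle.trans (min_le_left _ _)
      rwa [le_div_iff₀ (by positivity)] at this
    have ht2 : t * (8 * (L + 1) * (C + 1)) ≤ singVals X k * κ := by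
      have := htle.trans (min_le_right _ _)
      rwa [le_div_iff₀ (by positivity)] at this
    obtain ⟨A₀, hA₀, hA₀eq⟩ := exists_isContraction_trInner_eq (X + t • H)
    -- Projecting keeps a norming contraction, as `X + t • H` lies in `V`, and makes `A` pair with
    -- `P (E k)` exactly as with `E k`.
    set A := P A₀ with hA
    have hAc : IsContraction A := hPc _ hA₀
    have hAeq : trInner A (X + t • H) = nuclearNorm (X + t • H) := by
      rw [hA, hPadj, hPid _ (V.add_mem hX.1 (V.smul_mem t hHV)), hA₀eq]
    rw [trInner_add_right, trInner_smul_right] at hAeq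
    have hAX := hAc.trInner_le_nuclearNorm X
    have hmain : trInner A H ≤ trInner (polarFactor Xbar) H - κ / 2 := by
      have hHL : t * |trInner A H| ≤ t * (L * C) := by
        refine mul_le_mul_of_nonneg_left ((hAc.abs_trInner_le H).trans ?_) ht.le
        gcongr
      have habs := mul_le_mul_of_nonneg_left (le_abs_self (trInner A H)) ht.le
      have habs' := mul_le_mul_of_nonneg_left (neg_abs_le (trInner A H)) ht.le
      have htn : ‖X - (X + t • H)‖ ≤ t * C := by
        rw [sub_add_cancel_left, norm_neg, norm_smul, Real.norm_of_nonneg ht.le]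
        gcongr
      have hg1 := nuclearNorm_le_add X (X + t • H)
      have hg1' : L * ‖X - (X + t • H)‖ ≤ t * (L * C) := by
        calc L * ‖X - (X + t • H)‖ ≤ L * (t * C) := by gcongr
          _ = _ := by ring
      -- `A` norms `X + t • H`, and passing to `X` changes the pairing and the nuclear norm by at
      -- most `t * (L * C)` each.
      have hXA : nuclearNorm X - trInner A X ≤ 2 * (t * (L * C)) := by linarith
      have htLC : t * (L * C) ≤ t * ((L + 1) * (C + 1)) := by
        gcongr <;> linarith
      have hEk : 1 - κ / 4 ≤ trInner A (E k) := by
        have h1 := hAc.singVals_mul_le hSVD k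
        rw [← hEtr] at h1
        have h2 : singVals X k * (1 - trInner A (E k)) ≤ singVals X k * (κ / 4) := by linarith
        linarith [le_of_mul_le_mul_left h2 hkpos]
      have hKb : trInner A K ≤ trInner (polarFactor Xbar) K + κ / 4 := by
        have h1 := (le_abs_self _).trans (hnear A hAc V K hKT)
        have h2 : nuclearNorm Xbar - trInner A Xbar ≤ e := by
          have h3 := nuclearNorm_le_add Xbar X
          have h4 := (le_abs_self _).trans (hAc.abs_trInner_le (X - Xbar))
          rw [norm_sub_rev] at h3
          rw [trInner_sub_right] at h4
          rw [lt_div_iff₀ (by positivity)] at hdist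
          have h5 : L * ‖X - Xbar‖ ≤ (L + 1) * ‖X - Xbar‖ := by
            gcongr
            linarith
          linarith
        have h6 : c * √(nuclearNorm Xbar - trInner A Xbar) * ‖K‖ ≤ κ / 4 := by
          refine le_trans ?_ hcC
          gcongr
        linarith
      have hPE : trInner A (P (E k)) = trInner A (E k) := by
        rw [← hPadj, hPid _ (hPV A₀)]
      rw [hH, trInner_sub_right, trInner_sub_right, hPE]
      linarith
    calc nuclearNorm (X + t • H) - nuclearNorm X ≤ t * trInner A H := by linarith
      _ ≤ _ := mul_le_mul_of_nonneg_left hmain ht.le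

theorem isClosed_feasible : IsClosed (feasible V Θ α Xbar) := by
  have h1 : IsClosed (V : Set (Matrix (Fin n₁) (Fin n₂) 𝕜)) := V.closed_of_finiteDimensional
  have h2 : Continuous (coeffs Θ α) := continuous_pi fun k => continuous_trInner _
  exact h1.inter (isClosed_eq h2 continuous_const)

end Descent

/-! ### Descent directions in the positive semidefinite case -/

section QuadraticForm

variable {𝕜 : Type*} [RCLike 𝕜] {n d : ℕ}

/-- The real quadratic form of a square matrix. -/
def quadForm (X : Matrix (Fin n) (Fin n) 𝕜) (b : Fin n → 𝕜) : ℝ :=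
  RCLike.re (star b ⬝ᵥ X *ᵥ b)

/-- Pairing with the rank-one matrix `b bᴴ` turns linearity and continuity in the matrix into facts
about `trInner`. -/
theorem quadForm_eq_trInner (X : Matrix (Fin n) (Fin n) 𝕜) (b : Fin n → 𝕜) :
    quadForm X b = trInner (vecMulVec b (star b)) X := by
  rw [quadForm, trInner_eq_sum]
  simp only [dotProduct, mulVec, vecMulVec_apply, Finset.mul_sum, map_sum, Pi.star_apply,
    star_mul', star_star]
  refine Finset.sum_congr rfl fun i _ => Finset.sum_congr rfl fun j _ => ?_
  congr 1
  ring

theorem quadForm_add (X Y : Matrix (Fin n) (Fin n) 𝕜) (b : Fin n → 𝕜) :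
    quadForm (X + Y) b = quadForm X b + quadForm Y b := by
  simp only [quadForm_eq_trInner, trInner_add_right]

theorem quadForm_sub (X Y : Matrix (Fin n) (Fin n) 𝕜) (b : Fin n → 𝕜) :
    quadForm (X - Y) b = quadForm X b - quadForm Y b := by
  simp only [quadForm_eq_trInner, trInner_sub_right]

theorem quadForm_smul (c : ℝ) (X : Matrix (Fin n) (Fin n) 𝕜) (b : Fin n → 𝕜) :
    quadForm (c • X) b = c * quadForm X b := by
  simp only [quadForm_eq_trInner, trInner_smul_right]

theorem quadForm_smul_vec (X : Matrix (Fin n) (Fin n) 𝕜) (c : 𝕜) (b : Fin n → 𝕜) :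
    quadForm X (c • b) = ‖c‖ ^ 2 * quadForm X b := by
  rw [quadForm, quadForm, star_smul, mulVec_smul, smul_dotProduct, dotProduct_smul, smul_eq_mul,
    smul_eq_mul, ← mul_assoc, RCLike.star_def, RCLike.conj_mul, ← RCLike.ofReal_pow,
    RCLike.re_ofReal_mul]

theorem continuous_quadForm :
    Continuous fun q : Matrix (Fin n) (Fin n) 𝕜 × (Fin n → 𝕜) => quadForm q.1 q.2 :=
  RCLike.continuous_re.comp (continuous_snd.star.dotProduct
    (continuous_fst.matrix_mulVec continuous_snd))

theorem _root_.Matrix.PosSemidef.quadForm_nonneg {X : Matrix (Fin n) (Fin n) 𝕜}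
    (hX : X.PosSemidef) (b : Fin n → 𝕜) : 0 ≤ quadForm X b :=
  (RCLike.nonneg_iff.mp (hX.dotProduct_mulVec_nonneg b)).1

theorem posSemidef_of_quadForm_nonneg {X : Matrix (Fin n) (Fin n) 𝕜} (hX : X.IsHermitian)
    (h : ∀ b, 0 ≤ quadForm X b) : X.PosSemidef :=
  posSemidef_iff_dotProduct_mulVec.mpr ⟨hX, fun b =>
    RCLike.nonneg_iff.mpr ⟨h b, hX.im_star_dotProduct_mulVec_self b⟩⟩

theorem _root_.Matrix.PosSemidef.mulVec_eq_zero_of_quadForm {X : Matrix (Fin n) (Fin n) 𝕜}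
    (hX : X.PosSemidef) {b : Fin n → 𝕜} (h : quadForm X b = 0) : X *ᵥ b = 0 := by
  refine (hX.dotProduct_mulVec_zero_iff b).mp (RCLike.ext ?_ ?_)
  · rw [map_zero]
    exact h
  · rw [map_zero]
    exact hX.1.im_star_dotProduct_mulVec_self b

theorem isClosed_posSemidef : IsClosed {X : Matrix (Fin n) (Fin n) 𝕜 | X.PosSemidef} := by
  have h : {X : Matrix (Fin n) (Fin n) 𝕜 | X.PosSemidef} =
      (hermitianSpace 𝕜 n : Set (Matrix (Fin n) (Fin n) 𝕜)) ∩ ⋂ b, {X | 0 ≤ quadForm X b} := by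
    ext X
    simp only [Set.mem_inter_iff, Set.mem_iInter]
    exact ⟨fun hX => ⟨hX.1, fun b => hX.quadForm_nonneg b⟩,
      fun hX => posSemidef_of_quadForm_nonneg hX.1 hX.2⟩
  rw [h]
  refine (hermitianSpace 𝕜 n).closed_of_finiteDimensional.inter (isClosed_iInter fun b =>
    isClosed_le continuous_const ?_)
  simp only [quadForm_eq_trInner]
  exact continuous_trInner _

/-- A Hermitian direction that is positive definite on the kernel of a positive semidefinite
matrix points into the cone of positive semidefinite matrices. -/
theorem _root_.Matrix.PosSemidef.exists_add_smul_posSemidef {X H : Matrix (Fin n) (Fin n) 𝕜}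
    (hX : X.PosSemidef) (hH : H.IsHermitian)
    (hpos : ∀ b, ‖b‖ = 1 → X *ᵥ b = 0 → 0 < quadForm H b) :
    ∃ t₀ : ℝ, 0 < t₀ ∧ ∀ t : ℝ, 0 < t → t ≤ t₀ → (X + t • H).PosSemidef := by
  have : ProperSpace (Fin n → 𝕜) := FiniteDimensional.proper ℝ _
  have hcX : Continuous (quadForm X) :=
    continuous_quadForm.comp (continuous_const.prodMk continuous_id)
  have hcH : Continuous (quadForm H) :=
    continuous_quadForm.comp (continuous_const.prodMk continuous_id)
  have hsphere : IsCompact (Metric.sphere (0 : Fin n → 𝕜) 1) := isCompact_sphere _ _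
  obtain ⟨C, hC⟩ := hsphere.exists_bound_of_continuousOn hcH.continuousOn
  -- On the compact set of unit vectors where the form of `H` is nonpositive, the form of `X` has no
  -- zero: a zero would be a kernel vector, where `H` is positive. Hence it is bounded below there.
  have hlow : ∃ m : ℝ, 0 < m ∧ ∀ b : Fin n → 𝕜, ‖b‖ = 1 → quadForm H b ≤ 0 → m ≤ quadForm X b := by
    have hcomp : IsCompact (Metric.sphere (0 : Fin n → 𝕜) 1 ∩ {b | quadForm H b ≤ 0}) :=
      hsphere.inter_right (isClosed_le hcH continuous_const)
    rcases (Metric.sphere (0 : Fin n → 𝕜) 1 ∩ {b | quadForm H b ≤ 0}).eq_empty_or_nonempty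
      with he | hne
    · refine ⟨1, one_pos, fun b hb hb' => ?_⟩
      have : b ∈ Metric.sphere (0 : Fin n → 𝕜) 1 ∩ {b | quadForm H b ≤ 0} :=
        ⟨by simpa using hb, hb'⟩
      rw [he] at this
      exact this.elim
    · obtain ⟨b₀, hb₀, hmin⟩ := hcomp.exists_isMinOn hne hcX.continuousOn
      have hb₀' : ‖b₀‖ = 1 := by simpa using hb₀.1
      refine ⟨quadForm X b₀, lt_of_le_of_ne (hX.quadForm_nonneg b₀) fun h => ?_,
        fun b hb hb' => hmin ⟨by simpa using hb, hb'⟩⟩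
      exact absurd hb₀.2 (not_le.mpr (hpos b₀ hb₀' (hX.mulVec_eq_zero_of_quadForm h.symm)))
  obtain ⟨m, hm, hmin⟩ := hlow
  refine ⟨m / (|C| + 1), by positivity, fun t ht htle => ?_⟩
  rw [le_div_iff₀ (by positivity)] at htle
  have hunit : ∀ b : Fin n → 𝕜, ‖b‖ = 1 → 0 ≤ quadForm (X + t • H) b := by
    intro b hb
    rw [quadForm_add, quadForm_smul]
    rcases le_or_gt (quadForm H b) 0 with h | h
    · have h1 := hmin b hb h
      have h2 : -|C| ≤ quadForm H b := by
        have := hC b (by simpa using hb)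
        rw [Real.norm_eq_abs] at this
        linarith [neg_abs_le (quadForm H b), le_abs_self C]
      nlinarith [mul_le_mul_of_nonneg_left h2 ht.le]
    · exact add_nonneg (hX.quadForm_nonneg b) (mul_nonneg ht.le h.le)
  refine posSemidef_of_quadForm_nonneg (hX.1.add ?_) fun b => ?_
  · exact (hermitianSpace 𝕜 n).smul_mem t hH
  · rcases eq_or_ne b 0 with rfl | hb
    · simp [quadForm]
    · have hb' : ‖b‖ ≠ 0 := norm_ne_zero_iff.mpr hb
      have h1 := hunit (((‖b‖⁻¹ : ℝ) : 𝕜) • b) (by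
        rw [norm_smul, RCLike.norm_ofReal, abs_of_nonneg (by positivity), inv_mul_cancel₀ hb'])
      rw [quadForm_smul_vec, RCLike.norm_ofReal] at h1
      exact nonneg_of_mul_nonneg_right h1 (by positivity)

/-- The Hermitian matrices whose quadratic form vanishes on the kernel of `X`. -/
def kerVanishing (X : Matrix (Fin n) (Fin n) 𝕜) : Submodule ℝ (Matrix (Fin n) (Fin n) 𝕜) where
  carrier := {K | K.IsHermitian ∧ ∀ b, X *ᵥ b = 0 → quadForm K b = 0}
  add_mem' := fun hA hB => ⟨hA.1.add hB.1, fun b hb => by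
    rw [quadForm_add, hA.2 b hb, hB.2 b hb, add_zero]⟩
  zero_mem' := ⟨isHermitian_zero, fun b _ => by simp [quadForm]⟩
  smul_mem' := fun c A hA => ⟨(hermitianSpace 𝕜 n).smul_mem c hA.1, fun b hb => by
    rw [quadForm_smul, hA.2 b hb, mul_zero]⟩

/-- Polarization. -/
theorem dotProduct_mulVec_eq_zero_of_mem_kerVanishing {X K : Matrix (Fin n) (Fin n) 𝕜}
    (hK : K ∈ kerVanishing X) {b b' : Fin n → 𝕜} (hb : X *ᵥ b = 0) (hb' : X *ᵥ b' = 0) :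
    star b ⬝ᵥ K *ᵥ b' = 0 := by
  have hre : ∀ b' : Fin n → 𝕜, X *ᵥ b' = 0 → RCLike.re (star b ⬝ᵥ K *ᵥ b') = 0 := by
    intro b' hb'
    have h1 := hK.2 (b + b') (by rw [mulVec_add, hb, hb', add_zero])
    have h2 := hK.2 b hb
    have h3 := hK.2 b' hb'
    have h4 : star b' ⬝ᵥ K *ᵥ b = star (star b ⬝ᵥ K *ᵥ b') := by
      rw [← star_dotProduct_star, star_star, star_mulVec, hK.1.eq, dotProduct_mulVec,
        dotProduct_comm]
    simp only [quadForm] at h1 h2 h3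
    rw [mulVec_add, star_add, add_dotProduct, dotProduct_add, dotProduct_add, h4] at h1
    simp only [map_add, RCLike.star_def, RCLike.conj_re] at h1
    linarith
  set z := star b ⬝ᵥ K *ᵥ b' with hz
  -- Replacing `b'` by `star z • b'` turns `z` into `|z|²`, so the vanishing of real parts gives `z
  -- = 0`.
  have h5 := hre (star z • b') (by rw [mulVec_smul, hb', smul_zero])
  rw [mulVec_smul, dotProduct_smul, smul_eq_mul, ← hz, RCLike.star_def, RCLike.conj_mul,
    ← RCLike.ofReal_pow, RCLike.ofReal_re] at h5
  simpa using h5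

/-- Near `X`, the forms in a bounded part of `kerVanishing X` are small on almost-kernel
vectors. -/
theorem exists_abs_quadForm_lt (X : Matrix (Fin n) (Fin n) 𝕜) (C : ℝ) {η : ℝ} (hη : 0 < η) :
    ∃ δ : ℝ, 0 < δ ∧ ∀ K ∈ kerVanishing X, ‖K‖ ≤ C → ∀ b : Fin n → 𝕜, ‖b‖ = 1 →
      ‖X *ᵥ b‖ < δ → |quadForm K b| < η := by
  have : ProperSpace (Fin n → 𝕜) := FiniteDimensional.proper ℝ _
  have : ProperSpace (Matrix (Fin n) (Fin n) 𝕜) := FiniteDimensional.proper ℝ _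
  -- The set of violating pairs is compact, and `‖X *ᵥ b‖` never vanishes on it, since forms in
  -- `kerVanishing X` vanish on kernel vectors. Its minimum over the set is the required `δ`.
  set Q : Set (Matrix (Fin n) (Fin n) 𝕜 × (Fin n → 𝕜)) :=
    ((Metric.closedBall 0 C ∩ kerVanishing X) ×ˢ Metric.sphere 0 1) ∩
      {q | η ≤ |quadForm q.1 q.2|} with hQ
  have hclosed : IsClosed {q : Matrix (Fin n) (Fin n) 𝕜 × (Fin n → 𝕜) |
      η ≤ |quadForm q.1 q.2|} := isClosed_le continuous_const continuous_quadForm.abs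
  have hker : IsClosed (kerVanishing X : Set (Matrix (Fin n) (Fin n) 𝕜)) :=
    (kerVanishing X).closed_of_finiteDimensional
  have hball : IsCompact (Metric.closedBall (0 : Matrix (Fin n) (Fin n) 𝕜) C ∩
      kerVanishing X) := (isCompact_closedBall _ _).inter_right hker
  have hcomp : IsCompact Q := (hball.prod (isCompact_sphere _ _)).inter_right hclosed
  have hc : Continuous fun q : Matrix (Fin n) (Fin n) 𝕜 × (Fin n → 𝕜) => ‖X *ᵥ q.2‖ :=
    (continuous_const.matrix_mulVec continuous_snd).norm
  have hmem : ∀ K ∈ kerVanishing X, ‖K‖ ≤ C → ∀ b : Fin n → 𝕜, ‖b‖ = 1 →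
      η ≤ |quadForm K b| → (K, b) ∈ Q := fun K hK hKC b hb h =>
    ⟨⟨⟨by simpa using hKC, hK⟩, by simpa using hb⟩, h⟩
  rcases Q.eq_empty_or_nonempty with he | hne
  · refine ⟨1, one_pos, fun K hK hKC b hb _ => ?_⟩
    by_contra hcon
    have := hmem K hK hKC b hb (not_lt.mp hcon)
    rw [he] at this
    exact this.elim
  · obtain ⟨⟨K₀, b₀⟩, h₀, hmin⟩ := hcomp.exists_isMinOn hne hc.continuousOn
    refine ⟨‖X *ᵥ b₀‖, norm_pos_iff.mpr fun h => ?_, fun K hK hKC b hb hlt => ?_⟩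
    · have h1 := h₀.1.1.2.2 b₀ h
      have h2 : η ≤ |quadForm K₀ b₀| := h₀.2
      rw [h1, abs_zero] at h2
      linarith
    · by_contra hcon
      have h3 : ‖X *ᵥ b₀‖ ≤ ‖X *ᵥ b‖ :=
        isMinOn_iff.mp hmin (K, b) (hmem K hK hKC b hb (not_lt.mp hcon))
      exact absurd hlt (not_lt.mpr h3)

theorem norm_mulVec_le_card_mul (D : Matrix (Fin n) (Fin n) 𝕜) (b : Fin n → 𝕜) :
    ‖D *ᵥ b‖ ≤ n * ‖D‖ * ‖b‖ := by
  refine (pi_norm_le_iff_of_nonneg (by positivity)).mpr fun i => ?_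
  calc ‖∑ j, D i j * b j‖ ≤ ∑ j, ‖D i j * b j‖ := norm_sum_le _ _
    _ ≤ ∑ _j : Fin n, ‖D‖ * ‖b‖ := Finset.sum_le_sum fun j _ => by
        rw [norm_mul]
        exact mul_le_mul (norm_entry_le D i j) (norm_le_pi_norm b j) (norm_nonneg _)
          (norm_nonneg _)
    _ = n * ‖D‖ * ‖b‖ := by simp; ring

theorem le_quadForm_one {b : Fin n → 𝕜} (hb : ‖b‖ = 1) :
    1 ≤ quadForm (1 : Matrix (Fin n) (Fin n) 𝕜) b := by
  have h1 : quadForm (1 : Matrix (Fin n) (Fin n) 𝕜) b = ∑ i, ‖b i‖ ^ 2 := by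
    rw [quadForm, one_mulVec, dotProduct, map_sum]
    refine Finset.sum_congr rfl fun i _ => ?_
    rw [Pi.star_apply, RCLike.star_def, RCLike.conj_mul, ← RCLike.ofReal_pow, RCLike.ofReal_re]
  have hne : Nonempty (Fin n) := by
    by_contra hcon
    rw [not_nonempty_iff] at hcon
    rw [Subsingleton.elim b 0, norm_zero] at hb
    exact zero_ne_one hb
  obtain ⟨i, hi⟩ := Finite.exists_max fun i => ‖b i‖
  have h2 : ‖b‖ ≤ ‖b i‖ := (pi_norm_le_iff_of_nonneg (norm_nonneg _)).mpr hi
  rw [hb] at h2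
  rw [h1]
  exact (one_le_pow₀ h2).trans (Finset.single_le_sum (f := fun i => ‖b i‖ ^ 2)
    (fun _ _ => by positivity) (Finset.mem_univ i))

/-- The trace inner product as a continuous linear functional. -/
noncomputable def trInnerCLM (A : Matrix (Fin n) (Fin n) 𝕜) :
    Matrix (Fin n) (Fin n) 𝕜 →L[ℝ] ℝ where
  toFun := trInner A
  map_add' := trInner_add_right A
  map_smul' := fun c X => trInner_smul_right c A X
  cont := continuous_trInner A

/-- First-order optimality: a linear functional minimized over the cone at `X` is nonnegative on the
tangent cone, hence zero on its lineality space. -/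
theorem trInner_eq_zero_of_mem_psdLineality {X A H : Matrix (Fin n) (Fin n) 𝕜}
    (hmin : ∀ Y : Matrix (Fin n) (Fin n) 𝕜, Y.PosSemidef → trInner A X ≤ trInner A Y)
    (hH : H ∈ psdLineality X) : trInner A H = 0 := by
  have h1 : IsLocalMinOn (trInner A) {Y : Matrix (Fin n) (Fin n) 𝕜 | Y.PosSemidef} X :=
    IsMinOn.localize fun Y hY => hmin Y hY
  have h2 : HasFDerivWithinAt (trInner A) (trInnerCLM A)
      {Y : Matrix (Fin n) (Fin n) 𝕜 | Y.PosSemidef} X := (trInnerCLM A).hasFDerivWithinAt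
  exact h1.hasFDerivWithinAt_eq_zero h2 hH.1 hH.2

/-- Both properties follow by testing with functionals that are minimal over the cone at `X`.
Pairing with `H - Hᴴ` vanishes on all Hermitian matrices and forces `H = Hᴴ`; pairing with `b bᴴ`
for `b` in the kernel of `X` is minimal because its value at `X` is `0`. -/
theorem psdLineality_subset_kerVanishing {X : Matrix (Fin n) (Fin n) 𝕜} (hX : X.PosSemidef) :
    psdLineality X ⊆ kerVanishing X := by
  intro H hH
  have hskew : ∀ Y : Matrix (Fin n) (Fin n) 𝕜, Y.IsHermitian → trInner (H - Hᴴ) Y = 0 := by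
    intro Y hY
    have h := trInner_conjTranspose H Y
    rw [hY.eq] at h
    rw [trInner_sub_left, h, sub_self]
  refine ⟨?_, fun b hb => ?_⟩
  · have h1 : trInner (H - Hᴴ) H = 0 := trInner_eq_zero_of_mem_psdLineality
      (fun Y hY => by rw [hskew X hX.1, hskew Y hY.1]) hH
    have h2 : trInner (H - Hᴴ) Hᴴ = 0 := by
      have h := trInner_conjTranspose (H - Hᴴ) Hᴴ
      rw [conjTranspose_sub, conjTranspose_conjTranspose, ← neg_sub, trInner_comm,
        trInner_neg_right, trInner_comm, h1] at h
      linarith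
    have h3 : ‖H - Hᴴ‖ ^ 2 = 0 := by
      rw [← trInner_self, trInner_sub_right, h1, h2, sub_zero]
    have h4 : H - Hᴴ = 0 := norm_eq_zero.mp (pow_eq_zero_iff two_ne_zero |>.mp h3)
    exact (sub_eq_zero.mp h4).symm
  · rw [quadForm_eq_trInner]
    refine trInner_eq_zero_of_mem_psdLineality (fun Y hY => ?_) hH
    rw [← quadForm_eq_trInner, ← quadForm_eq_trInner]
    refine le_trans (le_of_eq ?_) (hY.quadForm_nonneg b)
    rw [quadForm, hb, dotProduct_zero, map_zero]

theorem IsSVD.mulVec_right_eq_zero {n₁ n₂ : ℕ} {X : Matrix (Fin n₁) (Fin n₂) 𝕜}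
    {U : Matrix (Fin n₁) (Fin n₁) 𝕜} {W : Matrix (Fin n₂) (Fin n₂) 𝕜} (h : IsSVD X U W)
    {j : Fin n₂} (hj : X.rank ≤ j.val) : X *ᵥ (fun i => W i j) = 0 := by
  obtain ⟨hU, hW, hX⟩ := h
  have h1 : X * W = U * rectDiag 𝕜 (singVals X) := by
    nth_rewrite 1 [hX]
    rw [Matrix.mul_assoc, conjTranspose_mul_self_of_mem hW, Matrix.mul_one]
  ext i
  have h2 : (X *ᵥ fun i => W i j) i = (X * W) i j := rfl
  rw [h2, h1, Matrix.mul_apply, Pi.zero_apply]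
  refine Finset.sum_eq_zero fun k _ => ?_
  by_cases hkj : k.val = j.val
  · have h3 : singVals X ⟨k.val, lt_min k.isLt (hkj ▸ j.isLt)⟩ = 0 := by
      refine le_antisymm (not_lt.mp fun hpos => ?_) (singVals_nonneg X _)
      rw [singVals_pos_iff] at hpos
      simp only at hpos
      omega
    simp only [rectDiag, of_apply, dif_pos hkj, h3, RCLike.ofReal_zero, mul_zero]
  · simp only [rectDiag, of_apply, dif_neg hkj, mul_zero]

theorem IsSVD.mulVec_left_eq_zero {n₁ n₂ : ℕ} {X : Matrix (Fin n₁) (Fin n₂) 𝕜}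
    {U : Matrix (Fin n₁) (Fin n₁) 𝕜} {W : Matrix (Fin n₂) (Fin n₂) 𝕜} (h : IsSVD X U W)
    {i : Fin n₁} (hi : X.rank ≤ i.val) : Xᴴ *ᵥ (fun k => U k i) = 0 := by
  obtain ⟨hU, hW, hX⟩ := h
  have h1 : Uᴴ * X = rectDiag 𝕜 (singVals X) * Wᴴ := by
    nth_rewrite 1 [hX]
    rw [Matrix.mul_assoc, ← Matrix.mul_assoc, conjTranspose_mul_self_of_mem hU, Matrix.one_mul]
  ext j
  have h2 : (Xᴴ *ᵥ fun k => U k i) j = star ((Uᴴ * X) i j) := by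
    simp [mulVec, dotProduct, Matrix.mul_apply, mul_comm]
  rw [h2, h1, Matrix.mul_apply, Pi.zero_apply, star_eq_zero]
  refine Finset.sum_eq_zero fun k _ => ?_
  by_cases hki : i.val = k.val
  · have h3 : singVals X ⟨i.val, lt_min i.isLt (hki ▸ k.isLt)⟩ = 0 := by
      refine le_antisymm (not_lt.mp fun hpos => ?_) (singVals_nonneg X _)
      rw [singVals_pos_iff] at hpos
      simp only at hpos
      omega
    simp only [rectDiag, of_apply, dif_pos hki, h3, RCLike.ofReal_zero, zero_mul]
  · simp only [rectDiag, of_apply, dif_neg hki, zero_mul]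

/-- For Hermitian `X` the trailing columns of both `U` and `W` lie in the kernel of `X`, though they
may be different bases. Polarization covers the mixed products. -/
theorem kerVanishing_subset_tangentSpace {X : Matrix (Fin n) (Fin n) 𝕜} (hX : X.IsHermitian) :
    (kerVanishing X : Set (Matrix (Fin n) (Fin n) 𝕜)) ⊆ tangentSpace (hermitianSpace 𝕜 n) X := by
  intro K hK
  refine ⟨hK.1, fun U W h => ?_⟩
  ext ⟨i, hi⟩ ⟨j, hj⟩
  have h1 := h.mulVec_left_eq_zero hi
  rw [hX.eq] at h1
  have h2 := dotProduct_mulVec_eq_zero_of_mem_kerVanishing hK h1 (h.mulVec_right_eq_zero hj)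
  rw [Matrix.mul_assoc, Matrix.mul_apply]
  exact h2

end QuadraticForm

/-! ### Eigenvalue decompositions and descent inside the semidefinite cone -/

section PSD

variable {𝕜 : Type*} [RCLike 𝕜] {n d : ℕ}

theorem diagonal_eq_rectDiag (x : Fin n → ℝ) :
    (diagonal fun i => ((x i : ℝ) : 𝕜)) = rectDiag 𝕜 (n₁ := n) (n₂ := n) fun k => x (rowIdx k) := by
  ext i j
  by_cases h : i = j
  · subst h
    simp [rectDiag, rowIdx]
  · have h' : ¬ i.val = j.val := fun h' => h (Fin.ext h')
    simp [rectDiag, h, h']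

theorem sum_rowIdx (x : Fin n → ℝ) :
    ∑ k : Fin (min n n), x (rowIdx k) = ∑ i, x i :=
  Fintype.sum_equiv (finCongr (min_self n)) _ _ fun _ => rfl

theorem isContraction_one : IsContraction (1 : Matrix (Fin n) (Fin n) 𝕜) :=
  isContraction_of_unitary (one_mem _)

theorem _root_.Matrix.IsHermitian.eq_mul_diagonal_mul {X : Matrix (Fin n) (Fin n) 𝕜}
    (hX : X.IsHermitian) :
    X = (hX.eigenvectorUnitary : Matrix (Fin n) (Fin n) 𝕜) *
      diagonal (fun i => ((hX.eigenvalues i : ℝ) : 𝕜)) *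
        (hX.eigenvectorUnitary : Matrix (Fin n) (Fin n) 𝕜)ᴴ := by
  have h := hX.spectral_theorem
  rw [Unitary.conjStarAlgAut_apply] at h
  exact h

/-- The identity is a contraction, which gives one inequality. The eigenvalue decomposition, whose
entries are nonnegative with sum the trace, gives the other. -/
theorem _root_.Matrix.PosSemidef.nuclearNorm_eq {X : Matrix (Fin n) (Fin n) 𝕜}
    (hX : X.PosSemidef) : nuclearNorm X = trInner 1 X := by
  refine le_antisymm ?_ (isContraction_one.trInner_le_nuclearNorm X)
  have hU := hX.1.eigenvectorUnitary.2
  have h1 := nuclearNorm_le_sum (𝕜 := 𝕜) hU hU (fun k => hX.1.eigenvalues (rowIdx k))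
  rw [← diagonal_eq_rectDiag, ← hX.1.eq_mul_diagonal_mul,
    sum_rowIdx fun i => |hX.1.eigenvalues i|] at h1
  refine h1.trans (le_of_eq ?_)
  rw [trInner, conjTranspose_one, Matrix.one_mul, hX.1.trace_eq_sum_eigenvalues, map_sum]
  exact Finset.sum_congr rfl fun i _ => by
    rw [abs_of_nonneg (hX.eigenvalues_nonneg i), RCLike.ofReal_re]

theorem isClosed_feasiblePSD {Θ : Fin d → Matrix (Fin n) (Fin n) 𝕜} {α : Finset (Fin d)}
    {Xbar : Matrix (Fin n) (Fin n) 𝕜} : IsClosed (feasiblePSD Θ α Xbar) :=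
  isClosed_feasible.inter isClosed_posSemidef

/-- The direction is `K - E k + η • 1`, with `E k` an eigenprojection of `X` poorly aligned with the
polar factor of `Xbar`. On the kernel of `X` the form of `E k` vanishes and that of `K` is below
`η`, so `η • 1` makes the direction point into the cone. The nuclear norm is the trace there, hence
exactly linear. -/
theorem hasRankDescent_feasiblePSD {Θ : Fin d → Matrix (Fin n) (Fin n) 𝕜}
    {α : Finset (Fin d)} {Xbar : Matrix (Fin n) (Fin n) 𝕜}
    (hΘ : IsONBasis (hermitianSpace 𝕜 n) Θ) (hXbar : Xbar.PosSemidef)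
    (hnd : ConstraintNondegPSD Θ α Xbar) :
    HasRankDescent (hermitianSpace 𝕜 n) (feasiblePSD Θ α Xbar) Xbar := by
  have hnd' : coeffs Θ α '' (kerVanishing Xbar : Set (Matrix (Fin n) (Fin n) 𝕜)) = Set.univ :=
    Set.univ_subset_iff.mp
      (hnd.symm.subset.trans (Set.image_mono (psdLineality_subset_kerVanishing hXbar)))
  obtain ⟨s, hs, hmin⟩ := exists_pos_le_singVals Xbar
  obtain ⟨C₀, hC₀, hpre⟩ := exists_bounded_preimage (kerVanishing Xbar) hnd'
  obtain ⟨c, hc, hnear⟩ := exists_abs_trInner_sub_polarFactor_le Xbar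
  -- The identity norms `Xbar` with zero duality gap, so it agrees exactly with the polar factor on
  -- tangent directions.
  have hpolar : ∀ K ∈ kerVanishing Xbar, trInner (polarFactor Xbar) K = trInner 1 K := by
    intro K hK
    have h := hnear 1 isContraction_one _ K (kerVanishing_subset_tangentSpace hXbar.1 hK)
    rw [hXbar.nuclearNorm_eq, sub_self, Real.sqrt_zero, mul_zero, zero_mul] at h
    linarith [abs_eq_zero.mp (le_antisymm h (abs_nonneg _))]
  set κ : ℝ := 1 / (Xbar.rank + 1) with hκ
  have hκ0 : 0 < κ := by positivity
  set M : ℝ := |trInner 1 (1 : Matrix (Fin n) (Fin n) 𝕜) - trInner (polarFactor Xbar) 1| + 1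
  have hM0 : 0 < M := by positivity
  -- Adding `η • 1` then costs at most half of the descent rate `κ`.
  set η : ℝ := κ / (2 * M) with hη
  have hη0 : 0 < η := by positivity
  set N : ℝ := 1 + η * ‖(1 : Matrix (Fin n) (Fin n) 𝕜)‖ with hN
  have hN0 : 0 ≤ N := by positivity
  obtain ⟨δ, hδ, hsmall⟩ := exists_abs_quadForm_lt Xbar (C₀ * N) hη0
  refine ⟨κ / 2, half_pos hκ0, C₀ * N + N, by positivity, min s (δ / (n + 1)), by positivity,
    fun X hX hclose hrk => ?_⟩
  have hge := rank_le_rank_of_norm_sub_lt hmin (hclose.trans_le (min_le_left _ _))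
  have hdist : ‖X - Xbar‖ < δ / (n + 1) := hclose.trans_le (min_le_right _ _)
  have hgt : Xbar.rank < X.rank := lt_of_le_of_ne hge (Ne.symm hrk)
  have hXp : X.PosSemidef := hX.2
  set U := (hXp.1.eigenvectorUnitary : Matrix (Fin n) (Fin n) 𝕜) with hUdef
  have hU : U ∈ unitaryGroup (Fin n) 𝕜 := hXp.1.eigenvectorUnitary.2
  set ev := hXp.1.eigenvalues with hev
  have hXeq : X = U * diagonal (fun i => ((ev i : ℝ) : 𝕜)) * Uᴴ := hXp.1.eq_mul_diagonal_mul
  set D : Fin n → Matrix (Fin n) (Fin n) 𝕜 := fun k =>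
    diagonal fun i => (((Pi.single k 1 : Fin n → ℝ) i : ℝ) : 𝕜) with hD
  set E : Fin n → Matrix (Fin n) (Fin n) 𝕜 := fun k => U * D k * Uᴴ with hE
  have hDherm : ∀ k, (D k)ᴴ = D k := by
    intro k
    rw [hD, diagonal_conjTranspose]
    congr 1
    ext i
    simp
  have hEherm : ∀ k, (E k).IsHermitian := by
    intro k
    change (U * D k * Uᴴ)ᴴ = U * D k * Uᴴ
    rw [conjTranspose_mul, conjTranspose_mul, conjTranspose_conjTranspose, hDherm,
      Matrix.mul_assoc]
  have hEnorm : ∀ k, ‖E k‖ = 1 := by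
    intro k
    have h1 : ‖E k‖ ^ 2 = 1 := by
      rw [hE, norm_mul_unitary (conjTranspose_mem hU), norm_unitary_mul hU, hD,
        show (fun k => diagonal fun i => (((Pi.single k 1 : Fin n → ℝ) i : ℝ) : 𝕜)) k =
          diagonal fun i => (((Pi.single k 1 : Fin n → ℝ) i : ℝ) : 𝕜) from rfl,
        diagonal_eq_rectDiag, norm_rectDiag_sq,
        sum_rowIdx fun i => (Pi.single k 1 : Fin n → ℝ) i ^ 2]
      simp [Pi.single_apply, ite_pow]
    exact (pow_eq_one_iff_of_nonneg (norm_nonneg _) two_ne_zero).mp h1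
  have hEtr : ∀ k, trInner 1 (E k) = 1 := by
    intro k
    rw [trInner, conjTranspose_one, Matrix.one_mul, hE, Matrix.trace_mul_comm,
      ← Matrix.mul_assoc, conjTranspose_mul_self_of_mem hU, Matrix.one_mul, hD, trace_diagonal]
    simp [Pi.single_apply]
  have hEker : ∀ k, ev k ≠ 0 → ∀ b, X *ᵥ b = 0 → E k *ᵥ b = 0 := by
    intro k hk b hb
    have h1 : diagonal (fun i => ((ev i : ℝ) : 𝕜)) *ᵥ (Uᴴ *ᵥ b) = 0 := by
      have h2 : Uᴴ *ᵥ (X *ᵥ b) = 0 := by rw [hb, mulVec_zero]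
      nth_rewrite 1 [hXeq] at h2
      rwa [mulVec_mulVec, Matrix.mul_assoc, ← Matrix.mul_assoc Uᴴ,
        conjTranspose_mul_self_of_mem hU, Matrix.one_mul, ← mulVec_mulVec] at h2
    have h3 : (Uᴴ *ᵥ b) k = 0 := by
      have h4 := congrFun h1 k
      rw [mulVec_diagonal, Pi.zero_apply] at h4
      exact (mul_eq_zero.mp h4).resolve_left (by exact_mod_cast hk)
    have h5 : D k *ᵥ (Uᴴ *ᵥ b) = 0 := by
      ext i
      rw [hD, mulVec_diagonal, Pi.zero_apply]
      by_cases hik : i = k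
      · rw [hik, h3, mul_zero]
      · simp [Pi.single_eq_of_ne hik]
    rw [hE, ← mulVec_mulVec, ← mulVec_mulVec, h5, mulVec_zero]
  -- A nonzero eigenvalue ensures that `E k` kills the kernel of `X`; the number of such indices is
  -- the rank of `X`.
  obtain ⟨k, hk, hkle⟩ : ∃ k ∈ Finset.univ.filter fun k => ev k ≠ 0,
      trInner (polarFactor Xbar) (E k) ≤ 1 - κ := by
    refine exists_trInner_polarFactor_le ?_ Xbar ?_
    · have h1 : ∑ k ∈ Finset.univ.filter (fun k => ev k ≠ 0), E k =
          U * rectDiag 𝕜 (fun j => if ev (rowIdx j) ≠ 0 then 1 else 0) * Uᴴ := by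
        rw [← diagonal_eq_rectDiag fun i => if ev i ≠ 0 then 1 else 0, hE, ← Matrix.sum_mul,
          ← Matrix.mul_sum]
        congr 2
        ext i j
        rw [Matrix.sum_apply]
        by_cases hij : i = j
        · subst hij
          simp [hD, Pi.single_apply, apply_ite]
        · simp [hD, hij]
      rw [h1]
      refine isContraction_unitary_rectDiag hU hU fun j => ?_
      split_ifs <;> simp
    · rwa [← Fintype.card_subtype, ← hXp.1.rank_eq_card_non_zero_eigs]
  have hkne : ev k ≠ 0 := (Finset.mem_filter.mp hk).2
  set Y := E k - η • (1 : Matrix (Fin n) (Fin n) 𝕜) with hY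
  have hYn : ‖Y‖ ≤ N := by
    refine (norm_sub_le _ _).trans ?_
    rw [hEnorm, norm_smul, Real.norm_of_nonneg hη0.le]
  have hYherm : Y ∈ hermitianSpace 𝕜 n :=
    (hermitianSpace 𝕜 n).sub_mem (hEherm k)
      ((hermitianSpace 𝕜 n).smul_mem η (isHermitian_one (n := Fin n) (α := 𝕜)))
  obtain ⟨K, hKT, hKα, hKn⟩ := hpre (coeffs Θ α Y)
  have hKn' : ‖K‖ ≤ C₀ * N := by
    refine hKn.trans (mul_le_mul_of_nonneg_left ((pi_norm_le_iff_of_nonneg hN0).mpr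
      fun j => (hΘ.abs_trInner_le j _).trans hYn) hC₀)
  have hHV : K - Y ∈ hermitianSpace 𝕜 n := (hermitianSpace 𝕜 n).sub_mem hKT.1 hYherm
  -- A kernel vector of `X` is almost in the kernel of `Xbar`, since `Xbar *ᵥ b = (Xbar - X) *ᵥ b`;
  -- therefore `K`, chosen relative to `Xbar`, has a small form on it.
  have hpos : ∀ b, ‖b‖ = 1 → X *ᵥ b = 0 → 0 < quadForm (K - Y) b := by
    intro b hb hXb
    have h1 : |quadForm K b| < η := by
      refine hsmall K hKT hKn' b hb ?_
      have h2 : Xbar *ᵥ b = (Xbar - X) *ᵥ b := by rw [sub_mulVec, hXb, sub_zero]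
      rw [h2]
      refine (norm_mulVec_le_card_mul _ _).trans_lt ?_
      rw [hb, mul_one, norm_sub_rev]
      rw [lt_div_iff₀ (by positivity)] at hdist
      linarith [norm_nonneg (X - Xbar)]
    have h3 : quadForm (E k) b = 0 := by
      rw [quadForm, hEker k hkne b hXb, dotProduct_zero, map_zero]
    have h4 := mul_le_mul_of_nonneg_left (le_quadForm_one (𝕜 := 𝕜) hb) hη0.le
    rw [quadForm_sub, hY, quadForm_sub, quadForm_smul, h3]
    linarith [neg_abs_le (quadForm K b)]
  obtain ⟨t₀, ht₀, hpsd⟩ := hXp.exists_add_smul_posSemidef hHV hpos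
  refine ⟨K - Y, hHV, (norm_sub_le _ _).trans (add_le_add hKn' hYn), t₀, ht₀,
    fun t ht htle => ⟨⟨⟨?_, ?_⟩, hpsd t ht htle⟩, ?_⟩⟩
  · exact (hermitianSpace 𝕜 n).add_mem hX.1.1 ((hermitianSpace 𝕜 n).smul_mem t hHV)
  · rw [coeffs_add, coeffs_smul, coeffs_sub, hKα, sub_self, smul_zero, add_zero, hX.1.2]
  · rw [(hpsd t ht htle).nuclearNorm_eq, hXp.nuclearNorm_eq, trInner_add_right,
      trInner_smul_right, add_sub_cancel_left]
    refine mul_le_mul_of_nonneg_left ?_ ht.le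
    have h1 : η * (trInner 1 (1 : Matrix (Fin n) (Fin n) 𝕜) - trInner (polarFactor Xbar) 1) ≤
        κ / 2 := by
      have h2 : trInner 1 (1 : Matrix (Fin n) (Fin n) 𝕜) - trInner (polarFactor Xbar) 1 ≤ M :=
        (le_abs_self _).trans (le_add_of_nonneg_right zero_le_one)
      calc _ ≤ η * M := by gcongr
        _ = κ / 2 := by rw [hη]; field_simp
    rw [hY]
    simp only [trInner_sub_right, trInner_smul_right, hEtr, hpolar K hKT]
    linarith

/-- On the cone the two objectives coincide, so the semidefinite problem becomes an instance of the
common argument with a smaller feasible set. -/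
theorem objectivePSD_eq {X : Matrix (Fin n) (Fin n) 𝕜} (hX : X.PosSemidef)
    (Θ : Fin d → Matrix (Fin n) (Fin n) 𝕜) (Xbar : Matrix (Fin n) (Fin n) 𝕜) (ν : ℝ) (m : ℕ)
    (ω : ℕ → Fin d) (ξ : ℕ → ℝ) (ρ γ : ℝ) (G Xt : Matrix (Fin n) (Fin n) 𝕜) :
    objectivePSD Θ Xbar ν m ω ξ ρ γ G Xt X = objective Θ Xbar ν m ω ξ ρ γ G Xt X := by
  rw [objectivePSD, objective, hX.nuclearNorm_eq, trInner_sub_left]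

theorem Solves.congr {E : Type*} {Φ Ψ : E → ℝ} {S : Set E} {X : E} (h : Solves Φ S X)
    (heq : ∀ Y ∈ S, Φ Y = Ψ Y) : Solves Ψ S X := by
  have hiff : ∀ Y, IsMinimizer Φ S Y ↔ IsMinimizer Ψ S Y := fun Y =>
    and_congr_right fun hY => forall₂_congr fun Z hZ => by rw [heq Y hY, heq Z hZ]
  rintro ⟨Y, hY⟩
  exact (hiff X).mp (h ⟨Y, (hiff Y).mpr hY⟩)

end PSD

end RankCorrection

/-! ### Rank consistency in the rectangular and semidefinite cases -/

theorem mainTheorem12 {𝕜 : Type*} [RCLike 𝕜]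
    {Ω : Type*} [MeasurableSpace Ω] (μ : Measure Ω) [IsProbabilityMeasure μ]
    {d : ℕ} (α : Finset (Fin d)) (p : Fin d → ℝ) (ω : ℕ → Ω → Fin d) (ξ : ℕ → Ω → ℝ)
    (hsamp : RankCorrection.IsSampling μ α p ω ξ) (ν : ℝ) (hν : 0 < ν)
    (ρ : ℕ → ℝ) (hρpos : ∀ m, 0 < ρ m) (hρ0 : Tendsto ρ atTop (𝓝 0))
    (hρ : Tendsto (fun m : ℕ => √(m : ℝ) * ρ m) atTop atTop)
    (γ : ℕ → Ω → ℝ) (hγmeas : ∀ m, Measurable (γ m)) (hγ0 : ∀ m a, 0 ≤ γ m a)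
    (hγ : RankCorrection.BoundedInProb μ γ) :
    -- the rectangular case
    (∀ (n₁ n₂ : ℕ) (V : Submodule ℝ (Matrix (Fin n₁) (Fin n₂) 𝕜))
        (_ : RankCorrection.IsMatrixSpace 𝕜 V)
        (Θ : Fin d → Matrix (Fin n₁) (Fin n₂) 𝕜) (_ : RankCorrection.IsONBasis V Θ)
        (Xbar : Matrix (Fin n₁) (Fin n₂) 𝕜) (_ : Xbar ∈ V) (_ : 1 ≤ Xbar.rank)
        (_ : RankCorrection.ConstraintNondeg V Θ α Xbar)
        (Xtilde : ℕ → Ω → Matrix (Fin n₁) (Fin n₂) 𝕜)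
        (_ : ∀ m, RankCorrection.MeasurableMatrix (Xtilde m)) (_ : ∀ m a, Xtilde m a ∈ V)
        (_ : TendstoInMeasure μ Xtilde atTop (fun _ => Xbar)),
      ∀ τ : ℝ, 0 < τ → ∃ εbar : ℝ, 0 < εbar ∧ ∀ ε : ℝ, 0 < ε → ε ≤ εbar →
        ∀ Xhat : ℕ → Ω → Matrix (Fin n₁) (Fin n₂) 𝕜,
          (∀ m, RankCorrection.MeasurableMatrix (Xhat m)) →
          (∀ m, 1 ≤ m → ∀ᵐ a ∂μ, RankCorrection.Solves
            (RankCorrection.objective Θ Xbar ν m (fun i => ω i a) (fun i => ξ i a) (ρ m) (γ m a)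
              (RankCorrection.rankCorr τ ε (Xtilde m a)) (Xtilde m a))
            (RankCorrection.feasible V Θ α Xbar) (Xhat m a)) →
          RankCorrection.RankConsistent μ Xhat Xbar) ∧
    -- the positive semidefinite case
    (∀ (n : ℕ) (Θ : Fin d → Matrix (Fin n) (Fin n) 𝕜)
        (_ : RankCorrection.IsONBasis (RankCorrection.hermitianSpace 𝕜 n) Θ)
        (Xbar : Matrix (Fin n) (Fin n) 𝕜) (_ : Xbar.PosSemidef) (_ : 1 ≤ Xbar.rank)
        (_ : RankCorrection.ConstraintNondegPSD Θ α Xbar)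
        (Xtilde : ℕ → Ω → Matrix (Fin n) (Fin n) 𝕜)
        (_ : ∀ m, RankCorrection.MeasurableMatrix (Xtilde m))
        (_ : ∀ m a, (Xtilde m a).PosSemidef)
        (_ : TendstoInMeasure μ Xtilde atTop (fun _ => Xbar)),
      ∀ τ : ℝ, 0 < τ → ∃ εbar : ℝ, 0 < εbar ∧ ∀ ε : ℝ, 0 < ε → ε ≤ εbar →
        ∀ Xhat : ℕ → Ω → Matrix (Fin n) (Fin n) 𝕜,
          (∀ m, RankCorrection.MeasurableMatrix (Xhat m)) →
          (∀ m, 1 ≤ m → ∀ᵐ a ∂μ, RankCorrection.Solves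
            (RankCorrection.objectivePSD Θ Xbar ν m (fun i => ω i a) (fun i => ξ i a) (ρ m)
              (γ m a) (RankCorrection.rankCorr τ ε (Xtilde m a)) (Xtilde m a))
            (RankCorrection.feasiblePSD Θ α Xbar) (Xhat m a)) →
          RankCorrection.RankConsistent μ Xhat Xbar) := by
  refine ⟨?_, ?_⟩
  · intro n₁ n₂ V hV Θ hΘ Xbar hXbar hrank hnd Xtilde _ _ hXt τ hτ
    obtain ⟨ε₀, hε₀, h⟩ := RankCorrection.exists_rankConsistent_of_hasRankDescent hsamp hν hρpos
      hρ0 hρ hγ0 hγ hΘ hXbar hrank subset_rfl RankCorrection.isClosed_feasible ⟨hXbar, rfl⟩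
      (RankCorrection.hasRankDescent_feasible hV hΘ hnd) hXt hτ
    exact ⟨ε₀, hε₀, fun ε hε hle Xhat _ hsol => h ε hε hle Xhat hsol⟩
  · intro n Θ hΘ Xbar hXbar hrank hnd Xtilde _ _ hXt τ hτ
    obtain ⟨ε₀, hε₀, h⟩ := RankCorrection.exists_rankConsistent_of_hasRankDescent hsamp hν hρpos
      hρ0 hρ hγ0 hγ hΘ (S := RankCorrection.feasiblePSD Θ α Xbar) hXbar.1 hrank (fun _ hX => hX.1)
      RankCorrection.isClosed_feasiblePSD ⟨⟨hXbar.1, rfl⟩, hXbar⟩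
      (RankCorrection.hasRankDescent_feasiblePSD hΘ hXbar hnd) hXt hτ
    refine ⟨ε₀, hε₀, fun ε hε hle Xhat _ hsol => h ε hε hle Xhat fun m hm => ?_⟩
    filter_upwards [hsol m hm] with a ha
    exact ha.congr fun Y hY => RankCorrection.objectivePSD_eq hY.2 _ _ _ _ _ _ _ _ _ _
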